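/- **Conventions.** Let $K$ be a field, $n\ge 2$ and $m$ integers, $Q$ a finite quiver, and $KQ$ its path algebra, graded by path length. Let $I\subseteq KQ$ be a homogeneous two-sided ideal generated by its elements of degree $\ge n$, and put $\Lambda=KQ/I$ (a graded quotient of a path algebra with relations of degree $\ge n$). Let $I_n^\perp\subseteq KQ_n^{op}$ be the orthogonal of $I_n=I\cap KQ_n$ with respect to the canonical pairing $KQ_n^{op}\otimes KQ_n\to KQ_0$, $q^o\otimes p\mapsto\delta_{p,q}e_{t(p)}$ for paths $p,q$ of length $n$, and let $\Lambda^!=KQ^{op}/\langle I_n^\perp\rangle$ be the $n$-homogeneous dual algebra; $\Lambda^!_0=\Lambda_0=KQ_0$ and $\otimes=\otimes_{\Lambda_0}$. Modules are right modules, $Gr_A$ is the category of $\mathbb Z$-graded right $A$-modules with morphisms of degree $0$, $M[k]_i=M_{k+i}$, and $C(Gr_A)$ is the category of cochain complexes in $Gr_A$. Let $\mathcal U=n\mathbb Z\cup(n\mathbb Z+1)$, $\mathcal S=m+\mathcal U$ and $(\mathcal S:\mathcal U)=\{i\in\mathbb Z: i+\mathcal U\subseteq\mathcal S\}$ (this is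 $m+n\mathbb Z$ if $n>2$, and $\mathbb Z$ if $n=2$). Let $\Lambda^!_{\mathcal U}=\bigoplus_{u\in\mathcal U}\Lambda^!_u$ be the graded algebra in which the product of homogeneous elements is their product in $\Lambda^!$ if its degree lies in $\mathcal U$, and $0$ otherwise. A graded module $M$ is *generated* (resp. *cogenerated*) in degrees belonging to $\mathcal X\subseteq\mathbb Z$ if every nonzero graded factor (resp. graded submodule) of $M$ has a support that meets $\mathcal X$. It is *presented* in degrees belonging to $\mathcal X$ if it is the cokernel of a morphism between projective graded modules that are generated in degrees belonging to $\mathcal X$. The graded socle is $Soc(M)=\{x\in M: x\Lambda_j=0\text{ for all } j>0\}$. With $D(\Lambda)_i=Hom_K(\Lambda_{-i},K)$, a graded $\Lambda$-module is *almost injective* if it is a direct summand of a direct sum of modules of the form $D(\Lambda)[k]$, $k\in\mathbb Z$. A *linear $n$-complex* of almost injective modules is a sequence of morphisms $d^k:I^k\to I^{k+1}$ ($k\in\mathbb Z$) in $Gr_\Lambda$ such that $d^{k+n-1}\circ\dots\circ d^k=0$ and $I^k$ is almost injective and cogenerated in degree $-k$, for all $k$. Let $\delta_m(2k)=m+kn$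 and $\delta_m(2k+1)=m+kn+1$. Then $H_m(I^\cdot)\in C(Gr_\Lambda)$ is the complex with $\tilde I^j=I^{\delta_m(j)}$, $\tilde d^{2j}=d^{m+jn}$ and $\tilde d^{2j+1}=d^{m+(j+1)n-1}\circ\dots\circ d^{m+jn+1}$. A complex in $C(Gr_\Lambda)$ is *$H_m$-liftable* if it is isomorphic to $H_m(I^\cdot)$ for some linear $n$-complex $I^\cdot$ of almost injective modules. For $X\in Gr_{\Lambda^!_{\mathcal U}}$ and $u\in\mathcal U$ let $\mu_{i,u}:X_i\otimes\Lambda^!_u\to X_{i+u}$ be the multiplication map, and let $Ker(\mu_{i,1})\Lambda^!_{n-1}\subseteq X_i\otimes\Lambda^!_n$ be the subspace spanned by the images of the elements of $Ker(\mu_{i,1})\subseteq X_i\otimes\Lambda^!_1$ under the maps $x\otimes a\mapsto x\otimes ab$, $b\in\Lambda^!_{n-1}$. **Theorem.** The following two categories are equivalent: 1. the full subcategory $\mathcal L(\mathcal S,\mathcal U)$ of $Gr_{\Lambda^!_{\mathcal U}}$ whose objects are the $X$ that are generated in degrees belonging to $(\mathcal S:\mathcal U)$ and satisfy $Ker(\mu_{m+kn,1})\Lambda^!_{n-1}\subseteq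 Ker(\mu_{m+kn,n})$ for all $k\in\mathbb Z$; 2. the full subcategory $\mathcal Y(\mathcal S,\mathcal U)$ of $C(Gr_\Lambda)$ whose objects are the $H_m$-liftable complexes $(\tilde I^\cdot,\tilde d^\cdot)$ that satisfy condition (a) if $n=2$, and both conditions (a) and (b) if $n>2$: (a) $\tilde I^j$ is almost injective and cogenerated in degree $-\delta_m(j)$, for all $j\in\mathbb Z$; (b) $Soc(\tilde I^{2j+1})\subseteq Im(\tilde d^{2j})$, for all $j\in\mathbb Z$. Moreover, $\mathcal L(\mathcal S,\mathcal U)$ contains all graded $\Lambda^!_{\mathcal U}$-modules that are presented in degrees belonging to $(\mathcal S:\mathcal U)$. -/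

import Mathlib

open CategoryTheory
open scoped TensorProduct

universe u

namespace GrDual

/-! ## Graded algebras

A `ℤ`-graded `K`-algebra `A = ⨁ A_i` is recorded by its homogeneous components. To avoid casts, the
multiplication `A_i × A_j → A_k` is indexed by a proof of `i + j = k`. -/

/-- A (unital, associative) `ℤ`-graded `K`-algebra. -/
structure GrAlg (K : Type u) [Field K] where
  comp : ℤ → Type u
  [acg : ∀ i, AddCommGroup (comp i)]
  [mod : ∀ i, Module K (comp i)]
  one : comp 0
  mul : ∀ {i j k : ℤ}, i + j = k → comp i →ₗ[K] comp j →ₗ[K] comp k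
  one_mul : ∀ {i : ℤ} (h : 0 + i = i) (a : comp i), mul h one a = a
  mul_one : ∀ {i : ℤ} (h : i + 0 = i) (a : comp i), mul h a one = a
  mul_assoc : ∀ {i j k ij jk l : ℤ} (h₁ : i + j = ij) (h₂ : ij + k = l) (h₃ : j + k = jk)
    (h₄ : i + jk = l) (a : comp i) (b : comp j) (c : comp k),
    mul h₂ (mul h₁ a b) c = mul h₄ a (mul h₃ b c)

attribute [instance] GrAlg.acg GrAlg.mod

namespace GrAlg

variable {K : Type u} [Field K]

/-- The opposite graded algebra. -/
def op (A : GrAlg K) : GrAlg K where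
  comp := A.comp
  one := A.one
  mul := fun {i j k} h => (A.mul (i := j) (j := i) (k := k) (by omega)).flip
  one_mul := fun h a => A.mul_one (by omega) a
  mul_one := fun h a => A.one_mul (by omega) a
  mul_assoc := fun h₁ h₂ h₃ h₄ a b c =>
    (A.mul_assoc (by omega) (by omega) (by omega) (by omega) c b a).symm

/-- A homogeneous (graded) two-sided ideal. -/
@[ext]
structure HomIdeal (A : GrAlg K) where
  comp : ∀ i : ℤ, Submodule K (A.comp i)
  mul_left : ∀ {i j k : ℤ} (h : i + j = k) (a : A.comp i) (x : A.comp j),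
    x ∈ comp j → A.mul h a x ∈ comp k
  mul_right : ∀ {i j k : ℤ} (h : i + j = k) (x : A.comp i) (a : A.comp j),
    x ∈ comp i → A.mul h x a ∈ comp k

/-- The two-sided ideal generated by a family `G` of sets of homogeneous elements (`G i` consists of
elements of degree `i`). -/
def span (A : GrAlg K) (G : ∀ i : ℤ, Set (A.comp i)) : HomIdeal A where
  comp := fun i => sInf {N | ∃ J : HomIdeal A, (∀ l, G l ⊆ J.comp l) ∧ N = J.comp i}
  mul_left := by
    intro i j k h a x hx
    rw [Submodule.mem_sInf] at hx ⊢
    rintro _ ⟨J, hJ, rfl⟩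
    exact J.mul_left h a x (hx _ ⟨J, hJ, rfl⟩)
  mul_right := by
    intro i j k h x a hx
    rw [Submodule.mem_sInf] at hx ⊢
    rintro _ ⟨J, hJ, rfl⟩
    exact J.mul_right h x a (hx _ ⟨J, hJ, rfl⟩)

/-- The quotient of a graded algebra by a homogeneous two-sided ideal. -/
def quot (A : GrAlg K) (J : HomIdeal A) : GrAlg K where
  comp := fun i => A.comp i ⧸ J.comp i
  one := (J.comp 0).mkQ A.one
  mul := fun {i j k} h =>
    (J.comp i).liftQ
      { toFun := fun a => (J.comp j).liftQ ((J.comp k).mkQ ∘ₗ A.mul h a) (by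
          intro x hx
          simpa using J.mul_left h a x hx)
        map_add' := by intro a b; ext x; simp
        map_smul' := by intro c a; ext x; simp }
      (by
        intro x hx
        rw [LinearMap.mem_ker]
        ext a
        simpa using J.mul_right h x a hx)
  one_mul := by
    intro i h a
    induction a using Submodule.Quotient.induction_on with
    | H a => simp [A.one_mul]
  mul_one := by
    intro i h a
    induction a using Submodule.Quotient.induction_on with
    | H a => simp [A.mul_one]
  mul_assoc := by
    intro i j k ij jk l h₁ h₂ h₃ h₄ a b c
    induction a using Submodule.Quotient.induction_on with
    | H a =>
    induction b using Submodule.Quotient.induction_on with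
    | H b =>
    induction c using Submodule.Quotient.induction_on with
    | H c => simp [A.mul_assoc h₁ h₂ h₃ h₄]

end GrAlg

/-! ## The path algebra `KQ`

The product `p q` of two paths is "first `p`, then `q`". -/

section PathAlgebra

variable (K : Type u) [Field K] (Q : Type u) [Quiver.{u} Q]

/-- The paths of length `i` in `Q` (none if `i < 0`). -/
structure PathOfLength (i : ℤ) where
  origin : Q
  terminus : Q
  path : Quiver.Path origin terminus
  length_eq : (path.length : ℤ) = i

variable {Q}

/-- The trivial path at a vertex. -/
def PathOfLength.triv (a : Q) : PathOfLength Q 0 := ⟨a, a, Quiver.Path.nil, by simp⟩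

open Classical in
/-- The product of two paths in the path algebra: their concatenation if the first one ends where
the second one starts, and `0` otherwise. -/
noncomputable def pathMul {i j k : ℤ} (h : i + j = k) (p : PathOfLength Q i)
    (q : PathOfLength Q j) : PathOfLength Q k →₀ K :=
  if e : p.terminus = q.origin then
    Finsupp.single ⟨p.origin, q.terminus, p.path.comp (q.path.cast e.symm rfl), by
      obtain ⟨a, b, p, hp⟩ := p
      obtain ⟨c, d, q, hq⟩ := q
      dsimp only at e
      subst e
      simp only [Quiver.Path.cast_rfl_rfl, Quiver.Path.length_comp, Nat.cast_add]
      omega⟩ 1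
  else 0

theorem pathMul_of_ne {i j k : ℤ} (h : i + j = k) (p : PathOfLength Q i) (q : PathOfLength Q j)
    (e : p.terminus ≠ q.origin) : pathMul K h p q = 0 :=
  dif_neg e

theorem pathMul_comp {i j k : ℤ} (h : i + j = k) {a b c : Q} (p : Quiver.Path a b)
    (q : Quiver.Path b c) (hp : (p.length : ℤ) = i) (hq : (q.length : ℤ) = j)
    (hpq : ((p.comp q).length : ℤ) = k) :
    pathMul K h ⟨a, b, p, hp⟩ ⟨b, c, q, hq⟩ = Finsupp.single ⟨a, c, p.comp q, hpq⟩ 1 :=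
  dif_pos rfl

/-- The bilinear extension of the product of paths. -/
noncomputable def pathMulLin {i j k : ℤ} (h : i + j = k) :
    (PathOfLength Q i →₀ K) →ₗ[K] (PathOfLength Q j →₀ K) →ₗ[K] (PathOfLength Q k →₀ K) :=
  Finsupp.linearCombination K fun p => Finsupp.linearCombination K fun q => pathMul K h p q

theorem pathMulLin_single {i j k : ℤ} (h : i + j = k) (p : PathOfLength Q i)
    (q : PathOfLength Q j) (x y : K) :
    pathMulLin K h (Finsupp.single p x) (Finsupp.single q y) = (x * y) • pathMul K h p q := by
  simp [pathMulLin, smul_smul]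

theorem pathMulLin_assoc {i j k ij jk l : ℤ} (h₁ : i + j = ij) (h₂ : ij + k = l) (h₃ : j + k = jk)
    (h₄ : i + jk = l) (a : PathOfLength Q i →₀ K) (b : PathOfLength Q j →₀ K)
    (c : PathOfLength Q k →₀ K) :
    pathMulLin K h₂ (pathMulLin K h₁ a b) c = pathMulLin K h₄ a (pathMulLin K h₃ b c) := by
  induction a using Finsupp.induction_linear with
  | zero => simp
  | add f g hf hg => simp only [map_add, LinearMap.add_apply, hf, hg]
  | single p x =>
  induction b using Finsupp.induction_linear with
  | zero => simp
  | add f g hf hg => simp only [map_add, LinearMap.add_apply, hf, hg]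
  | single q y =>
  induction c using Finsupp.induction_linear with
  | zero => simp
  | add f g hf hg => simp only [map_add, hf, hg]
  | single r z =>
    obtain ⟨a, b, p, hp⟩ := p
    obtain ⟨c, d, q, hq⟩ := q
    obtain ⟨e, f, r, hr⟩ := r
    rw [pathMulLin_single, pathMulLin_single]
    by_cases e₁ : b = c
    · subst e₁
      rw [pathMul_comp K h₁ p q hp hq (by rw [Quiver.Path.length_comp]; push_cast; omega)]
      by_cases e₂ : d = e
      · subst e₂
        rw [pathMul_comp K h₃ q r hq hr (by rw [Quiver.Path.length_comp]; push_cast; omega),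
          Finsupp.smul_single, Finsupp.smul_single, pathMulLin_single, pathMulLin_single,
          pathMul_comp K h₂ (p.comp q) r _ hr
            (by simp only [Quiver.Path.length_comp]; push_cast; omega),
          pathMul_comp K h₄ p (q.comp r) hp _
            (by simp only [Quiver.Path.length_comp]; push_cast; omega)]
        simp [mul_assoc]
      · rw [pathMul_of_ne K h₃ _ _ e₂, Finsupp.smul_single, pathMulLin_single,
          pathMul_of_ne K h₂ _ _ e₂]
        simp
    · rw [pathMul_of_ne K h₁ _ _ e₁]
      by_cases e₂ : d = e
      · subst e₂
        rw [pathMul_comp K h₃ q r hq hr (by rw [Quiver.Path.length_comp]; push_cast; omega),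
          Finsupp.smul_single, pathMulLin_single, pathMul_of_ne K h₄ _ _ e₁]
        simp
      · rw [pathMul_of_ne K h₃ _ _ e₂]
        simp

variable (Q)

/-- The path algebra `KQ` of a finite quiver, graded by the length of paths. -/
noncomputable def pathAlg [Fintype Q] : GrAlg K where
  comp := fun i => PathOfLength Q i →₀ K
  one := ∑ a : Q, Finsupp.single (PathOfLength.triv a) 1
  mul := fun h => pathMulLin K h
  one_mul := by
    intro i h a
    induction a using Finsupp.induction_linear with
    | zero => simp
    | add f g hf hg => rw [map_add, hf, hg]
    | single q c =>
      obtain ⟨a, b, q, hq⟩ := q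
      rw [map_sum, LinearMap.sum_apply, Finset.sum_eq_single a]
      · rw [pathMulLin_single, PathOfLength.triv,
          pathMul_comp K h Quiver.Path.nil q _ hq (by simpa using hq)]
        simp
      · intro v _ hv
        rw [pathMulLin_single, pathMul_of_ne K h _ _ hv, smul_zero]
      · simp
  mul_one := by
    intro i h a
    induction a using Finsupp.induction_linear with
    | zero => simp
    | add f g hf hg => rw [map_add, LinearMap.add_apply, hf, hg]
    | single q c =>
      obtain ⟨a, b, q, hq⟩ := q
      rw [map_sum, Finset.sum_eq_single b]
      · rw [pathMulLin_single, PathOfLength.triv, pathMul_comp K h q Quiver.Path.nil hq _ hq]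
        simp
      · intro v _ hv
        rw [pathMulLin_single, pathMul_of_ne K h _ _ (Ne.symm hv), smul_zero]
      · simp
  mul_assoc := pathMulLin_assoc K

variable {K Q} [Fintype Q]

/-- The homogeneous ideal `I` of the path algebra is generated by its elements of degree `≥ n`. -/
def RelationsOfDegreeGE (n : ℕ) (I : GrAlg.HomIdeal (pathAlg K Q)) : Prop :=
  I = (pathAlg K Q).span fun i => {x | (n : ℤ) ≤ i ∧ x ∈ I.comp i}

open Classical in
/-- The orthogonal `I_n^⊥ ⊆ KQ_n^op` of `I_n ⊆ KQ_n` with respect to the canonical pairing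
`KQ_n^op ⊗ KQ_n → KQ_0 = K^{Q_0}`, which sends `q^o ⊗ p` to `δ_{p,q} e_{t(p)}`; the condition below
says that for each vertex `b` the `b`-th coordinate of `⟨ξ, x⟩` vanishes. -/
def orthogonal (n : ℤ) (I : GrAlg.HomIdeal (pathAlg K Q)) : Set ((pathAlg K Q).op.comp n) :=
  {ξ : PathOfLength Q n →₀ K | ∀ x : PathOfLength Q n →₀ K, x ∈ I.comp n → ∀ b : Q,
    (ξ.sum fun p c => if p.terminus = b then c * x p else 0) = 0}

/-- The `n`-homogeneous dual algebra `Λ^! = KQ^op / ⟨I_n^⊥⟩` of `Λ = KQ / I`. -/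
noncomputable def dualAlg (n : ℕ) (I : GrAlg.HomIdeal (pathAlg K Q)) : GrAlg K :=
  (pathAlg K Q).op.quot
    ((pathAlg K Q).op.span fun i => {x | i = (n : ℤ) ∧ x ∈ orthogonal i I})

end PathAlgebra

/-! ## Restricting a graded algebra to a set of degrees -/

/-- The condition on `U ⊆ ℤ` which makes `⨁_{u ∈ U} A_u`, with the product of `A_u` and `A_v`
replaced by `0` when `u + v ∉ U`, a unital associative algebra. -/
structure RingSupporting (U : Set ℤ) : Prop where
  zero_mem : 0 ∈ U
  assoc : ∀ u ∈ U, ∀ v ∈ U, ∀ w ∈ U, u + v + w ∈ U → (u + v ∈ U ↔ v + w ∈ U)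

namespace GrAlg

variable {K : Type u} [Field K] (A : GrAlg K) (U : Set ℤ)

/-- The degree `i` component of `A_U`: it is `A_i` if `i ∈ U`, and `0` otherwise. -/
def part (i : ℤ) : Submodule K (A.comp i) where
  carrier := {a | i ∉ U → a = 0}
  add_mem' := by
    intro a b ha hb h
    rw [ha h, hb h, add_zero]
  zero_mem' := fun _ => rfl
  smul_mem' := by
    intro c a ha h
    rw [ha h, smul_zero]

open Classical in
/-- The projection of `A` onto `A_U` in degree `i`: the identity if `i ∈ U`, and `0` otherwise. -/
noncomputable def trunc (i : ℤ) : A.comp i →ₗ[K] A.part U i where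
  toFun := fun a => ⟨if i ∈ U then a else 0, fun h => if_neg h⟩
  map_add' := by
    intro a b
    ext
    by_cases h : i ∈ U <;> simp [h]
  map_smul' := by
    intro c a
    ext
    by_cases h : i ∈ U <;> simp [h]

variable {A U}

theorem coe_trunc_of_mem {i : ℤ} (h : i ∈ U) (a : A.comp i) : (A.trunc U i a : A.comp i) = a :=
  if_pos h

theorem trunc_of_notMem {i : ℤ} (h : i ∉ U) (a : A.comp i) : A.trunc U i a = 0 :=
  Subtype.ext (if_neg h)

theorem trunc_coe {i : ℤ} (a : A.part U i) : A.trunc U i (a : A.comp i) = a := by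
  apply Subtype.ext
  by_cases h : i ∈ U
  · exact coe_trunc_of_mem h _
  · rw [trunc_of_notMem h, a.2 h]
    rfl

variable (A)

/-- The graded algebra `A_U = ⨁_{u ∈ U} A_u`; the product of homogeneous elements is their product
in `A` if its degree lies in `U`, and `0` otherwise. -/
noncomputable def restrict (hU : RingSupporting U) : GrAlg K where
  comp := fun i => A.part U i
  one := A.trunc U 0 A.one
  mul := fun {i j k} h =>
    ((A.mul h).compl₁₂ (A.part U i).subtype (A.part U j).subtype).compr₂ (A.trunc U k)
  one_mul := by
    intro i h a
    simp [coe_trunc_of_mem hU.zero_mem, A.one_mul, trunc_coe]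
  mul_one := by
    intro i h a
    simp [coe_trunc_of_mem hU.zero_mem, A.mul_one, trunc_coe]
  mul_assoc := by
    intro i j k ij jk l h₁ h₂ h₃ h₄ a b c
    simp only [LinearMap.compr₂_apply, LinearMap.compl₁₂_apply, Submodule.subtype_apply]
    by_cases hi : i ∈ U
    swap
    · simp [a.2 hi]
    by_cases hj : j ∈ U
    swap
    · simp [b.2 hj]
    by_cases hk : k ∈ U
    swap
    · simp [c.2 hk]
    by_cases hl : l ∈ U
    swap
    · rw [trunc_of_notMem hl, trunc_of_notMem hl]
    have key : ij ∈ U ↔ jk ∈ U := by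
      have := hU.assoc i hi j hj k hk (by rwa [h₁, h₂])
      rwa [h₁, h₃] at this
    by_cases hij : ij ∈ U
    · rw [coe_trunc_of_mem hij, coe_trunc_of_mem (key.1 hij), A.mul_assoc h₁ h₂ h₃ h₄]
    · rw [trunc_of_notMem hij, trunc_of_notMem (fun h => hij (key.2 h))]
      simp

/-- The projection `A → A_U` in degree `i`. -/
noncomputable def proj (hU : RingSupporting U) (i : ℤ) : A.comp i →ₗ[K] (A.restrict hU).comp i :=
  A.trunc U i

theorem restrict_mul_proj (hU : RingSupporting U) {i j k : ℤ} (hi : i ∈ U) (hj : j ∈ U)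
    (h : i + j = k) (a : A.comp i) (b : A.comp j) :
    (A.restrict hU).mul h (A.proj hU i a) (A.proj hU j b) = A.proj hU k (A.mul h a b) := by
  change A.trunc U k (A.mul h (A.trunc U i a : A.comp i) (A.trunc U j b : A.comp j)) = _
  rw [coe_trunc_of_mem hi, coe_trunc_of_mem hj]
  rfl

theorem proj_of_notMem (hU : RingSupporting U) {i : ℤ} (hi : i ∉ U) (a : A.comp i) :
    A.proj hU i a = 0 :=
  trunc_of_notMem hi a

end GrAlg

/-! ## Graded right modules -/

section Modules

variable {K : Type u} [Field K]

/-- A `ℤ`-graded right module `M = ⨁ M_i` over the graded algebra `A`, recorded by its homogeneous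
components and the action maps `M_i × A_j → M_{i+j}`. -/
structure GrMod (A : GrAlg K) where
  comp : ℤ → Type u
  [acg : ∀ i, AddCommGroup (comp i)]
  [mod : ∀ i, Module K (comp i)]
  act : ∀ {i j k : ℤ}, i + j = k → comp i →ₗ[K] A.comp j →ₗ[K] comp k
  act_one : ∀ {i : ℤ} (h : i + 0 = i) (x : comp i), act h x A.one = x
  act_mul : ∀ {i j k ij jk l : ℤ} (h₁ : i + j = ij) (h₂ : ij + k = l) (h₃ : j + k = jk)
    (h₄ : i + jk = l) (x : comp i) (a : A.comp j) (b : A.comp k),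
    act h₂ (act h₁ x a) b = act h₄ x (A.mul h₃ a b)

attribute [instance] GrMod.acg GrMod.mod

namespace GrMod

variable {A : GrAlg K}

/-- Morphisms of graded modules: `A`-linear maps of degree `0`. -/
@[ext]
structure Hom (M N : GrMod A) where
  app : ∀ i : ℤ, M.comp i →ₗ[K] N.comp i
  comm : ∀ {i j k : ℤ} (h : i + j = k) (x : M.comp i) (a : A.comp j),
    app k (M.act h x a) = N.act h (app i x) a

/-- The category `Gr_A` of graded right `A`-modules. -/
instance : Category.{u} (GrMod A) where
  Hom := Hom
  id := fun M => ⟨fun _ => LinearMap.id, fun _ _ _ => rfl⟩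
  comp := fun f g => ⟨fun i => g.app i ∘ₗ f.app i, fun h x a => by simp [f.comm, g.comm]⟩

instance (M N : GrMod A) : Zero (M ⟶ N) :=
  ⟨(⟨fun _ => 0, fun _ _ _ => by simp⟩ : Hom M N)⟩

instance : Limits.HasZeroMorphisms (GrMod A) where
  comp_zero := by
    intro X Y f Z
    apply Hom.ext
    funext i
    exact LinearMap.zero_comp _
  zero_comp := by
    intro X Y Z f
    apply Hom.ext
    funext i
    exact LinearMap.comp_zero _

/-- The shift `M[k]`, with `M[k]_i = M_{k+i}`. -/
def shift (M : GrMod A) (k : ℤ) : GrMod A where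
  comp := fun i => M.comp (k + i)
  act := fun {i j l} h => M.act (i := k + i) (j := j) (k := k + l) (by omega)
  act_one := fun h x => M.act_one (by omega) x
  act_mul := fun h₁ h₂ h₃ h₄ x a b => M.act_mul (by omega) (by omega) h₃ (by omega) x a b

/-- A graded submodule. -/
structure Sub (M : GrMod A) where
  comp : ∀ i : ℤ, Submodule K (M.comp i)
  act_mem : ∀ {i j k : ℤ} (h : i + j = k) (x : M.comp i) (a : A.comp j),
    x ∈ comp i → M.act h x a ∈ comp k

/-- `M` is generated in degrees belonging to `T`: every nonzero factor `M/N` has a support which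
meets `T`. -/
def GeneratedIn (T : Set ℤ) (M : GrMod A) : Prop :=
  ∀ N : Sub M, (∃ i, N.comp i ≠ ⊤) → ∃ i ∈ T, N.comp i ≠ ⊤

/-- `M` is cogenerated in degrees belonging to `T`: every nonzero graded submodule has a support
which meets `T`. -/
def CogeneratedIn (T : Set ℤ) (M : GrMod A) : Prop :=
  ∀ N : Sub M, (∃ i, N.comp i ≠ ⊥) → ∃ i ∈ T, N.comp i ≠ ⊥

/-- `M` is presented in degrees belonging to `T`: it is the cokernel of a morphism between
projective objects of `Gr_A` which are generated in degrees belonging to `T`. -/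
def PresentedIn (T : Set ℤ) (M : GrMod A) : Prop :=
  ∃ (P₁ P₀ : GrMod A) (f : P₁ ⟶ P₀) (g : P₀ ⟶ M) (w : f ≫ g = 0),
    Projective P₁ ∧ Projective P₀ ∧ GeneratedIn T P₁ ∧ GeneratedIn T P₀ ∧
      Nonempty (Limits.IsColimit (Limits.CokernelCofork.ofπ g w))

/-- The degree `i` part of the graded socle `{x ∈ M : x J = 0}`, where `J = ⨁_{j > 0} A_j`. -/
def socle (M : GrMod A) (i : ℤ) : Submodule K (M.comp i) where
  carrier := {x | ∀ (j k : ℤ) (h : i + j = k), 0 < j → ∀ a : A.comp j, M.act h x a = 0}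
  add_mem' := by
    intro x y hx hy j k h hj a
    simp [hx j k h hj a, hy j k h hj a]
  zero_mem' := by
    intro j k h hj a
    simp
  smul_mem' := by
    intro c x hx j k h hj a
    simp [hx j k h hj a]

variable (A)

/-- The graded right module `D(A)`, with `D(A)_i = Hom_K(A_{-i}, K)` and `(f a)(b) = f(a b)`. When
`A_0` is a product of copies of `K`, this is `ℋom_{A_0}(A, A_0)`. -/
def D : GrMod A where
  comp := fun i => Module.Dual K (A.comp (-i))
  act := fun {i j k} h =>
    LinearMap.mk₂ K (fun f a => f ∘ₗ A.mul (i := j) (j := -k) (k := -i) (by omega) a)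
      (by intros; ext; simp) (by intros; ext; simp) (by intros; ext; simp) (by intros; ext; simp)
  act_one := by
    intro i h f
    apply LinearMap.ext
    intro b
    change f (A.mul _ A.one b) = f b
    rw [A.one_mul]
  act_mul := by
    intro i j k ij jk l h₁ h₂ h₃ h₄ f a b
    apply LinearMap.ext
    intro c
    change f (A.mul _ a (A.mul _ b c)) = f (A.mul _ (A.mul _ a b) c)
    rw [A.mul_assoc]

variable {A}

/-- Almost injective graded modules, i.e. the objects of `Add(⨁_{k ∈ ℤ} D(A)[k])`: direct summands
of (arbitrary) direct sums of shifts of `D(A)`. -/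
def AlmostInjective (M : GrMod A) : Prop :=
  ∃ (T : Type u) (k : T → ℤ) (c : Limits.Cofan fun t => (D A).shift (k t)),
    Nonempty (Limits.IsColimit c) ∧ Nonempty (Retract M c.pt)

end GrMod

end Modules

/-! ## Linear `n`-complexes and their contraction -/

section Complexes

variable {K : Type u} [Field K] {A : GrAlg K}

/-- The composition of `r` consecutive maps `d^i, d^{i+1}, …, d^{i+r-1}`. -/
def dIter {I : ℤ → GrMod A} (d : ∀ i j : ℤ, i + 1 = j → (I i ⟶ I j)) :
    ∀ (r : ℕ) (i j : ℤ), i + r = j → (I i ⟶ I j)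
  | 0, i, j, h => eqToHom (congrArg I (by simpa using h))
  | r + 1, i, j, h => d i (i + 1) rfl ≫ dIter d r (i + 1) j (by push_cast at h; omega)

theorem dIter_comp {I : ℤ → GrMod A} (d : ∀ i j : ℤ, i + 1 = j → (I i ⟶ I j)) (r s t : ℕ)
    (hrs : r + s = t) (i j k : ℤ) (h₁ : i + r = j) (h₂ : j + s = k) (h₃ : i + t = k) :
    dIter d r i j h₁ ≫ dIter d s j k h₂ = dIter d t i k h₃ := by
  induction r generalizing i t with
  | zero =>
    obtain rfl : i = j := by simpa using h₁
    obtain rfl : s = t := by omega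
    simp [dIter]
  | succ r ih =>
    obtain rfl : r + s + 1 = t := by omega
    simp only [dIter, Category.assoc]
    congr 1
    exact ih (r + s) rfl _ _ _

variable (A) in
/-- Linear `n`-complexes of almost injective graded `A`-modules: sequences of morphisms
`d^k : I^k → I^{k+1}` such that any `n` consecutive ones compose to zero and each `I^k` is almost
injective and cogenerated in degree `-k`. -/
structure LinNComplex (n : ℕ) where
  obj : ℤ → GrMod A
  d : ∀ i j : ℤ, i + 1 = j → (obj i ⟶ obj j)
  d_zero : ∀ (i j : ℤ) (h : i + n = j), dIter d n i j h = 0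
  almostInjective : ∀ k, (obj k).AlmostInjective
  cogenerated : ∀ k, (obj k).CogeneratedIn {-k}

/-- `δ_m(2k) = m + kn` and `δ_m(2k+1) = m + kn + 1`. -/
def delta (n : ℕ) (m j : ℤ) : ℤ := m + (j / 2) * n + j % 2

/-- The number of consecutive differentials that are composed at position `j`. -/
def step (n : ℕ) (j : ℤ) : ℕ := if j % 2 = 0 then 1 else n - 1

theorem delta_add_step {n : ℕ} (hn : 2 ≤ n) (m i j : ℤ) (h : i + 1 = j) :
    delta n m i + (step n i : ℤ) = delta n m j := by
  subst h
  unfold delta step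
  rcases Int.emod_two_eq_zero_or_one i with h | h
  · have h₁ : (i + 1) / 2 = i / 2 := by omega
    have h₂ : (i + 1) % 2 = 1 := by omega
    simp [h, h₁, h₂]
  · have h₁ : (i + 1) / 2 = i / 2 + 1 := by omega
    have h₂ : (i + 1) % 2 = 0 := by omega
    rw [h, h₁, h₂, if_neg one_ne_zero]
    push_cast [Nat.cast_sub (show 1 ≤ n by omega)]
    ring

theorem step_add_step {n : ℕ} (hn : 2 ≤ n) (i j : ℤ) (h : i + 1 = j) :
    step n i + step n j = n := by
  subst h
  unfold step
  rcases Int.emod_two_eq_zero_or_one i with h | h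
  · have h₂ : (i + 1) % 2 = 1 := by omega
    simp only [h, h₂, if_true, one_ne_zero, if_false]
    omega
  · have h₂ : (i + 1) % 2 = 0 := by omega
    simp only [h, h₂, if_true, one_ne_zero, if_false]
    omega

/-- The contraction `H_m(I)` of an `n`-complex: it has `I^{δ_m(j)}` in position `j`, and its
differentials are alternately `d` and the composition of `n - 1` consecutive differentials. -/
noncomputable def contraction {n : ℕ} (hn : 2 ≤ n) (m : ℤ) (I : LinNComplex A n) :
    CochainComplex (GrMod A) ℤ where
  X := fun j => I.obj (delta n m j)
  d := fun i j =>
    if h : i + 1 = j then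
      dIter I.d (step n i) (delta n m i) (delta n m j) (delta_add_step hn m i j h)
    else 0
  shape := fun i j h => dif_neg h
  d_comp_d' := by
    intro i j k hij hjk
    have h₁ : i + 1 = j := hij
    have h₂ : j + 1 = k := hjk
    have h₃ : delta n m i + (n : ℤ) = delta n m k := by
      have h₄ := congrArg (Nat.cast (R := ℤ)) (step_add_step hn i j h₁)
      push_cast at h₄
      rw [← delta_add_step hn m j k h₂, ← delta_add_step hn m i j h₁, ← h₄, add_assoc]
    rw [dif_pos h₁, dif_pos h₂, dIter_comp I.d _ _ n (step_add_step hn i j h₁) _ _ _ _ _ h₃]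
    exact I.d_zero _ _ h₃

/-- `H_m`-liftable complexes: those isomorphic in `C(Gr_A)` to the contraction of some linear
`n`-complex, i.e. the essential image of `H_m`. -/
def HLiftable {n : ℕ} (hn : 2 ≤ n) (m : ℤ) (Y : CochainComplex (GrMod A) ℤ) : Prop :=
  ∃ I : LinNComplex A n, Nonempty (contraction hn m I ≅ Y)

variable (A) in
/-- The property that defines the full subcategory `𝒴(S, U)` of `C(Gr_A)`. -/
def YProp {n : ℕ} (hn : 2 ≤ n) (m : ℤ) : ObjectProperty (CochainComplex (GrMod A) ℤ) := fun Y =>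
  HLiftable hn m Y ∧
  (∀ j, (Y.X j).AlmostInjective ∧ (Y.X j).CogeneratedIn {-delta n m j}) ∧
  (2 < n → ∀ j i : ℤ,
    (Y.X (2 * j + 1)).socle i ≤ LinearMap.range ((Y.d (2 * j) (2 * j + 1)).app i))

end Complexes

/-! ## The subcategory of modules over the restricted algebra -/

/-- `U = nℤ ∪ (nℤ + 1)`. -/
def setU (n : ℕ) : Set ℤ := {i | ∃ k : ℤ, i = k * n ∨ i = k * n + 1}

/-- `S = m + U`. -/
def setS (n : ℕ) (m : ℤ) : Set ℤ := {i | ∃ u ∈ setU n, i = m + u}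

/-- `(S : U) = {i : i + U ⊆ S}`. -/
def colon (S U : Set ℤ) : Set ℤ := {i | ∀ u ∈ U, i + u ∈ S}

theorem setU_ringSupporting {n : ℕ} (hn : 2 ≤ n) : RingSupporting (setU n) := by
  have key : ∀ i : ℤ, i ∈ setU n ↔ ((n : ℤ) ∣ i ∨ (n : ℤ) ∣ i - 1) := by
    intro i
    constructor
    · rintro ⟨k, rfl | rfl⟩
      · exact Or.inl ⟨k, by ring⟩
      · exact Or.inr ⟨k, by ring⟩
    · rintro (⟨k, hk⟩ | ⟨k, hk⟩)
      · exact ⟨k, Or.inl (by rw [hk]; ring)⟩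
      · exact ⟨k, Or.inr (by linear_combination hk)⟩
  refine ⟨⟨0, Or.inl (by simp)⟩, ?_⟩
  rcases Nat.lt_or_ge 2 n with h2 | h2
  · have n2 : ¬ (n : ℤ) ∣ 2 := fun h => by have := Int.le_of_dvd (by norm_num) h; omega
    have n1 : ¬ (n : ℤ) ∣ 1 := fun h => by have := Int.le_of_dvd (by norm_num) h; omega
    have main : ∀ u ∈ setU n, ∀ v ∈ setU n, ∀ w ∈ setU n, u + v + w ∈ setU n →
        u + v ∈ setU n → v + w ∈ setU n := by
      intro u hu v hv w hw huvw huv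
      rw [key] at *
      rcases hv with hv | hv
      · rcases hw with hw | hw
        · exact Or.inl (dvd_add hv hw)
        · exact Or.inr (by simpa [add_sub_assoc] using dvd_add hv hw)
      · rcases hw with hw | hw
        · refine Or.inr ?_
          have := dvd_add hv hw
          rwa [show v - 1 + w = v + w - 1 by ring] at this
        · exfalso
          rcases hu with hu | hu
          · rcases huvw with h | h
            · exact n2 (by
                have := dvd_sub h (dvd_add hu (dvd_add hv hw))
                rwa [show u + v + w - (u + (v - 1 + (w - 1))) = 2 by ring] at this)
            · exact n1 (by
                have := dvd_sub h (dvd_add hu (dvd_add hv hw))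
                rwa [show u + v + w - 1 - (u + (v - 1 + (w - 1))) = 1 by ring] at this)
          · rcases huv with h | h
            · exact n2 (by
                have := dvd_sub h (dvd_add hu hv)
                rwa [show u + v - (u - 1 + (v - 1)) = 2 by ring] at this)
            · exact n1 (by
                have := dvd_sub h (dvd_add hu hv)
                rwa [show u + v - 1 - (u - 1 + (v - 1)) = 1 by ring] at this)
    intro u hu v hv w hw huvw
    refine ⟨main u hu v hv w hw huvw, fun h => ?_⟩
    have := main w hw v hv u hu (by rwa [show w + v + u = u + v + w by ring])
      (by rwa [add_comm])
    rwa [add_comm]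
  · obtain rfl : n = 2 := by omega
    intro u _ v _ w _ _
    constructor <;> intro _ <;> rw [key] <;> omega

namespace GrMod

variable {K : Type u} [Field K] {A : GrAlg K} {U : Set ℤ} {hU : RingSupporting U}
  (X : GrMod (A.restrict hU))

/-- The relations `x e ⊗ a = x ⊗ e a`, for `e ∈ A_0`. -/
def balanced (i j : ℤ) : Submodule K (X.comp i ⊗[K] A.comp j) :=
  Submodule.span K {t | ∃ (x : X.comp i) (e : A.comp 0) (a : A.comp j),
    t = X.act (add_zero i) x (A.proj hU 0 e) ⊗ₜ[K] a - x ⊗ₜ[K] A.mul (zero_add j) e a}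

/-- The tensor product `X_i ⊗_{A_0} A_j`, where `X` is a graded `A_U`-module. -/
abbrev TensorZero (i j : ℤ) : Type u := (X.comp i ⊗[K] A.comp j) ⧸ X.balanced i j

/-- Right multiplication by `b ∈ A_l`, `X_i ⊗ A_j → X_i ⊗ A_{j+l}`, `x ⊗ a ↦ x ⊗ a b`. -/
def rmul (i : ℤ) {j l k : ℤ} (h : j + l = k) (b : A.comp l) :
    X.TensorZero i j →ₗ[K] X.TensorZero i k :=
  Submodule.mapQ _ _ (LinearMap.lTensor (X.comp i) ((A.mul h).flip b)) (by
    refine Submodule.span_le.2 ?_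
    rintro _ ⟨x, e, a, rfl⟩
    refine Submodule.subset_span ⟨x, e, A.mul h a b, ?_⟩
    simp [A.mul_assoc (zero_add j) h h (zero_add k)])

/-- The multiplication map `μ_{i,j} : X_i ⊗_{A_0} A_j → X_{i+j}` (for `j ∈ U`). -/
noncomputable def mu {i j k : ℤ} (h : i + j = k) : X.TensorZero i j →ₗ[K] X.comp k :=
  Submodule.liftQ _ (TensorProduct.lift ((X.act h).compl₂ (A.proj hU j))) (by
    refine Submodule.span_le.2 ?_
    rintro _ ⟨x, e, a, rfl⟩
    rw [SetLike.mem_coe, LinearMap.mem_ker, map_sub, TensorProduct.lift.tmul,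
      TensorProduct.lift.tmul, LinearMap.compl₂_apply, LinearMap.compl₂_apply,
      X.act_mul (add_zero i) h (zero_add j) h, sub_eq_zero]
    congr 1
    by_cases hj : j ∈ U
    · exact A.restrict_mul_proj hU hU.zero_mem hj _ e a
    · rw [A.proj_of_notMem hU hj, A.proj_of_notMem hU hj, map_zero])

/-- The subspace `Ker(μ_{i,1}) A_{n-1}` of `X_i ⊗_{A_0} A_n`. -/
noncomputable def kerMul (n i : ℤ) : Submodule K (X.TensorZero i n) :=
  Submodule.span K {t | ∃ s ∈ LinearMap.ker (X.mu (i := i) (j := 1) rfl), ∃ b : A.comp (n - 1),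
    t = X.rmul i (add_sub_cancel 1 n) b s}

end GrMod

/-- The property that defines the full subcategory `ℒ(S, U)` of `Gr_{A_U}`: `X` is generated in
degrees belonging to `(S : U)`, and `Ker(μ_{m+kn,1}) A_{n-1} ⊆ Ker(μ_{m+kn,n})` for all `k`. -/
def LProp {K : Type u} [Field K] (A : GrAlg K) {n : ℕ} (hn : 2 ≤ n) (m : ℤ) :
    ObjectProperty (GrMod (A.restrict (setU_ringSupporting hn))) := fun X =>
  X.GeneratedIn (colon (setS n m) (setU n)) ∧
  ∀ k : ℤ, X.kerMul n (m + k * n) ≤ LinearMap.ker (X.mu (i := m + k * n) (j := n) rfl)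

end GrDual

/-!
# Linear `n`-complexes and modules over the restricted dual algebra

Write `A = KQ / I`, and `C` for the `n`-homogeneous dual algebra. Both are generated by `K^Q` and
elements of degree `1`, and `I` vanishes in degrees less than `n`.

*Coinduced modules.* For a representation `V` of `K^Q`, let `coind V k` be the graded `A`-module
with component `Hom_{K^Q}(A_{-k-i}, V)` in degree `i`. Since the components of `A` are finite
dimensional, the almost injective modules cogenerated in degree `-k` are exactly the modules
`coind V k` (`coind_almostInjective`, `toCoind_surjective`). Morphisms `coind V k ⟶ coind W k`
are `K^Q`-linear maps `V → W` (`exists_coindMap`), and morphisms `coind V k ⟶ coind W (k + 1)` are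
actions of the opposite arrows from `V` to `W` (`exists_arrowAction`). Hence the sequences of
morphisms of such modules are modules over `KQ^op`: to a module `Z` corresponds the sequence with
terms `coind Z_k k` and differentials `f ↦ (b ↦ ∑ f(b α) α^o)`, where `α` runs through the arrows.
Its `r`-fold compositions are given by the same formula with the paths of length `r`
(`dIter_linD`). As `coind` only sees functions on `A_n = KQ_n / I_n`, the `n`-fold compositions
vanish if and only if `I_n^⊥` annihilates `Z`, so that linear `n`-complexes are modules over `C`
(`linComplex`, `exists_linComplex_iso`).

*Contractions.* The contraction of the complex of `Z` knows the components of `Z` in the degrees of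
`S`, and the products with elements of `C` between such components: morphisms of contractions are
the families of maps `Z_i → Z'_i` that respect these products (`HomOn`, `contractionHom_injective`,
`contractionHom_surjective`), because `C` is generated in degree `1`. For `n > 2` the condition on
the socle says that `Z_{m+kn+1} = Z_{m+kn} C_1` (`contraction_socle`), so that the restriction of
`Z` to the degrees of `S`, which is a module over `C_U` (`restr`), is generated in degrees of
`(S : U)`. This restriction satisfies the kernel condition, since the product of an element of
`Ker μ_{i,1}` with `b ∈ C_{n-1}` is computed in `Z` from a vanishing product (`kerCond_restr`).

*Extensions.* Conversely, a module `X` over `C_U` has an extension `hat X` to a module over `C`: the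
submodule of the coinduced module generated by the functions `b ↦ x (a b)` with `x` of degree in
`(S : U)`. Evaluation at `1` is a map `hat X → X` (`counit`), which is surjective if `X` is
generated in degrees of `(S : U)`; the kernel condition makes it injective in the degrees of `S`
(`counit_injective`). So the contractions of the complexes of the modules `hat X` give the
equivalence (`linFunctor`).

*Presented modules.* The kernel condition holds for restrictions, in particular for restrictions of
shifts of `C`, and hence for direct summands of direct sums of these, among which are the projective
modules generated in degrees of `(S : U)` (`kerCond_projective`). It passes to cokernels of
morphisms of such modules (`lProp_of_presentedIn`).
-/

namespace GrDual

variable {K : Type u} [Field K]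

/-! ### Graded modules: morphisms, submodules, direct sums -/

namespace GrAlg

variable (A : GrAlg K)

/-- The identification of `A_i` with `A_j` for `i = j`, realized as multiplication by `1` so that
its compatibility with products is an instance of associativity. -/
def cst {i j : ℤ} (h : i = j) : A.comp i →ₗ[K] A.comp j :=
  A.mul (show 0 + i = j by omega) A.one

@[simp] theorem cst_self {i : ℤ} (h : i = i) (a : A.comp i) : A.cst h a = a :=
  A.one_mul _ a

theorem mul_cst_left {i i' j k : ℤ} (h : i = i') (h' : i' + j = k) (a : A.comp i) (b : A.comp j) :
    A.mul h' (A.cst h a) b = A.mul (show i + j = k by omega) a b := by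
  subst h; simp

theorem mul_cst_right {i j j' k : ℤ} (h : j = j') (h' : i + j' = k) (a : A.comp i)
    (b : A.comp j) : A.mul h' a (A.cst h b) = A.mul (show i + j = k by omega) a b := by
  subst h; simp

theorem cst_mul {i j k k' : ℤ} (h : i + j = k) (h' : k = k') (a : A.comp i) (b : A.comp j) :
    A.cst h' (A.mul h a b) = A.mul (h.trans h') a b := by
  subst h'; simp

end GrAlg

namespace GrMod

variable {A : GrAlg K}

theorem hom_ext {M N : GrMod A} {f g : M ⟶ N} (h : ∀ i x, f.app i x = g.app i x) : f = g :=
  Hom.ext (funext fun i => LinearMap.ext (h i))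

@[simp] theorem comp_app {M N P : GrMod A} (f : M ⟶ N) (g : N ⟶ P) (i : ℤ) (x : M.comp i) :
    (f ≫ g).app i x = g.app i (f.app i x) := rfl

@[simp] theorem id_app (M : GrMod A) (i : ℤ) (x : M.comp i) : (𝟙 M : M ⟶ M).app i x = x := rfl

@[simp] theorem zero_app (M N : GrMod A) (i : ℤ) (x : M.comp i) : (0 : M ⟶ N).app i x = 0 := rfl

theorem hom_comm {M N : GrMod A} (f : M ⟶ N) {i j k : ℤ} (h : i + j = k) (x : M.comp i)
    (a : A.comp j) : f.app k (M.act h x a) = N.act h (f.app i x) a :=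
  Hom.comm f h x a

theorem hom_inv_app {M N : GrMod A} (e : M ≅ N) (i : ℤ) (x : M.comp i) :
    e.inv.app i (e.hom.app i x) = x := by
  rw [← comp_app, e.hom_inv_id, id_app]

/-- A morphism which is bijective in each degree is an isomorphism. -/
noncomputable def isoOfBijective {M N : GrMod A} (f : M ⟶ N)
    (hf : ∀ i, Function.Bijective (f.app i)) : M ≅ N where
  hom := f
  inv := (⟨fun i => (LinearEquiv.ofBijective (f.app i) (hf i)).symm.toLinearMap, by
    intro i j k h x a
    apply (hf k).1
    obtain ⟨y, rfl⟩ := (hf i).2 x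
    have e₁ : ∀ (i : ℤ) (z : N.comp i),
        f.app i ((LinearEquiv.ofBijective (f.app i) (hf i)).symm z) = z := fun i z =>
      (LinearEquiv.ofBijective (f.app i) (hf i)).apply_symm_apply z
    change f.app k ((LinearEquiv.ofBijective (f.app k) (hf k)).symm _) =
      f.app k (M.act h ((LinearEquiv.ofBijective (f.app i) (hf i)).symm _) a)
    rw [e₁, hom_comm f, e₁]⟩ : Hom N M)
  hom_inv_id := hom_ext fun i x =>
    (LinearEquiv.ofBijective (f.app i) (hf i)).symm_apply_apply x
  inv_hom_id := hom_ext fun i x =>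
    (LinearEquiv.ofBijective (f.app i) (hf i)).apply_symm_apply x

theorem epi_of_surjective {M N : GrMod A} (f : M ⟶ N)
    (hf : ∀ i, Function.Surjective (f.app i)) : Epi f where
  left_cancellation g h e := hom_ext fun i x => by
    obtain ⟨y, rfl⟩ := hf i x
    rw [← comp_app, e, comp_app]

/-- A graded submodule, regarded as a graded module. -/
def Sub.toMod {M : GrMod A} (N : Sub M) : GrMod A where
  comp := fun i => N.comp i
  act := fun {i j k} h =>
    LinearMap.mk₂ K (fun (x : N.comp i) (a : A.comp j) =>
        (⟨M.act h x.1 a, N.act_mem h x.1 a x.2⟩ : N.comp k))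
      (by intros; ext; simp) (by intros; ext; simp) (by intros; ext; simp) (by intros; ext; simp)
  act_one := fun h x => Subtype.ext (M.act_one h x.1)
  act_mul := fun h₁ h₂ h₃ h₄ x a b => Subtype.ext (M.act_mul h₁ h₂ h₃ h₄ x.1 a b)

/-- The direct sum of a family of graded modules. -/
noncomputable def coprod {T : Type u} (M : T → GrMod A) : GrMod A where
  comp := fun i => Π₀ t, (M t).comp i
  act := fun {i j k} h =>
    LinearMap.mk₂ K (fun x a => DFinsupp.mapRange.linearMap (fun t => ((M t).act h).flip a) x)
      (by intros; rw [map_add]) (by intros; rw [map_smul]) (by intros; ext; simp)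
      (by intros; ext; simp)
  act_one := by
    intro i h x
    apply DFinsupp.ext
    intro t
    exact (M t).act_one h (x t)
  act_mul := by
    intro i j k ij jk l h₁ h₂ h₃ h₄ x a b
    apply DFinsupp.ext
    intro t
    exact (M t).act_mul h₁ h₂ h₃ h₄ (x t) a b

section Coprod

variable {T : Type u} (M : T → GrMod A)

/-- The projection of a direct sum onto a summand. -/
def coprodProj (t : T) : coprod M ⟶ M t :=
  (⟨fun i => (DFinsupp.lapply t : (Π₀ t, (M t).comp i) →ₗ[K] (M t).comp i),
    fun _ _ _ => rfl⟩ : Hom _ _)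

open Classical in
/-- The inclusion of a summand in a direct sum. -/
noncomputable def coprodInj (t : T) : M t ⟶ coprod M :=
  (⟨fun i => (DFinsupp.lsingle (M := fun t => (M t).comp i) t :
      (M t).comp i →ₗ[K] Π₀ t, (M t).comp i), by
    intro i j k h x a
    apply DFinsupp.ext
    intro s
    change (DFinsupp.single (β := fun t => (M t).comp k) t ((M t).act h x a)) s =
      (M s).act h ((DFinsupp.single (β := fun t => (M t).comp i) t x) s) a
    by_cases e : t = s
    · subst e; rw [DFinsupp.single_eq_same, DFinsupp.single_eq_same]
    · rw [DFinsupp.single_eq_of_ne (Ne.symm e), DFinsupp.single_eq_of_ne (Ne.symm e), map_zero,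
        LinearMap.zero_apply]⟩ : Hom (M t) (coprod M))

theorem coprod_ext {i : ℤ} {x y : (coprod M).comp i}
    (h : ∀ t, (coprodProj M t).app i x = (coprodProj M t).app i y) : x = y :=
  DFinsupp.ext h

open Classical in
theorem coprod_induction {i : ℤ} {P : (coprod M).comp i → Prop} (x : (coprod M).comp i)
    (h0 : P 0) (hadd : ∀ x y, P x → P y → P (x + y))
    (hs : ∀ t (y : (M t).comp i), P ((coprodInj M t).app i y)) : P x :=
  DFinsupp.induction (p := P) x h0 fun t b _ _ _ hf => hadd _ _ (hs t b) hf

open Classical in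
/-- The components of the morphism out of a direct sum given by morphisms out of the summands. -/
noncomputable def coprodDescApp {N : GrMod A} (f : ∀ t, M t ⟶ N) (i : ℤ) :
    (coprod M).comp i →ₗ[K] N.comp i :=
  (DFinsupp.lsum ℕ fun t => (f t).app i : (Π₀ t, (M t).comp i) →ₗ[K] N.comp i)

theorem coprodDescApp_inj {N : GrMod A} (f : ∀ t, M t ⟶ N) (t : T) (i : ℤ) (x : (M t).comp i) :
    coprodDescApp M f i ((coprodInj M t).app i x) = (f t).app i x := by
  classical
  exact DFinsupp.lsum_single (M := fun t => (M t).comp i) ℕ (fun t => (f t).app i) t x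

/-- The morphism out of a direct sum given by morphisms out of the summands. -/
noncomputable def coprodDesc {N : GrMod A} (f : ∀ t, M t ⟶ N) : coprod M ⟶ N :=
  (⟨coprodDescApp M f, by
    intro i j k h x a
    induction x using coprod_induction M with
    | h0 => simp
    | hadd x y hx hy => simp only [map_add, LinearMap.add_apply, hx, hy]
    | hs t y =>
      rw [coprodDescApp_inj, ← hom_comm (coprodInj M t), coprodDescApp_inj, hom_comm (f t)]⟩ :
    Hom (coprod M) N)

theorem coprodInj_desc {N : GrMod A} (f : ∀ t, M t ⟶ N) (t : T) :
    coprodInj M t ≫ coprodDesc M f = f t :=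
  hom_ext fun i x => coprodDescApp_inj M f t i x

/-- The direct sum is the coproduct in the category of graded modules. -/
noncomputable def coprodIsColimit :
    Limits.IsColimit (Limits.Cofan.mk (coprod M) (coprodInj M)) :=
  Limits.Cofan.IsColimit.mk _ (fun s => coprodDesc M s.inj)
    (fun s t => coprodInj_desc M s.inj t)
    (fun s m hm => by
      refine hom_ext fun i x => ?_
      induction x using coprod_induction M with
      | h0 => simp
      | hadd x y hx hy => simp only [map_add, hx, hy]
      | hs t y =>
        rw [← comp_app, ← comp_app, coprodInj_desc]
        exact congrArg (fun g : M t ⟶ s.pt => g.app i y) (hm t))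

end Coprod

/-- A module generated in degrees belonging to `T` is spanned, in each degree, by the products
`x a` with `x` of degree in `T`. -/
theorem GeneratedIn.span_eq_top {T : Set ℤ} {M : GrMod A} (hM : M.GeneratedIn T) (k : ℤ) :
    Submodule.span K {y : M.comp k | ∃ (s j : ℤ) (_ : s ∈ T) (h : s + j = k) (x : M.comp s)
      (a : A.comp j), y = M.act h x a} = ⊤ := by
  let N : Sub M :=
    { comp := fun k => Submodule.span K {y : M.comp k | ∃ (s j : ℤ) (_ : s ∈ T) (h : s + j = k)
        (x : M.comp s) (a : A.comp j), y = M.act h x a}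
      act_mem := by
        intro i j k h x a hx
        induction hx using Submodule.span_induction with
        | mem x hx =>
          obtain ⟨s, j', hs, h', x, a', rfl⟩ := hx
          refine Submodule.subset_span ⟨s, j' + j, hs, by omega, x, A.mul rfl a' a, ?_⟩
          exact M.act_mul _ _ _ _ x a' a
        | zero => simp
        | add x y _ _ hx hy => rw [map_add]; exact add_mem hx hy
        | smul c x _ hx => rw [map_smul]; exact Submodule.smul_mem _ c hx }
  by_contra hk
  obtain ⟨i, hi, hN⟩ := hM N ⟨k, hk⟩
  refine hN (eq_top_iff.2 fun x _ => Submodule.subset_span ⟨i, 0, hi, add_zero i, x, A.one, ?_⟩)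
  exact (M.act_one _ x).symm

theorem generatedIn_of_span {T : Set ℤ} {M : GrMod A}
    (h : ∀ k, ∀ x : M.comp k, x ∈ Submodule.span K {y : M.comp k | ∃ (s j : ℤ) (_ : s ∈ T)
      (h : s + j = k) (x : M.comp s) (a : A.comp j), y = M.act h x a}) : M.GeneratedIn T := by
  rintro N ⟨k, hk⟩
  by_contra! hN
  refine hk (eq_top_iff.2 fun x _ => ?_)
  refine Submodule.span_le.2 ?_ (h k x)
  rintro _ ⟨s, j, hs, h, x, a, rfl⟩
  exact N.act_mem h x a (by rw [hN s hs]; trivial)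

end GrMod

/-! ### Coinduced modules -/

/-- A finite family of orthogonal idempotents of `A_0` with sum `1`. -/
structure Idem (A : GrAlg K) (Q : Type u) [Fintype Q] where
  e : Q → A.comp 0
  mul_self : ∀ a, A.mul (add_zero 0) (e a) (e a) = e a
  mul_ne : ∀ {a b}, a ≠ b → A.mul (add_zero 0) (e a) (e b) = 0
  sum : ∑ a, e a = A.one

/-- An action of the algebra `K^Q` on a vector space: orthogonal projections `e a` with sum `1`. -/
structure VertAct (K : Type u) [Field K] (Q : Type u) [Fintype Q] (V : Type u) [AddCommGroup V]
    [Module K V] where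
  e : Q → V →ₗ[K] V
  self : ∀ a v, e a (e a v) = e a v
  ne : ∀ {a b}, a ≠ b → ∀ v, e a (e b v) = 0
  sum : ∀ v, ∑ a, e a v = v

variable {Q : Type u} [Fintype Q]

/-- The action of idempotents of degree `0` on a homogeneous component of a module. -/
def Idem.act {A : GrAlg K} (ε : Idem A Q) (M : GrMod A) (i : ℤ) : VertAct K Q (M.comp i) where
  e := fun a => (M.act (add_zero i)).flip (ε.e a)
  self := fun a v => by
    rw [LinearMap.flip_apply, LinearMap.flip_apply, M.act_mul _ _ (add_zero 0) (add_zero i),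
      ε.mul_self]
  ne := fun {a b} h v => by
    rw [LinearMap.flip_apply, LinearMap.flip_apply, M.act_mul _ _ (add_zero 0) (add_zero i),
      ε.mul_ne h.symm, map_zero]
  sum := fun v => by
    simp only [LinearMap.flip_apply]
    rw [← map_sum, ε.sum, M.act_one]

theorem Idem.act_e {A : GrAlg K} (ε : Idem A Q) (M : GrMod A) (i : ℤ) (a : Q) (x : M.comp i) :
    (ε.act M i).e a x = M.act (add_zero i) x (ε.e a) := rfl

namespace GrMod

variable (A : GrAlg K)

/-- The graded module `ℋom_K(A, V)[k]`. Its component of degree `i` is `Hom_K(A_j, V)` for the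
unique `j` with `k + i + j = 0`; it is encoded as a family over the one-element type of such `j`, so
that the indices never have to be transported. -/
def coindK (V : Type u) [AddCommGroup V] [Module K V] (k : ℤ) : GrMod A where
  comp := fun i => (j : {j : ℤ // k + i + j = 0}) → A.comp j.1 →ₗ[K] V
  act := fun {i j i'} h =>
    LinearMap.mk₂ K (fun f a l => f ⟨j + l.1, by have := l.2; omega⟩ ∘ₗ A.mul rfl a)
      (by intros; rfl) (by intros; rfl)
      (by intros; funext l; ext; simp) (by intros; funext l; ext; simp)
  act_one := by
    intro i h f
    funext ⟨l, hl⟩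
    ext b
    have key : ∀ (l' : ℤ) (h' : 0 + l = l') (hl' : k + i + l' = 0),
        f ⟨l', hl'⟩ (A.mul h' A.one b) = f ⟨l, hl⟩ b := by
      intro l' h' hl'
      obtain rfl : l = l' := by omega
      rw [A.one_mul]
    exact key _ _ _
  act_mul := by
    intro i j k' ij jk l h₁ h₂ h₃ h₄ f a b
    funext ⟨l', hl'⟩
    ext c
    have key : ∀ (p q : ℤ) (hp : k' + l' = p) (hq : j + p = q) (hq' : jk + l' = q)
        (r : ℤ) (hr : jk + l' = r) (hqr : k + i + q = 0) (hrr : k + i + r = 0),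
        f ⟨q, hqr⟩ (A.mul hq a (A.mul hp b c)) = f ⟨r, hrr⟩ (A.mul hr (A.mul h₃ a b) c) := by
      intro p q hp hq hq' r hr hqr hrr
      obtain rfl : q = r := by omega
      rw [A.mul_assoc h₃ hr hp hq]
    exact key _ _ rfl rfl (by omega) _ rfl _ _

variable {A}

section Coind

variable {V W : Type u} [AddCommGroup V] [Module K V] [AddCommGroup W] [Module K W]

/-- Evaluation of an element of `ℋom_K(A, V)[k]`. -/
def evK {k i j : ℤ} (h : k + i + j = 0) : (coindK A V k).comp i →ₗ[K] A.comp j →ₗ[K] V where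
  toFun f := f ⟨j, h⟩
  map_add' _ _ := rfl
  map_smul' _ _ := rfl

theorem evK_ext {k i j : ℤ} (h : k + i + j = 0) {f g : (coindK A V k).comp i}
    (hfg : ∀ b, evK h f b = evK h g b) : f = g := by
  funext ⟨l, hl⟩
  obtain rfl : j = l := by omega
  exact LinearMap.ext hfg

theorem evK_act {k i j i' l l' : ℤ} (h : i + j = i') (hl : k + i' + l = 0) (hl' : k + i + l' = 0)
    (hj : j + l = l') (f : (coindK A V k).comp i) (a : A.comp j) (b : A.comp l) :
    evK hl ((coindK A V k).act h f a) b = evK hl' f (A.mul hj a b) := by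
  subst hj; rfl

/-- The coinduced module `ℋom_{A_0}(A, V)[k]`, where `A_0` acts on `V` through the projections of
`w`: the functionals `f` satisfying `f (b ε_a) = e_a (f b)`. -/
def coindSub (ε : Idem A Q) (w : VertAct K Q V) (k : ℤ) : Sub (coindK A V k) where
  comp := fun i =>
    { carrier := {f | ∀ (j : ℤ) (h : k + i + j = 0) (b : A.comp j) (a : Q),
        evK h f (A.mul (add_zero j) b (ε.e a)) = w.e a (evK h f b)}
      add_mem' := by
        intro f g hf hg j h b a
        simp only [map_add, LinearMap.add_apply, hf j h b a, hg j h b a]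
      zero_mem' := by intro j h b a; simp
      smul_mem' := by
        intro c f hf j h b a
        simp only [map_smul, LinearMap.smul_apply, hf j h b a] }
  act_mem := by
    intro i j i' h f c hf l hl b a
    rw [evK_act h hl (l' := j + l) (by omega) rfl, evK_act h hl (l' := j + l) (by omega) rfl,
      ← hf, A.mul_assoc rfl (add_zero (j + l)) (add_zero l) rfl]

/-- The coinduced module `ℋom_{A_0}(A, V)[k]`. -/
def coind (ε : Idem A Q) (w : VertAct K Q V) (k : ℤ) : GrMod A := (coindSub ε w k).toMod

variable {ε : Idem A Q} {w : VertAct K Q V} {w' : VertAct K Q W} {k : ℤ}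

/-- Evaluation of an element of a coinduced module. -/
def ev {i j : ℤ} (h : k + i + j = 0) : (coind ε w k).comp i →ₗ[K] A.comp j →ₗ[K] V :=
  evK h ∘ₗ ((coindSub ε w k).comp i).subtype

theorem ev_ext {i j : ℤ} (h : k + i + j = 0) {f g : (coind ε w k).comp i}
    (hfg : ∀ b, ev h f b = ev h g b) : f = g :=
  Subtype.ext (evK_ext h hfg)

theorem ev_act {i j i' l l' : ℤ} (h : i + j = i') (hl : k + i' + l = 0) (hl' : k + i + l' = 0)
    (hj : j + l = l') (f : (coind ε w k).comp i) (a : A.comp j) (b : A.comp l) :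
    ev hl ((coind ε w k).act h f a) b = ev hl' f (A.mul hj a b) :=
  evK_act h hl hl' hj f.1 a b

theorem ev_idem {i j : ℤ} (h : k + i + j = 0) (f : (coind ε w k).comp i) (b : A.comp j) (a : Q) :
    ev h f (A.mul (add_zero j) b (ε.e a)) = w.e a (ev h f b) :=
  f.2 j h b a

/-- The element of a coinduced module with a given value at `A_j`. -/
def coindMk {i j : ℤ} (h : k + i + j = 0) (φ : A.comp j →ₗ[K] V)
    (hφ : ∀ b a, φ (A.mul (add_zero j) b (ε.e a)) = w.e a (φ b)) : (coind ε w k).comp i :=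
  ⟨fun l => φ ∘ₗ A.cst (show l.1 = j by have := l.2; omega), by
    intro l hl b a
    obtain rfl : j = l := by omega
    change φ (A.cst _ _) = w.e a (φ (A.cst _ _))
    rw [A.cst_self, A.cst_self, hφ]⟩

@[simp] theorem ev_coindMk {i j : ℤ} (h : k + i + j = 0) (φ : A.comp j →ₗ[K] V)
    (hφ : ∀ b a, φ (A.mul (add_zero j) b (ε.e a)) = w.e a (φ b)) (b : A.comp j) :
    ev h (coindMk h φ hφ : (coind ε w k).comp i) b = φ b := by
  change φ (A.cst _ b) = φ b
  rw [A.cst_self]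

/-- A morphism into a coinduced module, described by its values. -/
def homToCoind {M : GrMod A} (φ : ∀ i j : ℤ, k + i + j = 0 → M.comp i →ₗ[K] A.comp j →ₗ[K] V)
    (h₁ : ∀ i j (h : k + i + j = 0) x b a,
      φ i j h x (A.mul (add_zero j) b (ε.e a)) = w.e a (φ i j h x b))
    (h₂ : ∀ i j i' l (h : i + j = i') (hl : k + i' + l = 0) (hl' : k + i + (j + l) = 0) x a b,
      φ i' l hl (M.act h x a) b = φ i (j + l) hl' x (A.mul rfl a b)) : M ⟶ coind ε w k :=
  (⟨fun i =>
    { toFun := fun x => ⟨fun j => φ i j.1 j.2 x, fun j h b a => h₁ i j h x b a⟩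
      map_add' := fun x y => Subtype.ext (funext fun j => (φ i j.1 j.2).map_add x y)
      map_smul' := fun c x => Subtype.ext (funext fun j => (φ i j.1 j.2).map_smul c x) }, by
    intro i j i' h x a
    refine ev_ext (j := -(k + i')) (by omega) fun b => ?_
    rw [ev_act h _ (l' := j + -(k + i')) (by omega) rfl]
    exact h₂ i j i' _ h _ _ x a b⟩ : Hom M (coind ε w k))

theorem ev_homToCoind {M : GrMod A}
    (φ : ∀ i j : ℤ, k + i + j = 0 → M.comp i →ₗ[K] A.comp j →ₗ[K] V) (h₁ h₂) {i j : ℤ}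
    (h : k + i + j = 0) (x : M.comp i) (b : A.comp j) :
    ev h ((homToCoind (ε := ε) (w := w) φ h₁ h₂).app i x) b = φ i j h x b := rfl

/-- Functoriality of coinduction. -/
def coindMap (ε : Idem A Q) (w : VertAct K Q V) (w' : VertAct K Q W) (k : ℤ) (g : V →ₗ[K] W)
    (hg : ∀ a v, g (w.e a v) = w'.e a (g v)) : coind ε w k ⟶ coind ε w' k :=
  homToCoind (fun _ _ h => (LinearMap.llcomp K _ _ _ g) ∘ₗ ev h)
    (by
      intro i j h x b a
      change g (ev h x _) = w'.e a (g (ev h x b))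
      rw [ev_idem, hg])
    (by
      intro i j i' l h hl hl' x a b
      change g (ev _ _ _) = g (ev _ _ _)
      rw [ev_act h hl hl' rfl])

@[simp] theorem ev_coindMap (g : V →ₗ[K] W) (hg : ∀ a v, g (w.e a v) = w'.e a (g v)) {i j : ℤ}
    (h : k + i + j = 0) (f : (coind ε w k).comp i) (b : A.comp j) :
    ev h ((coindMap ε w w' k g hg).app i f) b = g (ev h f b) := rfl

theorem coind_cogeneratedIn : (coind ε w k).CogeneratedIn {-k} := by
  rintro N ⟨i, hi⟩
  refine ⟨-k, rfl, ?_⟩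
  obtain ⟨f, hf, hf0⟩ := (Submodule.ne_bot_iff _).1 hi
  intro hN
  apply hf0
  refine ev_ext (j := -(k + i)) (by omega) fun b => ?_
  have hb : (coind ε w k).act (by omega) f b ∈ N.comp (-k) := N.act_mem _ f b hf
  rw [hN, Submodule.mem_bot] at hb
  have := ev_act (i' := -k) (l := 0) (by omega) (by omega) (by omega) (add_zero _) f b A.one
  rw [hb, A.mul_one] at this
  rw [← this]
  simp

end Coind

end GrMod

/-! ### Almost injective modules are coinduced -/

/-- Linear maps out of a finite-dimensional space are sums of maps of rank at most one. -/
theorem linearMap_induction {V W : Type u} [AddCommGroup V] [Module K V] [AddCommGroup W]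
    [Module K W] [Module.Finite K V] {P : (V →ₗ[K] W) → Prop} (f : V →ₗ[K] W)
    (h0 : P 0) (hadd : ∀ f g, P f → P g → P (f + g))
    (hs : ∀ (φ : Module.Dual K V) (w : W), P (φ.smulRight w)) : P f := by
  obtain ⟨t, rfl⟩ := (dualTensorHomEquiv K V W).surjective f
  induction t using TensorProduct.induction_on with
  | zero => simpa using h0
  | add x y hx hy => rw [map_add]; exact hadd _ _ hx hy
  | tmul φ w =>
    have : dualTensorHomEquiv K V W (φ ⊗ₜ w) = φ.smulRight w := by
      ext v; simp
    rw [this]; exact hs φ w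

/-- A bilinear map on `Hom(V, K) × W` induces a linear map on `Hom(V, W)`. -/
noncomputable def homLift {V W N : Type u} [AddCommGroup V] [Module K V] [AddCommGroup W]
    [Module K W] [AddCommGroup N] [Module K N] [Module.Finite K V]
    (β : Module.Dual K V →ₗ[K] W →ₗ[K] N) : (V →ₗ[K] W) →ₗ[K] N :=
  TensorProduct.lift β ∘ₗ (dualTensorHomEquiv K V W).symm.toLinearMap

theorem homLift_smulRight {V W N : Type u} [AddCommGroup V] [Module K V] [AddCommGroup W]
    [Module K W] [AddCommGroup N] [Module K N] [Module.Finite K V]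
    (β : Module.Dual K V →ₗ[K] W →ₗ[K] N) (φ : Module.Dual K V) (w : W) :
    homLift β (φ.smulRight w) = β φ w := by
  have : φ.smulRight w = dualTensorHomEquiv K V W (φ ⊗ₜ w) := by
    ext v; simp
  rw [homLift, this, LinearMap.comp_apply, LinearEquiv.coe_coe, LinearEquiv.symm_apply_apply,
    TensorProduct.lift.tmul]

namespace GrMod

variable {A : GrAlg K} {V : Type u} [AddCommGroup V] [Module K V]

/-- The morphism `D(A)[k] ⟶ ℋom_K(A, V)[k]` given by a vector of `V`. -/
def coindLeg (k : ℤ) (v : V) : (D A).shift k ⟶ coindK A V k :=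
  (⟨fun i => show Module.Dual K (A.comp (-(k + i))) →ₗ[K]
      ((j : {j : ℤ // k + i + j = 0}) → A.comp j.1 →ₗ[K] V) from
    { toFun := fun φ l => LinearMap.smulRight
        (φ ∘ₗ
          A.cst (show l.1 = -(k + i) by have := l.2; omega)) v
      map_add' := fun φ ψ => by
        funext l; ext b
        exact add_smul _ _ _
      map_smul' := fun c φ => by
        funext l; ext b
        exact mul_smul _ _ _ }, by
    intro i j i' h φ a
    funext ⟨l, hl⟩
    ext b
    change (show Module.Dual K (A.comp (-(k + i))) from φ) (A.mul _ a (A.cst _ b)) • v =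
      (show Module.Dual K (A.comp (-(k + i))) from φ) (A.cst _ (A.mul _ a b)) • v
    rw [A.mul_cst_right, A.cst_mul]⟩ : Hom ((D A).shift k) (coindK A V k))

theorem coindLeg_apply (k : ℤ) (v : V) (i : ℤ) (φ : Module.Dual K (A.comp (-(k + i)))) :
    evK (show k + i + -(k + i) = 0 by omega) ((coindLeg k v).app i φ) = φ.smulRight v := by
  ext b
  change φ (A.cst _ b) • v = _
  rw [A.cst_self]
  rfl

theorem coindK_induction (hfin : ∀ i, Module.Finite K (A.comp i)) {k i : ℤ}
    {P : (coindK A V k).comp i → Prop} (f : (coindK A V k).comp i) (h0 : P 0)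
    (hadd : ∀ f g, P f → P g → P (f + g))
    (hs : ∀ (v : V) (φ : Module.Dual K (A.comp (-(k + i)))),
      P ((coindLeg k v).app i φ)) : P f := by
  have := hfin (-(k + i))
  have hk : k + i + -(k + i) = 0 := by omega
  suffices h : ∀ g : A.comp (-(k + i)) →ₗ[K] V, ∀ f : (coindK A V k).comp i, evK hk f = g → P f from
    h _ f rfl
  intro g
  have hex : ∀ g : A.comp (-(k + i)) →ₗ[K] V, ∃ f : (coindK A V k).comp i, evK hk f = g := by
    intro g
    refine ⟨fun l => g ∘ₗ A.cst (by have := l.2; omega), ?_⟩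
    ext b
    change g (A.cst _ b) = _
    rw [A.cst_self]
  have hinj : ∀ f f' : (coindK A V k).comp i, evK hk f = evK hk f' → f = f' := fun f f' h =>
    evK_ext hk fun b => by rw [h]
  induction g using linearMap_induction with
  | h0 => intro f hf; rwa [hinj f 0 (by rw [hf, map_zero])]
  | hadd g g' hg hg' =>
    intro f hf
    obtain ⟨e, he⟩ := hex g
    obtain ⟨e', he'⟩ := hex g'
    rw [hinj f (e + e') (by rw [hf, map_add, he, he'])]
    exact hadd _ _ (hg e he) (hg' e' he')
  | hs φ v =>
    intro f hf
    rw [hinj f _ (hf.trans (coindLeg_apply k v i φ).symm)]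
    exact hs v φ

/-- The components of the morphism out of `ℋom_K(A, V)[k]` which is `g t` on the copy of `D(A)[k]`
that belongs to the basis vector `b t`. -/
noncomputable def coindKDescApp (hfin : ∀ i, Module.Finite K (A.comp i)) {T : Type u}
    (b : Module.Basis T K V) (k : ℤ) {N : GrMod A} (g : ∀ _ : T, (D A).shift k ⟶ N) (i : ℤ) :
    (coindK A V k).comp i →ₗ[K] N.comp i :=
  have := hfin (-(k + i))
  homLift
    ((b.constr K).toLinearMap ∘ₗ LinearMap.pi (fun t => ((g t).app i :
      Module.Dual K (A.comp (-(k + i))) →ₗ[K] N.comp i))) ∘ₗ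
    evK (show k + i + -(k + i) = 0 by omega)

theorem coindKDescApp_leg (hfin : ∀ i, Module.Finite K (A.comp i)) {T : Type u}
    (b : Module.Basis T K V) (k : ℤ) {N : GrMod A} (g : ∀ _ : T, (D A).shift k ⟶ N) (i : ℤ)
    (φ : Module.Dual K (A.comp (-(k + i)))) (v : V) :
    coindKDescApp hfin b k g i ((coindLeg k v).app i φ) =
      b.constr K (fun t => (g t).app i φ) v := by
  have := hfin (-(k + i))
  rw [coindKDescApp, LinearMap.comp_apply, coindLeg_apply, homLift_smulRight]
  rfl

/-- `ℋom_K(A, V)[k]` is a direct sum of copies of `D(A)[k]`, indexed by a basis of `V`. -/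
noncomputable def coindKIsColimit (hfin : ∀ i, Module.Finite K (A.comp i)) {T : Type u}
    (b : Module.Basis T K V) (k : ℤ) : Limits.IsColimit
      (Limits.Cofan.mk (f := fun _ : T => (D A).shift k) (coindK A V k)
        (fun t => coindLeg k (b t))) :=
  Limits.Cofan.IsColimit.mk _
    (fun s => (⟨coindKDescApp hfin b k s.inj, by
      intro i j i' h f a
      induction f using coindK_induction hfin with
      | h0 => simp
      | hadd f g hf hg => simp only [map_add, LinearMap.add_apply, hf, hg]
      | hs v φ =>
        refine (congrArg _ (hom_comm (coindLeg k v) h φ a).symm).trans ?_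
        refine (coindKDescApp_leg hfin b k s.inj i' _ v).trans ?_
        rw [coindKDescApp_leg]
        have : ∀ w : V, (b.constr K fun t => (s.inj t).app i' (((D A).shift k).act h φ a)) w =
            (s.pt.act h).flip a ((b.constr K fun t => (s.inj t).app i φ) w) := by
          intro w
          rw [← LinearMap.comp_apply]
          congr 1
          refine b.ext fun t => ?_
          rw [LinearMap.comp_apply, b.constr_basis, b.constr_basis]
          exact hom_comm (s.inj t) h φ a
        exact this v⟩ : Hom (coindK A V k) s.pt))
    (fun s t => hom_ext fun i φ => by
      refine (coindKDescApp_leg hfin b k s.inj i φ (b t)).trans ?_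
      rw [b.constr_basis])
    (fun s m hm => hom_ext fun i f => by
      induction f using coindK_induction hfin with
      | h0 => simp
      | hadd f g hf hg => simp only [map_add, hf, hg]
      | hs v φ =>
        refine Eq.trans ?_ (coindKDescApp_leg hfin b k s.inj i φ v).symm
        let L : V →ₗ[K] (coindK A V k).comp i :=
          { toFun := fun v => (coindLeg k v).app i φ
            map_add' := fun v w => by
              funext l; ext c
              exact smul_add ((show Module.Dual K (A.comp (-(k + i))) from φ) (A.cst _ c)) v w
            map_smul' := fun r v => by
              funext l; ext c
              exact smul_comm ((show Module.Dual K (A.comp (-(k + i))) from φ) (A.cst _ c)) r v }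
        change (m.app i ∘ₗ L) v = _
        congr 1
        refine b.ext fun t => ?_
        rw [b.constr_basis]
        exact congrArg (fun g : (D A).shift k ⟶ s.pt => g.app i φ) (hm t))

variable {Q : Type u} [Fintype Q] {ε : Idem A Q} {w : VertAct K Q V} {k : ℤ}

/-- The inclusion `ℋom_{A_0}(A, V)[k] ⟶ ℋom_K(A, V)[k]`. -/
def coindIncl (ε : Idem A Q) (w : VertAct K Q V) (k : ℤ) : coind ε w k ⟶ coindK A V k :=
  (⟨fun i => ((coindSub ε w k).comp i).subtype, fun _ _ _ => rfl⟩ : Hom (coind ε w k) _)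

/-- The averaging map `ℋom_K(A, V)[k] ⟶ ℋom_{A_0}(A, V)[k]`, `f ↦ (b ↦ ∑ e_a f(b ε_a))`. -/
def coindAverage (ε : Idem A Q) (w : VertAct K Q V) (k : ℤ) : coindK A V k ⟶ coind ε w k :=
  homToCoind (fun i j h => ∑ a, (LinearMap.llcomp K _ _ _ (w.e a)) ∘ₗ
      (LinearMap.lcomp K V ((A.mul (add_zero j)).flip (ε.e a))) ∘ₗ evK h)
    (by
      intro i j h f b a
      simp only [LinearMap.sum_apply, LinearMap.comp_apply, LinearMap.llcomp_apply,
        LinearMap.lcomp_apply, LinearMap.flip_apply, map_sum]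
      refine Finset.sum_congr rfl fun c _ => ?_
      rw [A.mul_assoc (add_zero j) (add_zero j) (add_zero 0) (add_zero j)]
      by_cases e : a = c
      · subst e; rw [ε.mul_self, w.self]
      · rw [ε.mul_ne e, w.ne e]; simp)
    (by
      intro i j i' l h hl hl' f a b
      simp only [LinearMap.sum_apply, LinearMap.comp_apply, LinearMap.llcomp_apply,
        LinearMap.lcomp_apply, LinearMap.flip_apply]
      refine Finset.sum_congr rfl fun c _ => ?_
      rw [evK_act h hl hl' rfl, A.mul_assoc rfl (add_zero (j + l)) (add_zero l) rfl])

theorem coindIncl_average : coindIncl ε w k ≫ coindAverage ε w k = 𝟙 _ := by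
  refine hom_ext fun i f => ev_ext (j := -(k + i)) (by omega) fun b => ?_
  rw [comp_app, coindAverage, ev_homToCoind, id_app]
  simp only [LinearMap.sum_apply, LinearMap.comp_apply, LinearMap.llcomp_apply,
        LinearMap.lcomp_apply, LinearMap.flip_apply]
  refine Eq.trans (Finset.sum_congr rfl fun a _ => ?_) (w.sum _)
  have h := ev_idem (w := w) (show k + i + -(k + i) = 0 by omega) f b a
  exact (congrArg (w.e a) h).trans (w.self a _)

theorem coind_almostInjective (hfin : ∀ i, Module.Finite K (A.comp i)) :
    (coind ε w k).AlmostInjective :=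
  ⟨_, fun _ => k, _, ⟨coindKIsColimit hfin (Module.Basis.ofVectorSpace K V) k⟩,
    ⟨⟨coindIncl ε w k, coindAverage ε w k, coindIncl_average⟩⟩⟩

/-- The canonical morphism from a module to the module coinduced from one of its components. -/
def toCoind (ε : Idem A Q) (M : GrMod A) (k l : ℤ) (hl : k + l = 0) :
    M ⟶ coind ε (ε.act M l) k :=
  homToCoind (fun i j h => M.act (show i + j = l by omega))
    (by
      intro i j h x b a
      rw [Idem.act_e, M.act_mul])
    (by
      intro i j i' l h hl hl' x a b
      rw [M.act_mul])

theorem ev_toCoind (M : GrMod A) {k l : ℤ} (hl : k + l = 0) {i j : ℤ} (h : k + i + j = 0)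
    (x : M.comp i) (b : A.comp j) : ev h ((toCoind ε M k l hl).app i x) b =
      M.act (show i + j = l by omega) x b := rfl

theorem toCoind_injective {M : GrMod A} {k l : ℤ} (hl : k + l = 0) (hM : M.CogeneratedIn {l})
    (i : ℤ) : Function.Injective ((toCoind ε M k l hl).app i) := by
  let N : Sub M :=
    { comp := fun i => LinearMap.ker ((toCoind ε M k l hl).app i)
      act_mem := by
        intro i j i' h x a hx
        rw [LinearMap.mem_ker] at hx ⊢
        rw [hom_comm, hx, map_zero, LinearMap.zero_apply] }
  rw [← LinearMap.ker_eq_bot]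
  by_contra hi
  obtain ⟨_, rfl, h⟩ := hM N ⟨i, hi⟩
  refine h ((Submodule.eq_bot_iff _).2 fun x hx => ?_)
  rw [← M.act_one (add_zero _) x]
  have := ev_toCoind (ε := ε) M hl (i := i) (j := 0)
  have h2 := ev_toCoind (ε := ε) M hl (j := 0) (by omega) x A.one
  have h3 : (toCoind ε M k _ hl).app _ x = 0 := hx
  rw [h3] at h2
  simpa using h2.symm

/-- In a module cogenerated in degree `l` the components of degree `> l` vanish. -/
theorem CogeneratedIn.eq_zero_of_lt (hneg : ∀ i < 0, ∀ a : A.comp i, a = 0) {M : GrMod A} {l : ℤ}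
    (hM : M.CogeneratedIn {l}) {i : ℤ} (hi : l < i) (x : M.comp i) : x = 0 := by
  classical
  let N : Sub M :=
    { comp := fun i => if l < i then ⊤ else ⊥
      act_mem := by
        intro i j i' h x a hx
        by_cases hj : j < 0
        · rw [hneg j hj a, map_zero]; exact zero_mem _
        · split_ifs at hx with h'
          · rw [if_pos (by omega)]; trivial
          · rw [Submodule.mem_bot] at hx
            rw [hx, map_zero]; exact zero_mem _ }
  by_contra hx
  obtain ⟨_, rfl, h⟩ := hM N ⟨i, fun h => hx (by
    have : x ∈ N.comp i := by
      change x ∈ (if l < i then ⊤ else ⊥ : Submodule K (M.comp i))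
      rw [if_pos hi]; trivial
    rwa [h] at this)⟩
  exact h (if_neg (lt_irrefl _))

/-- The coordinates, as functionals, of an element of a direct sum of shifts of `D(A)`. -/
def dualCoord {T : Type u} (κ : T → ℤ) (t : T) (j : ℤ) :
    (coprod fun t => (D A).shift (κ t)).comp j →ₗ[K] Module.Dual K (A.comp (-(κ t + j))) :=
  (coprodProj (fun t => (D A).shift (κ t)) t).app j

theorem dualCoord_ext {T : Type u} {κ : T → ℤ} {j : ℤ}
    {x y : (coprod fun t => (D A).shift (κ t)).comp j}
    (h : ∀ t, dualCoord κ t j x = dualCoord κ t j y) : x = y :=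
  coprod_ext _ h

theorem dualCoord_act {T : Type u} (κ : T → ℤ) (t : T) {j j' j'' : ℤ} (h : j + j' = j'')
    (x : (coprod fun t => (D A).shift (κ t)).comp j) (a : A.comp j')
    (b : A.comp (-(κ t + j''))) :
    dualCoord κ t j'' ((coprod fun t => (D A).shift (κ t)).act h x a) b =
      dualCoord κ t j x (A.mul (show j' + -(κ t + j'') = -(κ t + j) by omega) a b) := rfl

/-- A linear map `g` from `A_{-(k+i)}` to the degree `-k` part of `⨁ D(A)[κ t]` is given by right
multiplication of an element `x` of degree `i`, as far as the values at `1` of the coordinates with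
`κ t = k` are concerned. -/
theorem exists_dualCoord (hfin : ∀ i, Module.Finite K (A.comp i)) {T : Type u} (κ : T → ℤ)
    {k l : ℤ} (i : ℤ)
    (g : A.comp (-(k + i)) →ₗ[K] (coprod fun t => (D A).shift (κ t)).comp l) :
    ∃ x : (coprod fun t => (D A).shift (κ t)).comp i, ∀ t,
      (κ t = k → ∀ (e₁ : -(κ t + i) = -(k + i)) (e₂ : 0 = -(κ t + l)) (a : A.comp (-(κ t + i))),
        dualCoord κ t i x a = dualCoord κ t l (g (A.cst e₁ a)) (A.cst e₂ A.one)) ∧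
      (κ t ≠ k → dualCoord κ t i x = 0) := by
  classical
  have := hfin (-(k + i))
  induction g using linearMap_induction with
  | h0 => exact ⟨0, fun t => ⟨fun _ _ _ _ => by simp, fun _ => map_zero _⟩⟩
  | hadd g g' hg hg' =>
    obtain ⟨x, hx⟩ := hg
    obtain ⟨x', hx'⟩ := hg'
    refine ⟨x + x', fun t => ⟨fun h e₁ e₂ a => ?_, fun h => ?_⟩⟩
    · simp only [map_add, LinearMap.add_apply, (hx t).1 h e₁ e₂, (hx' t).1 h e₁ e₂]
    · rw [map_add, (hx t).2 h, (hx' t).2 h, add_zero]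
  | hs φ y =>
    by_cases hkl : k + l = 0
    swap
    · refine ⟨0, fun t => ⟨fun h e₁ e₂ a => by omega, fun _ => map_zero _⟩⟩
    let F : ∀ t, Module.Dual K (A.comp (-(κ t + l))) → Module.Dual K (A.comp (-(κ t + i))) :=
      fun t ψ => if h : κ t = k then
        ψ (A.cst (show 0 = -(κ t + l) by omega) A.one) •
          (φ ∘ₗ A.cst (show -(κ t + i) = -(k + i) by omega))
        else 0
    let x : (coprod fun t => (D A).shift (κ t)).comp i :=
      DFinsupp.mapRange (β₁ := fun t => ((D A).shift (κ t)).comp l)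
        (β₂ := fun t => ((D A).shift (κ t)).comp i) F (fun t => by
          change F t 0 = 0
          by_cases h : κ t = k
          · simp [F, h]
          · simp [F, h]) y
    have hx : ∀ t, dualCoord κ t i x = F t (dualCoord κ t l y) := fun t => rfl
    refine ⟨x, fun t => ⟨fun h e₁ e₂ a => ?_, fun h => ?_⟩⟩
    · rw [hx, LinearMap.smulRight_apply, map_smul, LinearMap.smul_apply]
      simp only [F, dif_pos h]
      rw [LinearMap.smul_apply, LinearMap.comp_apply, smul_eq_mul, smul_eq_mul, mul_comm]
    · rw [hx]; exact dif_neg h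

/-- Over an algebra whose degree `0` part is spanned by the idempotents, an almost injective module
which is cogenerated in one degree is coinduced from its component of that degree. -/
theorem toCoind_surjective (hfin : ∀ i, Module.Finite K (A.comp i))
    (hneg : ∀ i < 0, ∀ a : A.comp i, a = 0) (hspan : Submodule.span K (Set.range ε.e) = ⊤)
    {M : GrMod A} {k l : ℤ} (hl : k + l = 0) (hM : M.CogeneratedIn {l}) (hI : M.AlmostInjective)
    (i : ℤ) : Function.Surjective ((toCoind ε M k l hl).app i) := by
  classical
  obtain ⟨T, κ, c, ⟨hc⟩, ⟨r⟩⟩ := hI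
  let E := coprod fun t => (D A).shift (κ t)
  let θ : c.pt ≅ E := hc.coconePointUniqueUpToIso (coprodIsColimit fun t => (D A).shift (κ t))
  let ι : M ⟶ E := r.i ≫ θ.hom
  let π : E ⟶ M := θ.inv ≫ r.r
  have hιπ : ∀ j x, π.app j (ι.app j x) = x := by
    intro j x
    rw [← comp_app]
    simp [ι, π]
  have hsoc : ∀ (x : M.comp l) (t : T), κ t ≠ k → dualCoord κ t l (ι.app l x) = 0 := by
    intro x t ht
    ext a
    rcases lt_or_gt_of_ne ht with h | h
    · -- elements of `M_l` are annihilated by `A_{> 0}`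
      have h0 : M.act (show l + -(κ t + l) = -κ t by omega) x a = 0 :=
        hM.eq_zero_of_lt hneg (by omega) _
      have h1 := dualCoord_act κ t (show l + -(κ t + l) = -κ t by omega) (ι.app l x) a
        (A.cst (by omega) A.one)
      rw [← hom_comm ι, h0, map_zero, map_zero, A.mul_cst_right, A.mul_one] at h1
      exact h1.symm
    · rw [hneg _ (by omega) a, map_zero, map_zero]
  intro f
  have hj : k + i + -(k + i) = 0 := by omega
  obtain ⟨x, hx⟩ := exists_dualCoord hfin κ (l := l) i (ι.app l ∘ₗ ev hj f)
  refine ⟨π.app i x, ev_ext hj fun a => ?_⟩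
  rw [ev_toCoind, ← hom_comm π, ← hιπ l (ev hj f a)]
  congr 1
  refine dualCoord_ext fun t => ?_
  by_cases ht : κ t = k
  swap
  · rw [hsoc _ t ht]
    ext b
    rw [dualCoord_act, (hx t).2 ht]
    rfl
  ext b
  rw [dualCoord_act, (hx t).1 ht (by omega) (by omega), LinearMap.comp_apply, A.cst_mul]
  -- `f` is linear over the degree `0` part
  have hf : ∀ (b : A.comp 0), ev hj f (A.mul (add_zero _) a b) =
      M.act (add_zero l) (ev hj f a) b := by
    intro b
    have hb : b ∈ Submodule.span K (Set.range ε.e) := by rw [hspan]; trivial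
    induction hb using Submodule.span_induction with
    | mem b hb =>
      obtain ⟨q, rfl⟩ := hb
      rw [ev_idem, Idem.act_e]
    | zero => simp
    | add b c _ _ hb hc => simp only [map_add, hb, hc]
    | smul r b _ hb => simp only [map_smul, hb]
  have e : -(κ t + l) = 0 := by omega
  have h1 := hf (A.cst e b)
  rw [A.mul_cst_right] at h1
  rw [h1, hom_comm ι, dualCoord_act, A.mul_cst_left, A.mul_cst_right, A.mul_one]

end GrMod

/-! ### Paths, and quotients of the path algebra -/

section Paths

variable {Q : Type u} [Quiver.{u} Q]

/-- The factorization of a path is determined by the length of the second factor. -/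
theorem comp_midpoint_unique {a c : Q} : ∀ {b b' : Q} (p : Quiver.Path a b)
    (q : Quiver.Path b c) (p' : Quiver.Path a b') (q' : Quiver.Path b' c),
    q.length = q'.length → p.comp q = p'.comp q' →
    (⟨b, p, q⟩ : Σ b : Q, Quiver.Path a b × Quiver.Path b c) = ⟨b', p', q'⟩ := by
  intro b b' p q p' q' hl h
  induction q with
  | nil =>
    cases q' with
    | nil =>
      obtain rfl : p = p' := h
      rfl
    | cons q' β => simp at hl
  | cons q α ih =>
    cases q' with
    | nil => simp at hl
    | cons q' β =>
      rw [Quiver.Path.comp_cons, Quiver.Path.comp_cons] at h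
      obtain rfl := Quiver.Path.obj_eq_of_cons_eq_cons h
      obtain rfl := eq_of_heq (Quiver.Path.hom_heq_of_cons_eq_cons h)
      have := ih q' (by simpa using hl) (eq_of_heq (Quiver.Path.heq_of_cons_eq_cons h))
      injection this with h₄ h₅
      subst h₄
      have h₆ := eq_of_heq h₅
      injection h₆ with h₇ h₈
      subst h₇ h₈
      rfl

theorem exists_comp_of_length {a c : Q} (r : Quiver.Path a c) (i j : ℕ) (h : r.length = i + j) :
    ∃ (b : Q) (p : Quiver.Path a b) (q : Quiver.Path b c), p.length = i ∧ q.length = j ∧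
      p.comp q = r := by
  induction j generalizing c with
  | zero => exact ⟨c, r, Quiver.Path.nil, h, rfl, rfl⟩
  | succ j ih =>
    cases r with
    | nil => simp at h
    | cons r α =>
      obtain ⟨b, p, q, hp, hq, rfl⟩ := ih r (by simpa [← add_assoc] using h)
      exact ⟨b, p, q.cons α, hp, by simp [hq], rfl⟩

instance (i : ℤ) [Fintype Q] [∀ a b : Q, Finite (a ⟶ b)] : Finite (PathOfLength Q i) := by
  rcases lt_or_ge i 0 with hi | hi
  · exact @Finite.of_fintype _ (@Fintype.ofIsEmpty _ ⟨fun p => by have := p.length_eq; omega⟩)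
  obtain ⟨r, rfl⟩ := Int.eq_ofNat_of_zero_le hi
  clear hi
  induction r with
  | zero =>
    refine Finite.of_injective (fun p : PathOfLength Q ((0 : ℕ) : ℤ) => p.origin) ?_
    rintro ⟨a, b, p, hp⟩ ⟨a', b', p', hp'⟩ h
    obtain rfl : a = a' := h
    cases p with
    | nil =>
      cases p' with
      | nil => rfl
      | cons p' α => simp at hp'; omega
    | cons p α => simp at hp; omega
  | succ r ih =>
    refine Finite.of_surjective (fun x : Σ p : PathOfLength Q (r : ℤ), Σ c : Q, (p.terminus ⟶ c) =>
      (⟨x.1.origin, x.2.1, x.1.path.cons x.2.2, by simp [x.1.length_eq]⟩ :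
        PathOfLength Q ((r + 1 : ℕ) : ℤ))) ?_
    rintro ⟨a, b, p, hp⟩
    cases p with
    | nil => simp at hp; omega
    | cons p α => exact ⟨⟨⟨_, _, p, by simpa using hp⟩, _, α⟩, rfl⟩

noncomputable instance (i : ℤ) [Fintype Q] [∀ a b : Q, Finite (a ⟶ b)] :
    Fintype (PathOfLength Q i) := Fintype.ofFinite _

theorem PathOfLength.nonneg {i : ℤ} (p : PathOfLength Q i) : 0 ≤ i := by
  have := p.length_eq; omega

theorem PathOfLength.eq_triv (p : PathOfLength Q 0) : p = PathOfLength.triv p.origin := by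
  obtain ⟨a, b, p, hp⟩ := p
  cases p with
  | nil => rfl
  | cons p α => simp at hp; omega

variable (K)

theorem pathMul_eq_zero_or {i j k : ℤ} (h : i + j = k) (p : PathOfLength Q i)
    (q : PathOfLength Q j) : pathMul K h p q = 0 ∨ ∃ r, pathMul K h p q = Finsupp.single r 1 := by
  by_cases e : p.terminus = q.origin
  · exact Or.inr ⟨_, dif_pos e⟩
  · exact Or.inl (pathMul_of_ne K h p q e)

theorem exists_pathMul_eq {i j k : ℤ} (h : i + j = k) (hi : 0 ≤ i) (hj : 0 ≤ j)
    (r : PathOfLength Q k) : ∃ p q, pathMul K h p q = Finsupp.single r 1 := by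
  obtain ⟨a, c, r, hr⟩ := r
  obtain ⟨b, p, q, hp, hq, rfl⟩ := exists_comp_of_length r i.toNat j.toNat (by omega)
  exact ⟨⟨a, b, p, by omega⟩, ⟨b, c, q, by omega⟩, pathMul_comp K h p q _ _ _⟩

theorem pathMul_unique {i j k : ℤ} (h : i + j = k) {p p' : PathOfLength Q i}
    {q q' : PathOfLength Q j} {r : PathOfLength Q k} (h₁ : pathMul K h p q = Finsupp.single r 1)
    (h₂ : pathMul K h p' q' = Finsupp.single r 1) : (p, q) = (p', q') := by
  have hne : (Finsupp.single r 1 : PathOfLength Q k →₀ K) ≠ 0 := by simp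
  obtain ⟨a, b, p, hp⟩ := p
  obtain ⟨b₁, c, q, hq⟩ := q
  obtain ⟨a', b', p', hp'⟩ := p'
  obtain ⟨b'₁, c', q', hq'⟩ := q'
  by_cases e : b = b₁
  swap
  · rw [pathMul_of_ne K h _ _ e] at h₁; exact absurd h₁.symm hne
  by_cases e' : b' = b'₁
  swap
  · rw [pathMul_of_ne K h _ _ e'] at h₂; exact absurd h₂.symm hne
  subst e e'
  have hl : ∀ {x y z : Q} (p : Quiver.Path x y) (q : Quiver.Path y z), (p.length : ℤ) = i →
      (q.length : ℤ) = j → ((p.comp q).length : ℤ) = k := by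
    intro x y z p q hp hq; rw [Quiver.Path.length_comp]; push_cast; omega
  rw [pathMul_comp K h p q hp hq (hl p q hp hq)] at h₁
  rw [pathMul_comp K h p' q' hp' hq' (hl p' q' hp' hq')] at h₂
  have h₃ := Finsupp.single_left_injective (one_ne_zero (α := K)) (h₁.trans h₂.symm)
  injection h₃ with h₄ h₅ h₆
  subst h₄ h₅
  have := comp_midpoint_unique p q p' q' (by omega) (eq_of_heq h₆)
  injection this with h₇ h₈
  subst h₇
  have h₉ := eq_of_heq h₈
  injection h₉ with h₁₀ h₁₁
  subst h₁₀ h₁₁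
  rfl

/-- Summation over the paths of length `i + j` amounts to summation over pairs of paths of lengths
`i` and `j`. -/
theorem sum_pathMul [Fintype Q] [∀ a b : Q, Finite (a ⟶ b)] {i j k : ℤ} (h : i + j = k)
    (hi : 0 ≤ i) (hj : 0 ≤ j) {W : Type*} [AddCommMonoid W] (G : (PathOfLength Q k →₀ K) → W)
    (hG : G 0 = 0) :
    ∑ p : PathOfLength Q i, ∑ q : PathOfLength Q j, G (pathMul K h p q) =
      ∑ r : PathOfLength Q k, G (Finsupp.single r 1) := by
  choose e₁ e₂ he using exists_pathMul_eq K h hi hj (Q := Q)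
  rw [← Fintype.sum_prod_type' (f := fun p q => G (pathMul K h p q))]
  symm
  refine Finset.sum_of_injOn (fun r => (e₁ r, e₂ r)) ?_ (fun _ _ => Finset.mem_coe.2
    (Finset.mem_univ _)) ?_ ?_
  · intro r _ r' _ hr
    have h₁ : e₁ r = e₁ r' := congrArg Prod.fst hr
    have h₂ : e₂ r = e₂ r' := congrArg Prod.snd hr
    have h₃ := he r
    rw [h₁, h₂, he r'] at h₃
    exact (Finsupp.single_left_injective (one_ne_zero (α := K)) h₃).symm
  · rintro ⟨p, q⟩ _ hpq
    rcases pathMul_eq_zero_or K h p q with h₀ | ⟨r, hr⟩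
    · dsimp only; rw [h₀, hG]
    · exact absurd ⟨r, Finset.mem_coe.2 (Finset.mem_univ _),
        (pathMul_unique K h (he r) hr)⟩ hpq
  · intro r _
    dsimp only
    rw [he r]

theorem pathMul_triv {j : ℤ} (p : PathOfLength Q j) (a : Q) [Decidable (p.terminus = a)] :
    pathMul K (add_zero j) p (PathOfLength.triv a) =
      if p.terminus = a then Finsupp.single p 1 else 0 := by
  split_ifs with h
  · subst h
    obtain ⟨a, b, p, hp⟩ := p
    exact pathMul_comp K _ p Quiver.Path.nil hp _ hp
  · exact pathMul_of_ne K _ _ _ h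

theorem triv_pathMul {j : ℤ} (p : PathOfLength Q j) (a : Q) [Decidable (p.origin = a)] :
    pathMul K (zero_add j) (PathOfLength.triv a) p =
      if p.origin = a then Finsupp.single p 1 else 0 := by
  split_ifs with h
  · subst h
    obtain ⟨a, b, p, hp⟩ := p
    exact (pathMul_comp K _ Quiver.Path.nil p (by simp) hp (by simpa using hp)).trans (by simp)
  · exact pathMul_of_ne K _ _ _ (fun e => h e.symm)

end Paths

section Idempotents

variable {Q : Type u} [Fintype Q]

/-- The opposite algebra has the same idempotents. -/
def Idem.op {A : GrAlg K} (ε : Idem A Q) : Idem A.op Q where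
  e := ε.e
  mul_self := ε.mul_self
  mul_ne := fun h => ε.mul_ne h.symm
  sum := ε.sum

/-- The images of the idempotents in a quotient algebra. -/
def Idem.quot {A : GrAlg K} (ε : Idem A Q) (J : A.HomIdeal) : Idem (A.quot J) Q where
  e := fun a => (J.comp 0).mkQ (ε.e a)
  mul_self := fun a => congrArg (J.comp 0).mkQ (ε.mul_self a)
  mul_ne := fun h => (congrArg (J.comp 0).mkQ (ε.mul_ne h)).trans (map_zero _)
  sum := (map_sum (J.comp 0).mkQ ε.e Finset.univ).symm.trans (congrArg (J.comp 0).mkQ ε.sum)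

/-- The trivial paths, as idempotents of the path algebra. -/
noncomputable def pathIdem [Quiver.{u} Q] : Idem (pathAlg K Q) Q where
  e := fun a => Finsupp.single (PathOfLength.triv a) 1
  mul_self := fun a => by
    classical
    refine (pathMulLin_single K _ _ _ _ _).trans ?_
    rw [pathMul_triv, one_mul, one_smul]
    exact if_pos rfl
  mul_ne := fun {a b} h => by
    classical
    refine (pathMulLin_single K _ _ _ _ _).trans ?_
    rw [pathMul_triv, one_mul, one_smul]
    exact if_neg h
  sum := rfl

end Idempotents

section Quotients

variable {Q : Type u} [Quiver.{u} Q] [Fintype Q]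

theorem comp_eq_bot_of_lt {n : ℕ} {I : GrAlg.HomIdeal (pathAlg K Q)}
    (hI : RelationsOfDegreeGE n I) {i : ℤ} (hi : i < n) : I.comp i = ⊥ := by
  classical
  let J : GrAlg.HomIdeal (pathAlg K Q) :=
    { comp := fun i => if i < n then ⊥ else ⊤
      mul_left := by
        intro i j k h a x hx
        split_ifs at hx with hj
        · rw [(Submodule.mem_bot K).1 hx, map_zero]; exact zero_mem _
        · by_cases hi : 0 ≤ i
          · rw [if_neg (by omega)]; trivial
          · obtain rfl : a = 0 := Finsupp.ext fun p => absurd p.nonneg hi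
            rw [map_zero]; exact zero_mem _
      mul_right := by
        intro i j k h x a hx
        split_ifs at hx with hj
        · rw [(Submodule.mem_bot K).1 hx, map_zero]; exact zero_mem _
        · by_cases hi : 0 ≤ j
          · rw [if_neg (by omega)]; trivial
          · obtain rfl : a = 0 := Finsupp.ext fun p => absurd p.nonneg hi
            rw [map_zero]; exact zero_mem _ }
  rw [eq_bot_iff, hI]
  have hJ : J.comp i = ⊥ := if_pos hi
  rw [← hJ]
  refine sInf_le ⟨J, ?_, rfl⟩
  rintro l x ⟨hl, -⟩
  change x ∈ (if l < n then ⊥ else ⊤ : Submodule K _)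
  rw [if_neg (by omega)]; trivial

section PathQuot

/-- The projection of the path algebra onto a quotient. -/
noncomputable def clsLin (I : GrAlg.HomIdeal (pathAlg K Q)) (i : ℤ) :
    (PathOfLength Q i →₀ K) →ₗ[K] ((pathAlg K Q).quot I).comp i :=
  (I.comp i).mkQ

/-- The class of a path in a quotient of the path algebra. -/
noncomputable def cls (I : GrAlg.HomIdeal (pathAlg K Q)) {i : ℤ} (p : PathOfLength Q i) :
    ((pathAlg K Q).quot I).comp i :=
  clsLin I i (Finsupp.single p 1)

/-- The projection of the opposite path algebra onto a quotient. -/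
noncomputable def clsOpLin (J : GrAlg.HomIdeal (pathAlg K Q).op) (i : ℤ) :
    (PathOfLength Q i →₀ K) →ₗ[K] ((pathAlg K Q).op.quot J).comp i :=
  (J.comp i).mkQ

/-- The class of a path in a quotient of the opposite of the path algebra. -/
noncomputable def clsOp (J : GrAlg.HomIdeal (pathAlg K Q).op) {i : ℤ} (p : PathOfLength Q i) :
    ((pathAlg K Q).op.quot J).comp i :=
  clsOpLin J i (Finsupp.single p 1)

variable (I : GrAlg.HomIdeal (pathAlg K Q)) (J : GrAlg.HomIdeal (pathAlg K Q).op)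

theorem clsLin_surjective (i : ℤ) : Function.Surjective (clsLin I i) :=
  (I.comp i).mkQ_surjective

theorem clsOpLin_surjective (i : ℤ) : Function.Surjective (clsOpLin J i) :=
  (J.comp i).mkQ_surjective

theorem cls_mul {i j k : ℤ} (h : i + j = k) (p : PathOfLength Q i) (q : PathOfLength Q j) :
    ((pathAlg K Q).quot I).mul h (cls I p) (cls I q) = clsLin I k (pathMul K h p q) := by
  refine (congrArg (clsLin I k) (pathMulLin_single K h p q 1 1)).trans ?_
  rw [one_mul, one_smul]

theorem clsOp_mul {i j k : ℤ} (h : i + j = k) (p : PathOfLength Q i) (q : PathOfLength Q j) :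
    ((pathAlg K Q).op.quot J).mul h (clsOp J p) (clsOp J q) =
      clsOpLin J k (pathMul K (show j + i = k by omega) q p) := by
  refine (congrArg (clsOpLin J k)
    (pathMulLin_single K (show j + i = k by omega) q p 1 1)).trans ?_
  rw [one_mul, one_smul]

theorem span_cls (i : ℤ) : Submodule.span K (Set.range (cls I (i := i))) = ⊤ := by
  have : Set.range (cls I (i := i)) =
      clsLin I i '' Set.range fun p : PathOfLength Q i => (Finsupp.single p 1 : _ →₀ K) := by
    rw [← Set.range_comp]; rfl
  rw [this, Submodule.span_image, ← Finsupp.coe_basisSingleOne, Module.Basis.span_eq,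
    Submodule.map_top, LinearMap.range_eq_top]
  exact clsLin_surjective I i

theorem span_clsOp (i : ℤ) : Submodule.span K (Set.range (clsOp J (i := i))) = ⊤ := by
  have : Set.range (clsOp J (i := i)) =
      clsOpLin J i '' Set.range fun p : PathOfLength Q i => (Finsupp.single p 1 : _ →₀ K) := by
    rw [← Set.range_comp]; rfl
  rw [this, Submodule.span_image, ← Finsupp.coe_basisSingleOne, Module.Basis.span_eq,
    Submodule.map_top, LinearMap.range_eq_top]
  exact clsOpLin_surjective J i

theorem quot_eq_zero_of_neg (i : ℤ) (hi : i < 0) (a : ((pathAlg K Q).quot I).comp i) : a = 0 := by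
  have ha : a ∈ Submodule.span K (Set.range (cls I (i := i))) := by rw [span_cls]; trivial
  rw [Set.range_eq_empty_iff.2 ⟨fun p => absurd p.nonneg (by omega)⟩, Submodule.span_empty] at ha
  exact (Submodule.mem_bot K).1 ha

theorem quotOp_eq_zero_of_neg (i : ℤ) (hi : i < 0) (a : ((pathAlg K Q).op.quot J).comp i) :
    a = 0 := by
  have ha : a ∈ Submodule.span K (Set.range (clsOp J (i := i))) := by rw [span_clsOp]; trivial
  rw [Set.range_eq_empty_iff.2 ⟨fun p => absurd p.nonneg (by omega)⟩, Submodule.span_empty] at ha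
  exact (Submodule.mem_bot K).1 ha

theorem quot_finite [∀ a b : Q, Finite (a ⟶ b)] (i : ℤ) :
    Module.Finite K (((pathAlg K Q).quot I).comp i) :=
  ⟨by rw [← span_cls I i]; exact Submodule.fg_span (Set.finite_range _)⟩

theorem quot_span_idem :
    Submodule.span K (Set.range ((pathIdem (K := K) (Q := Q)).quot I).e) = ⊤ := by
  rw [← span_cls I 0]
  apply le_antisymm
  · apply Submodule.span_mono
    rintro _ ⟨a, rfl⟩
    exact ⟨PathOfLength.triv a, rfl⟩
  · apply Submodule.span_mono
    rintro _ ⟨p, rfl⟩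
    refine ⟨p.origin, ?_⟩
    rw [p.eq_triv]; rfl

/-- The opposite path algebra, and hence each of its quotients, is generated in degree `1`. -/
theorem quotOp_span_mul {i j k : ℤ} (h : i + j = k) (hi : 0 ≤ i) (hj : 0 ≤ j) :
    Submodule.span K {c | ∃ a b, c = ((pathAlg K Q).op.quot J).mul h a b} = ⊤ := by
  rw [eq_top_iff, ← span_clsOp J k]
  apply Submodule.span_mono
  rintro _ ⟨r, rfl⟩
  obtain ⟨p, q, hpq⟩ := exists_pathMul_eq K (show j + i = k by omega) hj hi r
  refine ⟨clsOp J q, clsOp J p, ?_⟩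
  rw [clsOp_mul, hpq]; rfl

open Classical in
theorem cls_mul_idem {i : ℤ} (p : PathOfLength Q i) (a : Q) :
    ((pathAlg K Q).quot I).mul (add_zero i) (cls I p) ((pathIdem.quot I).e a) =
      if p.terminus = a then cls I p else 0 := by
  refine (cls_mul I (add_zero i) p (PathOfLength.triv a)).trans ?_
  rw [pathMul_triv]
  split_ifs
  · rfl
  · exact map_zero _

open Classical in
theorem idem_mul_cls {i : ℤ} (p : PathOfLength Q i) (a : Q) :
    ((pathAlg K Q).quot I).mul (zero_add i) ((pathIdem.quot I).e a) (cls I p) =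
      if p.origin = a then cls I p else 0 := by
  refine (cls_mul I (zero_add i) (PathOfLength.triv a) p).trans ?_
  rw [triv_pathMul]
  split_ifs
  · rfl
  · exact map_zero _

open Classical in
theorem clsOp_mul_idem {i : ℤ} (p : PathOfLength Q i) (a : Q) :
    ((pathAlg K Q).op.quot J).mul (add_zero i) (clsOp J p) ((pathIdem.op.quot J).e a) =
      if p.origin = a then clsOp J p else 0 := by
  refine (clsOp_mul J (add_zero i) p (PathOfLength.triv a)).trans ?_
  rw [triv_pathMul]
  split_ifs
  · rfl
  · exact map_zero _

open Classical in
theorem idem_mul_clsOp {i : ℤ} (p : PathOfLength Q i) (a : Q) :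
    ((pathAlg K Q).op.quot J).mul (zero_add i) ((pathIdem.op.quot J).e a) (clsOp J p) =
      if p.terminus = a then clsOp J p else 0 := by
  refine (clsOp_mul J (zero_add i) (PathOfLength.triv a) p).trans ?_
  rw [pathMul_triv]
  split_ifs
  · rfl
  · exact map_zero _

end PathQuot

end Quotients

/-! ### The linear complex of a module over a quotient of the opposite path algebra -/

section Complex

variable {Q : Type u} [Quiver.{u} Q] [Fintype Q]

/-- The idempotents of a quotient of the path algebra given by the vertices. -/
noncomputable abbrev idemA (I : GrAlg.HomIdeal (pathAlg K Q)) : Idem ((pathAlg K Q).quot I) Q :=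
  pathIdem.quot I

/-- The idempotents of a quotient of the opposite path algebra given by the vertices. -/
noncomputable abbrev idemC (J : GrAlg.HomIdeal (pathAlg K Q).op) :
    Idem ((pathAlg K Q).op.quot J) Q :=
  pathIdem.op.quot J

open GrMod

section Coinduced

variable {I : GrAlg.HomIdeal (pathAlg K Q)}
variable {V W : Type u} [AddCommGroup V] [Module K V] [AddCommGroup W] [Module K W]
variable {w : VertAct K Q V} {w' : VertAct K Q W} {k : ℤ}

theorem ev_ext_cls {i j : ℤ} (h : k + i + j = 0) {f g : (coind (idemA I) w k).comp i}
    (hfg : ∀ p, ev h f (cls I p) = ev h g (cls I p)) : f = g := by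
  refine ev_ext h fun b => ?_
  have hb : b ∈ Submodule.span K (Set.range (cls I (i := j))) := by rw [span_cls]; trivial
  induction hb using Submodule.span_induction with
  | mem b hb => obtain ⟨p, rfl⟩ := hb; exact hfg p
  | zero => simp
  | add b c _ _ hb hc => rw [map_add, map_add, hb, hc]
  | smul r b _ hb => rw [map_smul, map_smul, hb]

open Classical in
/-- Elements of a coinduced module are given by their values at paths. -/
theorem exists_coind {i j : ℤ} (h : k + i + j = 0) (ψ : PathOfLength Q j → V)
    (hI : ∀ x : PathOfLength Q j →₀ K, x ∈ I.comp j → Finsupp.linearCombination K ψ x = 0)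
    (hψ : ∀ p a, w.e a (ψ p) = if p.terminus = a then ψ p else 0) :
    ∃ f : (coind (idemA I) w k).comp i, ∀ p, ev h f (cls I p) = ψ p := by
  let φ : ((pathAlg K Q).quot I).comp j →ₗ[K] V :=
    (I.comp j).liftQ (Finsupp.linearCombination K ψ) fun x hx => hI x hx
  have hφ : ∀ p, φ (cls I p) = ψ p := by
    intro p
    refine ((I.comp j).liftQ_apply _ _).trans ?_
    exact (Finsupp.linearCombination_single K 1 p).trans (one_smul _ _)
  refine ⟨coindMk h φ ?_, fun p => by rw [ev_coindMk, hφ]⟩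
  intro b a
  have hb : b ∈ Submodule.span K (Set.range (cls I (i := j))) := by rw [span_cls]; trivial
  induction hb using Submodule.span_induction with
  | mem b hb =>
    obtain ⟨p, rfl⟩ := hb
    rw [cls_mul_idem, hφ, hψ]
    split_ifs
    · exact hφ p
    · exact map_zero _
  | zero => simp
  | add b c _ _ hb hc => simp only [map_add, LinearMap.add_apply, hb, hc]
  | smul r b _ hb => simp only [map_smul, LinearMap.smul_apply, hb]

open Classical in
/-- The element supported at one path `p`; it exists where there are no relations. -/
theorem exists_coind_single {i j : ℤ} (h : k + i + j = 0) (hI : I.comp j = ⊥)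
    (p : PathOfLength Q j) (v : V) : ∃ f : (coind (idemA I) w k).comp i,
      ∀ q, ev h f (cls I q) = if q = p then w.e p.terminus v else 0 := by
  refine exists_coind h _ ?_ ?_
  · intro x hx
    rw [hI] at hx
    have hx0 : x = 0 := (Submodule.mem_bot (M := (pathAlg K Q).comp j) K).1 hx
    rw [hx0, map_zero]
  · intro q a
    by_cases hq : q = p
    · subst hq
      by_cases ha : q.terminus = a
      · subst ha; simp [w.self]
      · simp [ha, w.ne (Ne.symm ha)]
    · simp [hq]

theorem exists_coind_one (hI : I.comp 0 = ⊥) {i : ℤ} (h : k + i + 0 = 0) (v : V) :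
    ∃ f : (coind (idemA I) w k).comp i, ev h f ((pathAlg K Q).quot I).one = v := by
  classical
  obtain ⟨f, hf⟩ := exists_coind (I := I) (w := w) h (fun p => w.e p.origin v) (by
    intro x hx
    rw [hI] at hx
    have hx0 : x = 0 := (Submodule.mem_bot (M := (pathAlg K Q).comp 0) K).1 hx
    rw [hx0, map_zero]) (by
    intro p a
    have hp : p.terminus = p.origin := by rw [p.eq_triv]; rfl
    rw [hp]
    split_ifs with ha
    · subst ha; rw [w.self]
    · rw [w.ne (Ne.symm ha)])
  refine ⟨f, ?_⟩
  rw [← (idemA I).sum, map_sum, ← w.sum v]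
  exact Finset.sum_congr rfl fun a _ => hf (PathOfLength.triv a)

/-- A morphism between coinduced modules that acts by `γ` on the values at `1` acts by `γ` on all
values. -/
theorem ev_one_eq {g : coind (idemA I) w k ⟶ coind (idemA I) w' k} {γ : V →ₗ[K] W}
    (hγ : ∀ {i : ℤ} (h : k + i + 0 = 0) (f : (coind (idemA I) w k).comp i),
      ev h (g.app i f) ((pathAlg K Q).quot I).one = γ (ev h f ((pathAlg K Q).quot I).one))
    {i j : ℤ} (h : k + i + j = 0) (f : (coind (idemA I) w k).comp i)
    (b : ((pathAlg K Q).quot I).comp j) : ev h (g.app i f) b = γ (ev h f b) := by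
  have h0 : k + (i + j) + 0 = 0 := by omega
  have h1 := hγ h0 ((coind (idemA I) w k).act rfl f b)
  rw [hom_comm g, ev_act rfl h0 h (add_zero j), ev_act rfl h0 h (add_zero j)] at h1
  simpa only [GrAlg.mul_one] using h1

/-- Elements of the lowest degree of a coinduced module are determined by their value at `1`. -/
theorem ev_one_ext {i : ℤ} (h : k + i + 0 = 0) {f f' : (coind (idemA I) w k).comp i}
    (hff : ev h f ((pathAlg K Q).quot I).one = ev h f' ((pathAlg K Q).quot I).one) : f = f' := by
  refine ev_ext_cls h fun p => ?_
  have : cls I p = ((pathAlg K Q).quot I).mul (add_zero 0) ((pathAlg K Q).quot I).one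
      ((idemA I).e p.origin) := by
    rw [GrAlg.one_mul]
    change clsLin I 0 _ = clsLin I 0 _
    rw [p.eq_triv]; rfl
  rw [this, ev_idem, ev_idem, hff]

/-- Every morphism between modules coinduced in the same degree is coinduced. -/
theorem exists_coindMap (hI : I.comp 0 = ⊥) (g : coind (idemA I) w k ⟶ coind (idemA I) w' k) :
    ∃ (γ : V →ₗ[K] W) (hγ : ∀ a v, γ (w.e a v) = w'.e a (γ v)),
      g = coindMap (idemA I) w w' k γ hγ := by
  have h : k + -k + 0 = 0 := by omega
  have hinj := fun f f' : (coind (idemA I) w k).comp (-k) => ev_one_ext h (f := f) (f' := f')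
  choose s hs using fun v : V => exists_coind_one (w := w) hI h v
  let γ : V →ₗ[K] W :=
    { toFun := fun v => ev h (g.app _ (s v)) ((pathAlg K Q).quot I).one
      map_add' := fun v v' => by
        rw [hinj (s (v + v')) (s v + s v') (by
          rw [map_add, LinearMap.add_apply, hs, hs, hs]), map_add, map_add, LinearMap.add_apply]
      map_smul' := fun c v => by
        rw [hinj (s (c • v)) (c • s v) (by
          rw [map_smul, LinearMap.smul_apply, hs, hs]), map_smul, map_smul, LinearMap.smul_apply]
        rfl }
  have hγ : ∀ {i j : ℤ} (h : k + i + j = 0) (f : (coind (idemA I) w k).comp i)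
      (b : ((pathAlg K Q).quot I).comp j), ev h (g.app i f) b = γ (ev h f b) := by
    refine fun {i j} => ev_one_eq (γ := γ) (j := j) ?_
    intro i h' f
    obtain rfl : i = -k := by omega
    change _ = ev h (g.app _ (s _)) _
    rw [hinj f (s _) (hs _).symm]
    congr 4
    exact (hs _).symm
  refine ⟨γ, ?_, ?_⟩
  · intro a v
    obtain ⟨f, hf⟩ := exists_coind_one (w := w) hI h v
    have h1 := ev_idem h f ((pathAlg K Q).quot I).one a
    have h2 := ev_idem h (g.app _ f) ((pathAlg K Q).quot I).one a
    rw [hγ, hγ, h1, hf] at h2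
    exact h2
  · refine hom_ext fun i f => ev_ext (j := -(k + i)) (by omega) fun b => ?_
    rw [hγ, ev_coindMap]

end Coinduced

section Differential

variable (I : GrAlg.HomIdeal (pathAlg K Q)) {J : GrAlg.HomIdeal (pathAlg K Q).op}
variable (Z Z' : GrMod ((pathAlg K Q).op.quot J))

/-- The terms of the linear complex attached to a module over a quotient of `KQ^op`. -/
noncomputable abbrev linObj (k : ℤ) : GrMod ((pathAlg K Q).quot I) :=
  coind (idemA I) ((idemC J).act Z k) k

variable [∀ a b : Q, Finite (a ⟶ b)]

/-- The morphism `f ↦ (b ↦ ∑_p f(b p) p^o)`, where `p` runs through the paths of length `r`. For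
`r = 1` this is the differential of the linear complex, and for general `r` it is the composition of
`r` consecutive differentials. -/
noncomputable def linD (r i j : ℤ) (h : i + r = j) : linObj I Z i ⟶ linObj I Z j :=
  homToCoind (M := linObj I Z i)
    (fun x y hxy => ∑ p : PathOfLength Q r,
      (LinearMap.llcomp K _ _ _ ((Z.act h).flip (clsOp J p))) ∘ₗ
        (LinearMap.lcomp K _ ((((pathAlg K Q).quot I).mul (rfl : y + r = y + r)).flip (cls I p))) ∘ₗ
          ev (show i + x + (y + r) = 0 by omega))
    (by
      classical
      intro x y hxy f b a
      simp only [LinearMap.sum_apply, LinearMap.comp_apply, LinearMap.llcomp_apply,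
        LinearMap.lcomp_apply, LinearMap.flip_apply, map_sum]
      refine Finset.sum_congr rfl fun p _ => ?_
      rw [GrAlg.mul_assoc _ (add_zero y) rfl (zero_add r) rfl, Idem.act_e,
        Z.act_mul h (add_zero j) (add_zero r) h, idem_mul_cls, clsOp_mul_idem]
      split_ifs
      · rfl
      · simp)
    (by
      intro x y x' l hx hl hl' f a b
      simp only [LinearMap.sum_apply, LinearMap.comp_apply, LinearMap.llcomp_apply,
        LinearMap.lcomp_apply, LinearMap.flip_apply]
      refine Finset.sum_congr rfl fun p _ => ?_
      rw [ev_act hx _ (l' := y + l + r) (by omega) (by omega),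
        GrAlg.mul_assoc _ rfl rfl rfl (by omega)])

theorem ev_linD {r i j : ℤ} (h : i + r = j) {x y y' : ℤ} (hy : j + x + y = 0)
    (hy' : i + x + y' = 0) (hr : y + r = y') (f : (linObj I Z i).comp x)
    (b : ((pathAlg K Q).quot I).comp y) :
    ev hy ((linD I Z r i j h).app x f) b = ∑ p : PathOfLength Q r,
      Z.act h (ev hy' f (((pathAlg K Q).quot I).mul hr b (cls I p))) (clsOp J p) := by
  subst hr
  rw [linD, ev_homToCoind]
  simp only [LinearMap.sum_apply, LinearMap.comp_apply, LinearMap.llcomp_apply,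
        LinearMap.lcomp_apply, LinearMap.flip_apply]

theorem linD_zero (i j : ℤ) (r : ℤ) (hr : r = 0) (h : i + r = j) :
    linD I Z r i j h = eqToHom (by rw [← h, hr, add_zero]) := by
  subst hr
  obtain rfl : i = j := by omega
  refine hom_ext fun x f => ev_ext (j := -(i + x)) (by omega) fun b => ?_
  rw [ev_linD I Z h _ (by omega) (add_zero _), eqToHom_refl, id_app,
    ← Fintype.sum_bijective (PathOfLength.triv (Q := Q)) (f := fun a =>
      ((idemC J).act Z i).e a (ev (by omega) f b))]
  · exact ((idemC J).act Z i).sum _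
  · refine ⟨fun a b hab => congrArg PathOfLength.origin hab, fun p => ⟨p.origin, p.eq_triv.symm⟩⟩
  · intro a
    have h1 := ev_idem (show i + x + -(i + x) = 0 by omega) f b a
    refine Eq.symm ((congrArg (fun v => Z.act h v (clsOp J (PathOfLength.triv a))) h1).trans ?_)
    exact ((idemC J).act Z i).self a _

theorem linD_comp {r r' i i' j : ℤ} (hr : 0 ≤ r) (h₁ : i + 1 = i') (h₂ : i' + r = j)
    (hr' : r + 1 = r') (h₃ : i + r' = j) :
    linD I Z 1 i i' h₁ ≫ linD I Z r i' j h₂ = linD I Z r' i j h₃ := by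
  refine hom_ext fun x f => ev_ext (j := -(j + x)) (by omega) fun b => ?_
  rw [comp_app, ev_linD I Z h₂ _ (y' := -(j + x) + r) (by omega) rfl,
    ev_linD I Z h₃ _ (y' := -(j + x) + r') (by omega) rfl]
  refine Eq.trans ?_ (sum_pathMul K hr' hr zero_le_one (fun y => Z.act h₃ (ev (by omega) f
    (((pathAlg K Q).quot I).mul (rfl : -(j + x) + r' = _) b (clsLin I r' y))) (clsOpLin J r' y))
    (by simp))
  refine Finset.sum_congr rfl fun p _ => ?_
  rw [ev_linD I Z h₁ _ (y' := -(j + x) + r') (by omega) (by omega), map_sum, LinearMap.sum_apply]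
  refine Finset.sum_congr rfl fun q _ => ?_
  rw [Z.act_mul h₁ h₂ (by omega : 1 + r = r') h₃, clsOp_mul, GrAlg.mul_assoc _ rfl _ hr' rfl,
    cls_mul]

theorem dIter_linD (r : ℕ) (i j : ℤ) (h : i + r = j) :
    dIter (I := linObj I Z) (linD I Z 1) r i j h = linD I Z r i j h := by
  induction r generalizing i with
  | zero => exact (linD_zero I Z i j _ (by simp) h).symm
  | succ r ih =>
    rw [dIter, ih]
    exact linD_comp I Z (by omega) rfl _ (by push_cast; rfl) h

variable {Z Z'} in
/-- Maps that are compatible with the action of the paths induce morphisms that are compatible with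
the differentials. -/
theorem linD_coindMap {r i j : ℤ} (h : i + r = j) (γ : Z.comp i →ₗ[K] Z'.comp i)
    (hγ : ∀ a v, γ (((idemC J).act Z i).e a v) = ((idemC J).act Z' i).e a (γ v))
    (γ' : Z.comp j →ₗ[K] Z'.comp j)
    (hγ' : ∀ a v, γ' (((idemC J).act Z j).e a v) = ((idemC J).act Z' j).e a (γ' v))
    (hc : ∀ (p : PathOfLength Q r) v, γ' (Z.act h v (clsOp J p)) = Z'.act h (γ v) (clsOp J p)) :
    linD I Z r i j h ≫ coindMap (idemA I) _ _ j γ' hγ' =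
      coindMap (idemA I) _ _ i γ hγ ≫ linD I Z' r i j h := by
  refine hom_ext fun x f => ev_ext (j := -(j + x)) (by omega) fun b => ?_
  rw [comp_app, comp_app, ev_coindMap, ev_linD I Z h _ (y' := -(j + x) + r) (by omega) rfl,
    ev_linD I Z' h _ (y' := -(j + x) + r) (by omega) rfl, map_sum]
  refine Finset.sum_congr rfl fun p _ => ?_
  rw [hc, ev_coindMap]

/-- The product `v p^o` is the value at `1` of the image, under the differential, of the element
supported at `p` with value `v e`, where `e` is the idempotent of the end of `p`. -/
theorem exists_linD_eq {r i j : ℤ} (h : i + r = j) (hI : I.comp r = ⊥) (p : PathOfLength Q r)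
    (v : Z.comp i) {x : ℤ} (hx : j + x + 0 = 0) : ∃ f : (linObj I Z i).comp x,
      ev hx ((linD I Z r i j h).app x f) ((pathAlg K Q).quot I).one = Z.act h v (clsOp J p) ∧
      (∀ q, q ≠ p → ev (show i + x + r = 0 by omega) f (cls I q) = 0) ∧
      ev (show i + x + r = 0 by omega) f (cls I p) = ((idemC J).act Z i).e p.terminus v := by
  classical
  obtain ⟨f, hf⟩ := exists_coind_single (w := (idemC J).act Z i) (k := i) (i := x) (by omega) hI p v
  refine ⟨f, ?_, fun q hq => by rw [hf, if_neg hq], by rw [hf, if_pos rfl]⟩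
  rw [ev_linD I Z h hx (by omega) (zero_add r), Finset.sum_eq_single p]
  · rw [GrAlg.one_mul, hf, if_pos rfl, Idem.act_e, Z.act_mul (add_zero i) h (zero_add r) h,
      idem_mul_clsOp, if_pos rfl]
  · intro q _ hq
    rw [GrAlg.one_mul, hf, if_neg hq, map_zero, LinearMap.zero_apply]
  · intro hp; exact absurd (Finset.mem_univ p) hp

variable {Z Z'} in
/-- Conversely, compatibility with the differentials implies compatibility with the action of the
paths, as long as there are no relations between these paths. -/
theorem coindMap_linD {r i j : ℤ} (h : i + r = j) (hI : I.comp r = ⊥)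
    (γ : Z.comp i →ₗ[K] Z'.comp i)
    (hγ : ∀ a v, γ (((idemC J).act Z i).e a v) = ((idemC J).act Z' i).e a (γ v))
    (γ' : Z.comp j →ₗ[K] Z'.comp j)
    (hγ' : ∀ a v, γ' (((idemC J).act Z j).e a v) = ((idemC J).act Z' j).e a (γ' v))
    (hc : linD I Z r i j h ≫ coindMap (idemA I) _ _ j γ' hγ' =
      coindMap (idemA I) _ _ i γ hγ ≫ linD I Z' r i j h) (p : PathOfLength Q r) (v : Z.comp i) :
    γ' (Z.act h v (clsOp J p)) = Z'.act h (γ v) (clsOp J p) := by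
  obtain ⟨f, hf, hf', hf''⟩ := exists_linD_eq I Z h hI p v (x := -j) (by omega)
  have h1 := congrArg (fun g => ev (show j + -j + 0 = 0 by omega) (g.app (-j) f)
    ((pathAlg K Q).quot I).one) hc
  rw [comp_app, comp_app, ev_coindMap, hf, ev_linD I Z' h _ (y' := r) (by omega) (zero_add r),
    Finset.sum_eq_single p] at h1
  · rw [h1, GrAlg.one_mul, ev_coindMap, hf'', hγ, Idem.act_e,
      Z'.act_mul (add_zero i) h (zero_add r) h, idem_mul_clsOp, if_pos rfl]
  · intro q _ hq
    rw [GrAlg.one_mul, ev_coindMap, hf' q hq, map_zero, map_zero, LinearMap.zero_apply]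
  · intro hp; exact absurd (Finset.mem_univ p) hp

end Differential

section Dual

variable (n : ℕ) (I : GrAlg.HomIdeal (pathAlg K Q))

/-- The ideal generated by `I_n^⊥`. -/
noncomputable abbrev dualIdeal : GrAlg.HomIdeal (pathAlg K Q).op :=
  (pathAlg K Q).op.span fun i => {x | i = (n : ℤ) ∧ x ∈ orthogonal i I}

variable {n I} in
theorem clsOpLin_of_orthogonal (ξ : PathOfLength Q (n : ℤ) →₀ K)
    (hξ : ξ ∈ orthogonal (n : ℤ) I) : clsOpLin (dualIdeal n I) n ξ = 0 := by
  refine (Submodule.Quotient.mk_eq_zero _).2 ?_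
  refine (Submodule.mem_sInf).2 ?_
  rintro _ ⟨J, hJ, rfl⟩
  exact hJ n ⟨rfl, hξ⟩

variable [∀ a b : Q, Finite (a ⟶ b)] (Z : GrMod ((pathAlg K Q).op.quot (dualIdeal n I)))

/-- The composition of `n` consecutive differentials vanishes: functionals on `A_n` are elements of
`I_n^⊥`, which act by zero on modules over the dual algebra. -/
theorem linD_dual (i j : ℤ) (h : i + n = j) : linD I Z n i j h = 0 := by
  classical
  refine hom_ext fun x f => ev_ext (j := -(j + x)) (by omega) fun b => ?_
  rw [ev_linD I Z h _ (y' := -(j + x) + n) (by omega) rfl, zero_app, map_zero,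
    LinearMap.zero_apply]
  have := quot_finite I (n : ℤ)
  let g : ((pathAlg K Q).quot I).comp n →ₗ[K] Z.comp i :=
    ev (show i + x + (-(j + x) + n) = 0 by omega) f ∘ₗ
      ((pathAlg K Q).quot I).mul (rfl : -(j + x) + (n : ℤ) = _) b
  change ∑ p : PathOfLength Q (n : ℤ), Z.act h (g (cls I p)) (clsOp (dualIdeal n I) p) = 0
  induction g using linearMap_induction with
  | h0 => simp
  | hadd g g' hg hg' =>
    simp only [LinearMap.add_apply, map_add, Finset.sum_add_distrib, hg, hg', add_zero]
  | hs φ v =>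
    -- the functional `φ` on `A_n` is an element of `I_n^⊥`
    let ξ : PathOfLength Q (n : ℤ) →₀ K := Finsupp.equivFunOnFinite.symm fun p => φ (cls I p)
    have hξ : ξ ∈ orthogonal (n : ℤ) I := by
      intro y hy a
      have hya : clsLin I n (pathMulLin K (add_zero (n : ℤ)) y
          (Finsupp.single (PathOfLength.triv a) 1)) = 0 :=
        (Submodule.Quotient.mk_eq_zero _).2 (I.mul_right (add_zero (n : ℤ)) y _ hy)
      have key : ∀ y : PathOfLength Q (n : ℤ) →₀ K,
          (ξ.sum fun p c => if p.terminus = a then c * y p else 0) =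
            φ (clsLin I n (pathMulLin K (add_zero (n : ℤ)) y
              (Finsupp.single (PathOfLength.triv a) 1))) := by
        intro y
        rw [Finsupp.sum_fintype _ _ (by simp)]
        induction y using Finsupp.induction_linear with
        | zero => simp
        | add y z hy hz =>
          simp only [map_add, LinearMap.add_apply, ← hy, ← hz, ← Finset.sum_add_distrib]
          refine Finset.sum_congr rfl fun p _ => ?_
          split_ifs
          · rw [Finsupp.add_apply, mul_add]
          · rw [add_zero]
        | single q c =>
          rw [pathMulLin_single, pathMul_triv, Finset.sum_eq_single q]
          · by_cases hq : q.terminus = a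
            · rw [if_pos hq, if_pos hq, Finsupp.single_eq_same, map_smul, map_smul, mul_one,
                smul_eq_mul, mul_comm]
              rfl
            · rw [if_neg hq, if_neg hq, smul_zero, map_zero, map_zero]
          · intro p _ hp
            rw [Finsupp.single_eq_of_ne hp, mul_zero, ite_self]
          · intro hp; exact absurd (Finset.mem_univ q) hp
      rw [key, hya, map_zero]
    have h1 : clsOpLin (dualIdeal n I) n ξ = ∑ p, φ (cls I p) • clsOp (dualIdeal n I) p := by
      have h2 : ξ = ∑ p, Finsupp.single p (φ (cls I p)) :=
        (Finsupp.univ_sum_single ξ).symm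
      rw [h2, map_sum]
      refine Finset.sum_congr rfl fun p _ => ?_
      rw [clsOp, ← map_smul, Finsupp.smul_single, smul_eq_mul, mul_one]
    rw [clsOpLin_of_orthogonal ξ hξ] at h1
    have h3 := congrArg (Z.act h v) h1
    rw [map_zero, map_sum] at h3
    rw [h3]
    refine Finset.sum_congr rfl fun p _ => ?_
    rw [LinearMap.smulRight_apply, map_smul, map_smul, LinearMap.smul_apply]

/-- The linear `n`-complex attached to a module over the `n`-homogeneous dual algebra. -/
noncomputable def linComplex : LinNComplex ((pathAlg K Q).quot I) n where
  obj := linObj I Z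
  d := linD I Z 1
  d_zero := fun i j h => by rw [dIter_linD, linD_dual]
  almostInjective := fun _ => coind_almostInjective fun i => quot_finite I i
  cogenerated := fun _ => coind_cogeneratedIn

end Dual

end Complex

/-! ### Modules over the opposite path algebra from the action of vertices and arrows -/

section Rep

variable {Q : Type u} [Quiver.{u} Q]

/-- An arrow, as a path of length `1`. -/
def arrowPath {a b : Q} (α : a ⟶ b) : PathOfLength Q 1 := ⟨a, b, α.toPath, by simp⟩

theorem exists_arrowPath (p : PathOfLength Q 1) :
    ∃ (a b : Q) (α : a ⟶ b), p = arrowPath α := by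
  obtain ⟨a, b, p, hp⟩ := p
  cases p with
  | nil => simp at hp
  | cons p α =>
    cases p with
    | nil => exact ⟨_, _, α, rfl⟩
    | cons p β => simp at hp; omega

variable [Fintype Q]

/-- A graded representation of the opposite quiver: vertices act by orthogonal projections, and a
path `p` of length `1` from `a` to `b` acts by a map from the `b`-part to the `a`-part, which raises
degrees by `1`. -/
structure GrRep (K : Type u) [Field K] (Q : Type u) [Quiver.{u} Q] [Fintype Q] where
  comp : ℤ → Type u
  [acg : ∀ i, AddCommGroup (comp i)]
  [mod : ∀ i, Module K (comp i)]
  vert : ∀ i, VertAct K Q (comp i)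
  arr : ∀ {i j : ℤ}, i + 1 = j → PathOfLength Q 1 → comp i →ₗ[K] comp j
  arr_source : ∀ {i j : ℤ} (h : i + 1 = j) (p : PathOfLength Q 1) (v : comp i),
    arr h p ((vert i).e p.terminus v) = arr h p v
  arr_target : ∀ {i j : ℤ} (h : i + 1 = j) (p : PathOfLength Q 1) (v : comp i),
    (vert j).e p.origin (arr h p v) = arr h p v

attribute [instance] GrRep.acg GrRep.mod

namespace GrRep

variable (R : GrRep K Q)

/-- The action of a path; a path acts by its last arrow first. -/
def pathAct {a : Q} : ∀ {b : Q} (p : Quiver.Path a b) {i j : ℤ}, i + p.length = j →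
    R.comp i →ₗ[K] R.comp j
  | _, Quiver.Path.nil, i, j, h => (show i = j by simpa using h) ▸ (R.vert i).e a
  | _, Quiver.Path.cons p α, i, j, h =>
    pathAct p (i := i + 1) (by simp at h; omega) ∘ₗ R.arr rfl (arrowPath α)

theorem pathAct_cons {a b c : Q} (p : Quiver.Path a b) (α : b ⟶ c) {i i' j : ℤ}
    (h : i + (p.cons α).length = j) (h' : i + 1 = i') (h'' : i' + p.length = j) (v : R.comp i) :
    R.pathAct (p.cons α) h v = R.pathAct p h'' (R.arr h' (arrowPath α) v) := by
  subst h'; rfl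

theorem pathAct_source {a b : Q} (p : Quiver.Path a b) {i j : ℤ} (h : i + p.length = j)
    (v : R.comp i) : R.pathAct p h ((R.vert i).e b v) = R.pathAct p h v := by
  cases p with
  | nil =>
    obtain rfl : i = j := by simpa using h
    exact (R.vert i).self a v
  | cons p α =>
    have := R.arr_source (i := i) rfl (arrowPath α) v
    have e : i + 1 + p.length = j := by simp at h; omega
    rw [R.pathAct_cons p α h rfl e, R.pathAct_cons p α h rfl e]
    exact congrArg _ this

theorem pathAct_target {a b : Q} (p : Quiver.Path a b) {i j : ℤ} (h : i + p.length = j)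
    (v : R.comp i) : (R.vert j).e a (R.pathAct p h v) = R.pathAct p h v := by
  induction p generalizing i with
  | nil =>
    obtain rfl : i = j := by simpa using h
    exact (R.vert i).self a v
  | cons p α ih =>
    rw [R.pathAct_cons p α h rfl (by simp at h; omega), ih]

theorem pathAct_comp {a b c : Q} (q : Quiver.Path a b) (p : Quiver.Path b c) {i j k : ℤ}
    (h : i + (q.comp p).length = k) (h₁ : i + p.length = j) (h₂ : j + q.length = k)
    (v : R.comp i) : R.pathAct (q.comp p) h v = R.pathAct q h₂ (R.pathAct p h₁ v) := by
  induction p generalizing i with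
  | nil =>
    obtain rfl : i = j := by simpa using h₁
    exact (R.pathAct_source q h v).symm
  | cons p α ih =>
    have e : i + 1 + p.length = j := by simp at h₁; omega
    rw [R.pathAct_cons p α h₁ rfl e]
    refine Eq.trans ?_ (ih (by simp; omega) e _)
    exact R.pathAct_cons (q.comp p) α h rfl _ v

theorem pathAct_arrow {a b : Q} (α : a ⟶ b) {i j : ℤ} (h : i + α.toPath.length = j) (h' : i + 1 = j)
    (v : R.comp i) : R.pathAct α.toPath h v = R.arr h' (arrowPath α) v := by
  refine (R.pathAct_cons Quiver.Path.nil α h h' (by simp) v).trans ?_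
  exact R.arr_target h' (arrowPath α) v

/-- The module over the opposite path algebra defined by a representation. -/
noncomputable def toMod : GrMod (pathAlg K Q).op where
  comp := R.comp
  act := fun {i j k} h => LinearMap.flip (show (PathOfLength Q j →₀ K) →ₗ[K] _ from
    Finsupp.linearCombination K fun p : PathOfLength Q j =>
      R.pathAct p.path (show i + p.path.length = k by rw [p.length_eq, h]))
  act_one := by
    intro i h x
    change Finsupp.linearCombination K (fun p : PathOfLength Q 0 => R.pathAct p.path _)
      (∑ a : Q, Finsupp.single (PathOfLength.triv a) 1) x = x
    rw [map_sum, LinearMap.sum_apply]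
    refine Eq.trans (Finset.sum_congr rfl fun a _ => ?_) ((R.vert i).sum x)
    rw [Finsupp.linearCombination_single, one_smul]
    rfl
  act_mul := by
    intro i j k ij jk l h₁ h₂ h₃ h₄ x a b
    change Finsupp.linearCombination K (fun p : PathOfLength Q k => R.pathAct p.path _) b
      (Finsupp.linearCombination K (fun p : PathOfLength Q j => R.pathAct p.path _) a x) =
      Finsupp.linearCombination K (fun p : PathOfLength Q jk => R.pathAct p.path _)
        (pathMulLin K (show k + j = jk by omega) b a) x
    induction a using Finsupp.induction_linear with
    | zero => simp
    | add f g hf hg => simp only [map_add, LinearMap.add_apply, hf, hg]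
    | single p c =>
    induction b using Finsupp.induction_linear with
    | zero => simp
    | add f g hf hg => simp only [map_add, LinearMap.add_apply, hf, hg]
    | single q d =>
    rw [pathMulLin_single, Finsupp.linearCombination_single, Finsupp.linearCombination_single,
      map_smul, LinearMap.smul_apply, LinearMap.smul_apply, LinearMap.smul_apply, map_smul,
      smul_smul]
    congr 1
    by_cases e : q.terminus = p.origin
    · obtain ⟨a, b, q, hq⟩ := q
      obtain ⟨b', c, p, hp⟩ := p
      obtain rfl : b = b' := e
      rw [pathMul_comp K (show k + j = jk by omega) q p hq hp (by
        rw [Quiver.Path.length_comp]; push_cast; omega), Finsupp.linearCombination_single, one_smul]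
      exact (R.pathAct_comp q p _ _ _ x).symm
    · rw [pathMul_of_ne K _ _ _ e, map_zero, LinearMap.zero_apply, ← R.pathAct_source,
        ← R.pathAct_target p.path, (R.vert ij).ne e, map_zero]

theorem toMod_act_single {i j k : ℤ} (h : i + j = k) (p : PathOfLength Q j) (v : R.comp i)
    (h' : i + p.path.length = k) :
    R.toMod.act h v (show PathOfLength Q j →₀ K from Finsupp.single p 1) =
      R.pathAct p.path h' v := by
  change Finsupp.linearCombination K (fun p : PathOfLength Q j => R.pathAct p.path _)
    (Finsupp.single p 1) v = _
  rw [Finsupp.linearCombination_single, one_smul]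

end GrRep

end Rep

namespace GrMod

/-- The annihilator of a graded module. -/
def ann {A : GrAlg K} (M : GrMod A) : A.HomIdeal where
  comp := fun j =>
    { carrier := {a | ∀ (i k : ℤ) (h : i + j = k) (x : M.comp i), M.act h x a = 0}
      add_mem' := fun ha hb i k h x => by rw [map_add, ha, hb, add_zero]
      zero_mem' := fun i k h x => map_zero _
      smul_mem' := fun c a ha i k h x => by rw [map_smul, ha, smul_zero] }
  mul_left := by
    intro i j k h a y hy i' k' h' x
    rw [← M.act_mul (ij := i' + i) rfl (by omega) h h', hy]
  mul_right := by
    intro i j k h y a hy i' k' h' x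
    rw [← M.act_mul (ij := i' + i) rfl (by omega) h h', hy, map_zero, LinearMap.zero_apply]

/-- A module annihilated by an ideal is a module over the quotient. -/
def descend {A : GrAlg K} (M : GrMod A) (J : A.HomIdeal) (hJ : ∀ i, J.comp i ≤ M.ann.comp i) :
    GrMod (A.quot J) where
  comp := M.comp
  act := fun {i j k} h =>
    { toFun := fun x => (J.comp j).liftQ (M.act h x) fun a ha => hJ j ha i k h x
      map_add' := fun x y => Submodule.linearMap_qext _ (LinearMap.ext fun a => by
        change M.act h (x + y) a = M.act h x a + M.act h y a
        rw [map_add, LinearMap.add_apply])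
      map_smul' := fun c x => Submodule.linearMap_qext _ (LinearMap.ext fun a => by
        change M.act h (c • x) a = c • M.act h x a
        rw [map_smul, LinearMap.smul_apply]) }
  act_one := fun h x => M.act_one h x
  act_mul := by
    intro i j k ij jk l h₁ h₂ h₃ h₄ x a b
    induction a using Submodule.Quotient.induction_on with
    | H a =>
    induction b using Submodule.Quotient.induction_on with
    | H b => exact M.act_mul h₁ h₂ h₃ h₄ x a b

end GrMod

section Descend

variable {Q : Type u} [Quiver.{u} Q] [Fintype Q] {R : GrRep K Q}
  {J : GrAlg.HomIdeal (pathAlg K Q).op} (hJ : ∀ i, J.comp i ≤ R.toMod.ann.comp i)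

theorem descend_act_clsOp {i j k : ℤ} (h : i + j = k) (p : PathOfLength Q j) (v : R.comp i)
    (h' : i + p.path.length = k) :
    (R.toMod.descend J hJ).act h v (clsOp J p) = R.pathAct p.path h' v :=
  R.toMod_act_single h p v h'

theorem descend_vert (i : ℤ) (a : Q) (v : R.comp i) :
    ((idemC J).act (R.toMod.descend J hJ) i).e a v = (R.vert i).e a v :=
  descend_act_clsOp hJ (add_zero i) (PathOfLength.triv a) v (by simp [PathOfLength.triv])

theorem descend_arr {i j : ℤ} (h : i + 1 = j) (p : PathOfLength Q 1) (v : R.comp i) :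
    (R.toMod.descend J hJ).act h v (clsOp J p) = R.arr h p v := by
  obtain ⟨a, b, α, rfl⟩ := exists_arrowPath p
  refine (descend_act_clsOp hJ h (arrowPath α) v (by simpa [arrowPath] using h)).trans ?_
  exact R.pathAct_arrow α _ h v

end Descend

/-! ### Every linear complex comes from a module -/

section Linear

open GrMod

variable {Q : Type u} [Quiver.{u} Q] [Fintype Q] [∀ a b : Q, Finite (a ⟶ b)]

/-- A morphism between modules coinduced in consecutive degrees is given by an action of the
arrows. -/
theorem exists_arrowAction {I : GrAlg.HomIdeal (pathAlg K Q)} (hI : I.comp 1 = ⊥)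
    {V W : Type u} [AddCommGroup V] [Module K V] [AddCommGroup W] [Module K W]
    {w : VertAct K Q V} {w' : VertAct K Q W} {k k' : ℤ} (hk : k + 1 = k')
    (g : coind (idemA I) w k ⟶ coind (idemA I) w' k') :
    ∃ arr : PathOfLength Q 1 → V →ₗ[K] W,
      (∀ p v, arr p (w.e p.terminus v) = arr p v) ∧ (∀ p v, w'.e p.origin (arr p v) = arr p v) ∧
      ∀ {x y y' : ℤ} (hy : k' + x + y = 0) (hy' : k + x + y' = 0) (hr : y + 1 = y')
        (f : (coind (idemA I) w k).comp x) (b : ((pathAlg K Q).quot I).comp y),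
        ev hy (g.app x f) b =
          ∑ p, arr p (ev hy' f (((pathAlg K Q).quot I).mul hr b (cls I p))) := by
  classical
  have h1 : k + -k' + 1 = 0 := by omega
  have h0 : k' + -k' + 0 = 0 := by omega
  choose χ hχ using fun (p : PathOfLength Q 1) (v : V) =>
    exists_coind_single (w := w) h1 hI p v
  let arr : PathOfLength Q 1 → V →ₗ[K] W := fun p =>
    { toFun := fun v => ev h0 (g.app _ (χ p v)) ((pathAlg K Q).quot I).one
      map_add' := fun v v' => by
        have : χ p (v + v') = χ p v + χ p v' := ev_ext_cls h1 fun q => by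
          rw [map_add, LinearMap.add_apply, hχ, hχ, hχ]
          split_ifs
          · rw [map_add]
          · rw [add_zero]
        rw [this, map_add, map_add, LinearMap.add_apply]
      map_smul' := fun c v => by
        have : χ p (c • v) = c • χ p v := ev_ext_cls h1 fun q => by
          rw [map_smul, LinearMap.smul_apply, hχ, hχ]
          split_ifs
          · rw [map_smul]
          · rw [smul_zero]
        rw [this, map_smul, map_smul, LinearMap.smul_apply, RingHom.id_apply] }
  have harr : ∀ p v, arr p v = ev h0 (g.app _ (χ p v)) ((pathAlg K Q).quot I).one :=
    fun _ _ => rfl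
  refine ⟨arr, ?_, ?_, ?_⟩
  · intro p v
    rw [harr, harr]
    congr 3
    refine ev_ext_cls h1 fun q => ?_
    rw [hχ, hχ, w.self]
  · intro p v
    have h2 := ev_idem h0 (g.app _ (χ p v)) ((pathAlg K Q).quot I).one p.origin
    rw [harr, ← h2, GrAlg.one_mul]
    have h3 := ev_act (add_zero (-k')) h0 h0 (add_zero 0) (g.app _ (χ p v)) ((idemA I).e p.origin)
      ((pathAlg K Q).quot I).one
    rw [GrAlg.mul_one] at h3
    rw [← h3, ← hom_comm g]
    congr 3
    refine ev_ext_cls h1 fun q => ?_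
    rw [ev_act (add_zero (-k')) h1 h1 (zero_add 1), idem_mul_cls, hχ]
    by_cases hq : q = p
    · subst hq; rw [if_pos rfl, hχ]
    · rw [if_neg hq]
      split_ifs
      · rw [hχ, if_neg hq]
      · rw [map_zero]
  · intro x y y' hy hy' hr f b
    have hx : x + y = -k' := by omega
    have h2 := ev_act hx h0 hy (add_zero y) (g.app x f) b ((pathAlg K Q).quot I).one
    rw [GrAlg.mul_one] at h2
    rw [← h2, ← hom_comm g]
    have h3 : (coind (idemA I) w k).act hx f b =
        ∑ p, χ p (ev hy' f (((pathAlg K Q).quot I).mul hr b (cls I p))) := by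
      refine ev_ext_cls h1 fun q => ?_
      rw [map_sum, LinearMap.sum_apply, Finset.sum_eq_single q, hχ, if_pos rfl,
        ev_act hx h1 hy' hr, ← ev_idem, GrAlg.mul_assoc _ hr (add_zero y') (add_zero 1) hr,
        cls_mul_idem, if_pos rfl]
      · intro p _ hp
        rw [hχ, if_neg (Ne.symm hp)]
      · intro hq; exact absurd (Finset.mem_univ q) hq
    rw [h3, map_sum, map_sum, LinearMap.sum_apply]
    rfl

/-- Compatibility with the differentials passes to their iterates. -/
theorem dIter_naturality {A : GrAlg K} {X Y : ℤ → GrMod A}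
    (d : ∀ i j : ℤ, i + 1 = j → (X i ⟶ X j)) (d' : ∀ i j : ℤ, i + 1 = j → (Y i ⟶ Y j))
    (τ : ∀ i, X i ⟶ Y i) (hτ : ∀ i j h, d i j h ≫ τ j = τ i ≫ d' i j h) (r : ℕ) (i j : ℤ)
    (h : i + r = j) : dIter d r i j h ≫ τ j = τ i ≫ dIter d' r i j h := by
  induction r generalizing i with
  | zero =>
    obtain rfl : i = j := by simpa using h
    simp [dIter]
  | succ r ih =>
    rw [dIter, dIter, Category.assoc, ih, ← Category.assoc, hτ, Category.assoc]

/-- Isomorphic linear `n`-complexes have isomorphic contractions. -/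
noncomputable def contractionIso {A : GrAlg K} {n : ℕ} (hn : 2 ≤ n) (m : ℤ)
    (X Y : LinNComplex A n) (τ : ∀ i, X.obj i ≅ Y.obj i)
    (hτ : ∀ i j h, X.d i j h ≫ (τ j).hom = (τ i).hom ≫ Y.d i j h) :
    contraction hn m X ≅ contraction hn m Y :=
  HomologicalComplex.Hom.isoOfComponents (fun j => τ (delta n m j)) (by
    intro i j hij
    have h : i + 1 = j := hij
    simp only [contraction, dif_pos h]
    exact (dIter_naturality X.d Y.d (fun i => (τ i).hom) hτ _ _ _ _).symm)

section

variable {n : ℕ} {I : GrAlg.HomIdeal (pathAlg K Q)}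

/-- The data of a linear complex whose terms are identified with coinduced modules, in terms of a
representation `R`. -/
structure RepModel (L : LinNComplex ((pathAlg K Q).quot I) n) (R : GrRep K Q) where
  iso : ∀ k, L.obj k ≅ coind (idemA I) (R.vert k) k
  comm : ∀ {i j : ℤ} (h : i + 1 = j) {x y y' : ℤ} (hy : j + x + y = 0) (hy' : i + x + y' = 0)
    (hr : y + 1 = y') (f : (L.obj i).comp x) (b : ((pathAlg K Q).quot I).comp y),
    ev hy ((iso j).hom.app x ((L.d i j h).app x f)) b =
      ∑ p, R.arr h p (ev hy' ((iso i).hom.app x f) (((pathAlg K Q).quot I).mul hr b (cls I p)))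

theorem exists_repModel (L : LinNComplex ((pathAlg K Q).quot I) n) (hI : I.comp 1 = ⊥) :
    ∃ R : GrRep K Q, Nonempty (RepModel L R) := by
  let θ : ∀ k, L.obj k ≅ coind (idemA I) ((idemA I).act (L.obj k) (-k)) k := fun k =>
    isoOfBijective (toCoind (idemA I) (L.obj k) k (-k) (by omega)) fun i =>
      ⟨toCoind_injective (by omega) (L.cogenerated k) i,
        toCoind_surjective (quot_finite I) (quot_eq_zero_of_neg I) (quot_span_idem I) (by omega)
          (L.cogenerated k) (L.almostInjective k) i⟩
  choose arr h₁ h₂ h₃ using fun (i j : ℤ) (h : i + 1 = j) =>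
    exists_arrowAction hI h ((θ i).inv ≫ L.d i j h ≫ (θ j).hom)
  refine ⟨⟨fun k => (L.obj k).comp (-k), fun k => (idemA I).act (L.obj k) (-k),
    fun {i j} h => arr i j h, fun {i j} h => h₁ i j h, fun {i j} h => h₂ i j h⟩, ⟨⟨θ, ?_⟩⟩⟩
  intro i j h x y y' hy hy' hr f b
  refine Eq.trans ?_ (h₃ i j h hy hy' hr ((θ i).hom.app x f) b)
  rw [comp_app, comp_app, hom_inv_app]

variable {L : LinNComplex ((pathAlg K Q).quot I) n} {R : GrRep K Q} (S : RepModel L R)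
  {J : GrAlg.HomIdeal (pathAlg K Q).op} (hJ : ∀ i, J.comp i ≤ R.toMod.ann.comp i)

/-- The terms of `L` are those of the linear complex attached to the representation. -/
noncomputable def RepModel.linIso (k : ℤ) : L.obj k ≅ linObj I (R.toMod.descend J hJ) k :=
  S.iso k ≪≫
    { hom := coindMap (idemA I) (R.vert k) ((idemC J).act (R.toMod.descend J hJ) k) k
        LinearMap.id (fun a v => (descend_vert hJ k a v).symm)
      inv := coindMap (idemA I) ((idemC J).act (R.toMod.descend J hJ) k) (R.vert k) k
        LinearMap.id (fun a v => descend_vert hJ k a v)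
      hom_inv_id := rfl
      inv_hom_id := rfl }

theorem RepModel.linIso_comm (i j : ℤ) (h : i + 1 = j) :
    L.d i j h ≫ (S.linIso hJ j).hom =
      (S.linIso hJ i).hom ≫ linD I (R.toMod.descend J hJ) 1 i j h := by
  refine hom_ext fun x f => ev_ext (j := -(j + x)) (by omega) fun b => ?_
  rw [comp_app, comp_app, ev_linD I _ h _ (y' := -(j + x) + 1) (by omega) rfl]
  refine (S.comm h _ (y' := -(j + x) + 1) (by omega) rfl f b).trans ?_
  refine Finset.sum_congr rfl fun p _ => ?_
  exact (descend_arr hJ h p _).symm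

/-- The condition that `n` consecutive differentials compose to zero means that the orthogonal
relations act by zero. -/
theorem RepModel.dualIdeal_le (S : RepModel L R) (i : ℤ) :
    (dualIdeal n I).comp i ≤ R.toMod.ann.comp i := by
  classical
  refine sInf_le ⟨R.toMod.ann, ?_, rfl⟩
  rintro _ ξ ⟨rfl, hξ⟩ i j h (v : R.comp i)
  let J₀ : GrAlg.HomIdeal (pathAlg K Q).op :=
    ⟨fun _ => ⊥, fun h a x hx => by
      rw [(Submodule.mem_bot K).1 hx, map_zero]; exact zero_mem _, fun h a x hx => by
      rw [(Submodule.mem_bot K).1 hx, map_zero]; exact zero_mem _⟩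
  have hJ₀ : ∀ i, J₀.comp i ≤ R.toMod.ann.comp i := fun i => bot_le
  have hD : linD I (R.toMod.descend J₀ hJ₀) n i j h = 0 := by
    have h1 := dIter_naturality L.d (linD I (R.toMod.descend J₀ hJ₀) 1)
      (fun k => (S.linIso hJ₀ k).hom) (S.linIso_comm hJ₀) n i j h
    rw [L.d_zero, Limits.zero_comp, dIter_linD] at h1
    rw [← cancel_epi (S.linIso hJ₀ i).hom, ← h1, Limits.comp_zero]
  have hx : i + -j + n = 0 := by omega
  let w : VertAct K Q (R.comp i) := (idemC J₀).act (R.toMod.descend J₀ hJ₀) i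
  let ξ' : PathOfLength Q (n : ℤ) →₀ K := ξ
  obtain ⟨f, hf⟩ := exists_coind (I := I) (w := w) hx
    (fun p => ξ' p • w.e p.terminus v) (by
      intro x hx
      -- the values of `ξ` on `I_n` vanish at each vertex
      have h1 : ∀ b : Q, (∑ p : PathOfLength Q (n : ℤ),
          if p.terminus = b then ξ' p * x p else 0) = 0 := by
        intro b
        refine Eq.trans ?_ (hξ x hx b)
        exact (Finsupp.sum_fintype ξ' (fun p c => if p.terminus = b then c * x p else 0)
          (by simp)).symm
      rw [Finsupp.linearCombination_apply, Finsupp.sum_fintype _ _ (by simp)]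
      have h2 : ∀ p : PathOfLength Q (n : ℤ), x p • ξ' p • w.e p.terminus v =
          ∑ b, (if p.terminus = b then ξ' p * x p else 0) • w.e b v := by
        intro p
        rw [Finset.sum_eq_single p.terminus, if_pos rfl, smul_smul, mul_comm]
        · intro b _ hb; rw [if_neg (Ne.symm hb), zero_smul]
        · intro hb; exact absurd (Finset.mem_univ _) hb
      rw [Finset.sum_congr rfl fun p _ => h2 p, Finset.sum_comm]
      refine Finset.sum_eq_zero fun b _ => ?_
      rw [← Finset.sum_smul, h1, zero_smul]) (by
      intro p a
      rw [map_smul]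
      split_ifs with ha
      · subst ha; rw [w.self]
      · rw [w.ne (Ne.symm ha), smul_zero])
  have h3 := ev_linD I (R.toMod.descend J₀ hJ₀) h (x := -j) (y := 0) (by omega) hx (zero_add _)
    (show (linObj I (R.toMod.descend J₀ hJ₀) i).comp (-j) from f) ((pathAlg K Q).quot I).one
  rw [hD] at h3
  have h0 : ∀ g : (linObj I (R.toMod.descend J₀ hJ₀) i).comp (-j),
      ev (show j + -j + 0 = 0 by omega)
        ((0 : linObj I (R.toMod.descend J₀ hJ₀) i ⟶ linObj I (R.toMod.descend J₀ hJ₀) j).app _ g)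
          ((pathAlg K Q).quot I).one = 0 := by
    intro g; rw [zero_app, map_zero, LinearMap.zero_apply]
  have h4 := (h0 _).symm.trans h3
  have h5 : R.toMod.act h v ξ = ∑ p, ξ' p • R.pathAct p.path (show i + p.path.length = j by
      rw [p.length_eq, h]) v := by
    change Finsupp.linearCombination K (fun p : PathOfLength Q n => R.pathAct p.path _) ξ' v = _
    rw [Finsupp.linearCombination_apply, Finsupp.sum_fintype _ _ (by simp)]
    exact LinearMap.sum_apply _ _ _
  refine h5.trans (Eq.trans ?_ h4.symm)
  refine Finset.sum_congr rfl fun p _ => ?_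
  have h6 : ∀ (c : K) (y : R.comp i), (R.toMod.descend J₀ hJ₀).act h
      (show (R.toMod.descend J₀ hJ₀).comp i from c • y) (clsOp J₀ p) =
        c • R.pathAct p.path (show i + p.path.length = j by rw [p.length_eq, h]) y := by
    intro c y
    refine (descend_act_clsOp hJ₀ h p (c • y) (by rw [p.length_eq, h])).trans ?_
    rw [map_smul]
  rw [GrAlg.one_mul]
  refine Eq.symm ((congrArg (fun y => (R.toMod.descend J₀ hJ₀).act h y (clsOp J₀ p))
    (hf p)).trans ((h6 _ _).trans ?_))
  congr 1
  refine (congrArg _ (descend_vert hJ₀ i p.terminus v)).trans ?_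
  rw [R.pathAct_source]

end

/-- Every linear `n`-complex of almost injective modules over `KQ/I` is isomorphic to the one
attached to a module over the `n`-homogeneous dual algebra. -/
theorem exists_linComplex_iso {n : ℕ} (hn : 2 ≤ n) {I : GrAlg.HomIdeal (pathAlg K Q)}
    (hI : RelationsOfDegreeGE n I) (L : LinNComplex ((pathAlg K Q).quot I) n) :
    ∃ (Z : GrMod ((pathAlg K Q).op.quot (dualIdeal n I)))
      (τ : ∀ k, L.obj k ≅ (linComplex n I Z).obj k),
      ∀ i j h, L.d i j h ≫ (τ j).hom = (τ i).hom ≫ (linComplex n I Z).d i j h := by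
  have hI1 : I.comp 1 = ⊥ := comp_eq_bot_of_lt hI (by omega)
  obtain ⟨R, ⟨S⟩⟩ := exists_repModel L hI1
  have hJ := RepModel.dualIdeal_le S
  exact ⟨R.toMod.descend _ hJ, S.linIso hJ, S.linIso_comm hJ⟩

end Linear

/-! ### Degrees -/

section Degrees

theorem mem_setU_iff {n : ℕ} {i : ℤ} : i ∈ setU n ↔ (n : ℤ) ∣ i ∨ (n : ℤ) ∣ i - 1 := by
  constructor
  · rintro ⟨k, rfl | rfl⟩
    · exact Or.inl ⟨k, by ring⟩
    · exact Or.inr ⟨k, by ring⟩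
  · rintro (⟨k, hk⟩ | ⟨k, hk⟩)
    · exact ⟨k, Or.inl (by rw [hk]; ring)⟩
    · exact ⟨k, Or.inr (by linear_combination hk)⟩

theorem mem_setS_iff {n : ℕ} {m i : ℤ} : i ∈ setS n m ↔ i - m ∈ setU n := by
  constructor
  · rintro ⟨u, hu, rfl⟩; rwa [add_sub_cancel_left]
  · intro h; exact ⟨_, h, by ring⟩

theorem mem_colon {n : ℕ} (m k : ℤ) : m + k * n ∈ colon (setS n m) (setU n) := by
  intro u hu
  rw [mem_setS_iff]
  rw [mem_setU_iff] at hu ⊢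
  have h : (n : ℤ) ∣ k * n := Dvd.intro_left k rfl
  rcases hu with hu | hu
  · left; rw [show m + k * n + u - m = k * n + u by ring]; exact dvd_add h hu
  · right; rw [show m + k * n + u - m - 1 = k * n + (u - 1) by ring]; exact dvd_add h hu

theorem setU_two (i : ℤ) : i ∈ setU 2 := by
  rw [mem_setU_iff]; omega

theorem colon_cases {n : ℕ} (hn : 2 ≤ n) {m s : ℤ} (hs : s ∈ colon (setS n m) (setU n)) :
    n = 2 ∨ ∃ k : ℤ, s = m + k * n := by
  by_cases h2 : n = 2
  · exact Or.inl h2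
  right
  have h0 := hs 0 ⟨0, Or.inl (by simp)⟩
  have h1 := hs 1 ⟨0, Or.inr (by simp)⟩
  rw [mem_setS_iff, mem_setU_iff] at h0 h1
  have n2 : ¬ (n : ℤ) ∣ 2 := fun h => by have := Int.le_of_dvd (by norm_num) h; omega
  have n1 : ¬ (n : ℤ) ∣ 1 := fun h => by have := Int.le_of_dvd (by norm_num) h; omega
  rcases h0 with h0 | h0
  · obtain ⟨k, hk⟩ := h0
    exact ⟨k, by linear_combination hk⟩
  · exfalso
    rcases h1 with h1 | h1
    · exact n2 (by
        have := dvd_sub h1 h0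
        rwa [show s + 1 - m - (s + 0 - m - 1) = 2 by ring] at this)
    · exact n1 (by
        have := dvd_sub h1 h0
        rwa [show s + 1 - m - 1 - (s + 0 - m - 1) = 1 by ring] at this)

theorem sub_mem_setU {n : ℕ} (hn : 2 ≤ n) {m s i : ℤ} (hs : s ∈ colon (setS n m) (setU n))
    (hi : i ∈ setS n m) : i - s ∈ setU n := by
  rcases colon_cases hn hs with rfl | ⟨k, rfl⟩
  · exact setU_two _
  · rw [mem_setS_iff] at hi
    rw [mem_setU_iff] at hi ⊢
    have h : (n : ℤ) ∣ k * n := Dvd.intro_left k rfl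
    rcases hi with hi | hi
    · left; rw [show i - (m + k * n) = i - m - k * n by ring]; exact dvd_sub hi h
    · right; rw [show i - (m + k * n) - 1 = i - m - 1 - k * n by ring]; exact dvd_sub hi h

end Degrees

/-! ### Extending modules over `C_U` to modules over `C` -/

/-- The graded algebra `C` is concentrated in nonnegative degrees, and is generated in degrees
`0` and `1`. -/
structure GenInDegreeOne (C : GrAlg K) : Prop where
  eq_zero : ∀ i < 0, ∀ a : C.comp i, a = 0
  span_mul : ∀ {i j k : ℤ} (h : i + j = k), 0 ≤ i → 0 ≤ j →
    Submodule.span K {c | ∃ a b, c = C.mul h a b} = ⊤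

namespace GrMod

section Hat

variable {C : GrAlg K} {U : Set ℤ} {hU : RingSupporting U}

theorem proj_coe (i : ℤ) (a : (C.restrict hU).comp i) :
    C.proj hU i (show C.part U i from a : C.part U i) = a :=
  GrAlg.trunc_coe (A := C) (U := U) a

theorem act_act_proj (X : GrMod (C.restrict hU)) {i j k ij jk l : ℤ} (hj : j ∈ U) (hk : k ∈ U)
    (h₁ : i + j = ij) (h₂ : ij + k = l) (h₃ : j + k = jk) (h₄ : i + jk = l) (x : X.comp i)
    (a : C.comp j) (b : C.comp k) :
    X.act h₂ (X.act h₁ x (C.proj hU j a)) (C.proj hU k b) =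
      X.act h₄ x (C.proj hU jk (C.mul h₃ a b)) := by
  rw [X.act_mul h₁ h₂ h₃ h₄, C.restrict_mul_proj hU hj hk]

/-- The module over `C` coinduced from a module over `C_U`; its component of degree `i` is the
product of the spaces `Hom_K(C_j, X_{i+j})`. -/
def coext (X : GrMod (C.restrict hU)) : GrMod C where
  comp := fun i => (p : {p : ℤ × ℤ // i + p.1 = p.2}) → C.comp p.1.1 →ₗ[K] X.comp p.1.2
  act := fun {i j i'} h =>
    LinearMap.mk₂ K (fun f a p => f ⟨(j + p.1.1, p.1.2), by have := p.2; dsimp only; omega⟩ ∘ₗ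
        C.mul rfl a)
      (by intros; rfl) (by intros; rfl)
      (by intros; funext l; ext; simp) (by intros; funext l; ext; simp)
  act_one := by
    intro i h f
    funext ⟨⟨l, q⟩, hl⟩
    ext b
    have key : ∀ (l' : ℤ) (h' : 0 + l = l') (hl' : i + l' = q),
        f ⟨(l', q), hl'⟩ (C.mul h' C.one b) = f ⟨(l, q), hl⟩ b := by
      intro l' h' hl'
      obtain rfl : l = l' := by omega
      rw [C.one_mul]
    exact key _ _ _
  act_mul := by
    intro i j k' ij jk l h₁ h₂ h₃ h₄ f a b
    funext ⟨⟨l', q'⟩, hl'⟩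
    ext c
    dsimp only at hl'
    have key : ∀ (p q : ℤ) (hp : k' + l' = p) (hq : j + p = q) (hq' : jk + l' = q)
        (r : ℤ) (hr : jk + l' = r) (hqr : i + q = q') (hrr : i + r = q'),
        f ⟨(q, q'), hqr⟩ (C.mul hq a (C.mul hp b c)) =
          f ⟨(r, q'), hrr⟩ (C.mul hr (C.mul h₃ a b) c) := by
      intro p q hp hq hq' r hr hqr hrr
      obtain rfl : q = r := by omega
      rw [C.mul_assoc h₃ hr hp hq]
    exact key _ _ rfl rfl (by omega) _ rfl _ (by omega)

/-- Evaluation of an element of `coext X`. -/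
def cev {X : GrMod (C.restrict hU)} {i j l : ℤ} (h : i + j = l) :
    (coext X).comp i →ₗ[K] C.comp j →ₗ[K] X.comp l where
  toFun f := f ⟨(j, l), h⟩
  map_add' _ _ := rfl
  map_smul' _ _ := rfl

variable (X : GrMod (C.restrict hU))

/-- The element `b ↦ x (a b)` of `coext X`. -/
noncomputable def cgen {s d i : ℤ} (h : s + d = i) (x : X.comp s) (a : C.comp d) :
    (coext X).comp i :=
  fun p => X.act (show s + (d + p.1.1) = p.1.2 by have := p.2; omega) x ∘ₗ C.proj hU _ ∘ₗ
    C.mul rfl a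

variable {X}

theorem cev_ext {i : ℤ} {f g : (coext X).comp i}
    (h : ∀ (j l : ℤ) (hl : i + j = l) (b : C.comp j), cev hl f b = cev hl g b) : f = g := by
  funext ⟨⟨j, l⟩, hl⟩
  exact LinearMap.ext (h j l hl)

theorem cev_cgen {s d i j l e : ℤ} (h : s + d = i) (hl : i + j = l) (he : d + j = e)
    (x : X.comp s) (a : C.comp d) (b : C.comp j) :
    cev hl (cgen X h x a) b = X.act (show s + e = l by omega) x (C.proj hU e (C.mul he a b)) := by
  subst he; rfl

theorem cev_act {i j i' l l' q : ℤ} (h : i + j = i') (hl : i' + l = q) (hj : j + l = l')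
    (f : (coext X).comp i) (a : C.comp j) (b : C.comp l) :
    cev hl ((coext X).act h f a) b = cev (show i + l' = q by omega) f (C.mul hj a b) := by
  subst hj; rfl

theorem cgen_act {s d i j i' d' : ℤ} (h : s + d = i) (h' : i + j = i') (hd : d + j = d')
    (x : X.comp s) (a : C.comp d) (c : C.comp j) :
    (coext X).act h' (cgen X h x a) c = cgen X (show s + d' = i' by omega) x (C.mul hd a c) := by
  refine cev_ext fun l q hl b => ?_
  rw [cev_act h' hl rfl, cev_cgen h _ (e := d' + l) (by omega), cev_cgen _ hl rfl,
    C.mul_assoc hd rfl rfl]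

variable (X) (T : Set ℤ)

/-- The submodule of `coext X` generated by the elements `cgen x a` with `x` of degree in `T`. -/
noncomputable def hatSub : Sub (coext X) where
  comp := fun i => Submodule.span K {f | ∃ (s d : ℤ) (_ : s ∈ T) (h : s + d = i) (x : X.comp s)
    (a : C.comp d), f = cgen X h x a}
  act_mem := by
    intro i j i' h f c hf
    induction hf using Submodule.span_induction with
    | mem f hf =>
      obtain ⟨s, d, hs, hd, x, a, rfl⟩ := hf
      rw [cgen_act hd h rfl]
      exact Submodule.subset_span ⟨s, d + j, hs, by omega, x, _, rfl⟩
    | zero => simp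
    | add f g _ _ hf hg => rw [map_add, LinearMap.add_apply]; exact add_mem hf hg
    | smul r f _ hf => rw [map_smul, LinearMap.smul_apply]; exact Submodule.smul_mem _ r hf

/-- The extension of a `C_U`-module `X` to a `C`-module: the submodule of the coinduced module
generated by the functions `b ↦ x (a b)`, where `x` has its degree in `T`. -/
noncomputable def hat : GrMod C := (hatSub X T).toMod

variable {X T}

/-- Evaluation of an element of the extension. -/
noncomputable def hev {i j l : ℤ} (h : i + j = l) :
    (hat X T).comp i →ₗ[K] C.comp j →ₗ[K] X.comp l :=
  cev h ∘ₗ ((hatSub X T).comp i).subtype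

/-- The generators of the extension. -/
noncomputable def hgen {s d i : ℤ} (hs : s ∈ T) (h : s + d = i) (x : X.comp s) (a : C.comp d) :
    (hat X T).comp i :=
  ⟨cgen X h x a, Submodule.subset_span ⟨s, d, hs, h, x, a, rfl⟩⟩

theorem hev_ext {i : ℤ} {f g : (hat X T).comp i}
    (h : ∀ (j l : ℤ) (hl : i + j = l) (b : C.comp j), hev hl f b = hev hl g b) : f = g :=
  Subtype.ext (cev_ext h)

theorem hev_hgen {s d i j l e : ℤ} (hs : s ∈ T) (h : s + d = i) (hl : i + j = l) (he : d + j = e)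
    (x : X.comp s) (a : C.comp d) (b : C.comp j) :
    hev hl (hgen hs h x a) b = X.act (show s + e = l by omega) x (C.proj hU e (C.mul he a b)) :=
  cev_cgen h hl he x a b

theorem hev_act {i j i' l l' q : ℤ} (h : i + j = i') (hl : i' + l = q) (hj : j + l = l')
    (f : (hat X T).comp i) (a : C.comp j) (b : C.comp l) :
    hev hl ((hat X T).act h f a) b = hev (show i + l' = q by omega) f (C.mul hj a b) :=
  cev_act h hl hj f.1 a b

theorem hgen_act {s d i j i' d' : ℤ} (hs : s ∈ T) (h : s + d = i) (h' : i + j = i')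
    (hd : d + j = d') (x : X.comp s) (a : C.comp d) (c : C.comp j) :
    (hat X T).act h' (hgen hs h x a) c = hgen hs (show s + d' = i' by omega) x (C.mul hd a c) :=
  Subtype.ext (cgen_act h h' hd x a c)

theorem hat_induction {i : ℤ} {P : (hat X T).comp i → Prop} (f : (hat X T).comp i) (h0 : P 0)
    (hadd : ∀ f g, P f → P g → P (f + g)) (hsmul : ∀ (c : K) f, P f → P (c • f))
    (hgen' : ∀ s d (hs : s ∈ T) (h : s + d = i) (x : X.comp s) (a : C.comp d),
      P (hgen hs h x a)) : P f := by
  obtain ⟨f, hf⟩ := f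
  induction hf using Submodule.span_induction with
  | mem f hf =>
    obtain ⟨s, d, hs, h, x, a, rfl⟩ := hf
    exact hgen' s d hs h x a
  | zero => exact h0
  | add f g hf hg h₁ h₂ => exact hadd ⟨f, hf⟩ ⟨g, hg⟩ h₁ h₂
  | smul c f hf h₁ => exact hsmul c ⟨f, hf⟩ h₁

/-- The counit `f ↦ f(1)` from the extension to `X`. -/
noncomputable def counit (X : GrMod (C.restrict hU)) (T : Set ℤ) (i : ℤ) :
    (hat X T).comp i →ₗ[K] X.comp i :=
  (hev (add_zero i)).flip C.one

theorem counit_apply {i : ℤ} (f : (hat X T).comp i) :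
    counit X T i f = hev (add_zero i) f C.one := rfl

theorem counit_act {i j l : ℤ} (h : i + j = l) (f : (hat X T).comp i) (c : C.comp j) :
    counit X T l ((hat X T).act h f c) = hev h f c := by
  rw [counit_apply, hev_act h _ (add_zero j), C.mul_one]

theorem counit_hgen {s d i : ℤ} (hs : s ∈ T) (h : s + d = i) (x : X.comp s) (a : C.comp d) :
    counit X T i (hgen hs h x a) = X.act h x (C.proj hU d a) := by
  rw [counit_apply, hev_hgen hs h _ (add_zero d), C.mul_one]

theorem counit_surjective (hX : X.GeneratedIn T) (i : ℤ) :
    Function.Surjective (counit X T i) := by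
  rw [← LinearMap.range_eq_top, eq_top_iff, ← hX.span_eq_top i, Submodule.span_le]
  rintro _ ⟨s, d, hs, h, x, a, rfl⟩
  exact ⟨hgen hs h x (show C.part U d from a).1, by rw [counit_hgen, proj_coe]⟩

/-- An element of the extension, evaluated at a product `b b'`, is the product of its value at `b`
with `b'`, provided that `b'` has degree in `U`, and that the degree of the value at `b`
differs from each element of `T` by an element of `U`. -/
theorem hev_mul {i j j' j'' l l' : ℤ} (hT : ∀ s ∈ T, l - s ∈ U) (hj' : j' ∈ U) (h : i + j'' = l')
    (hj : j + j' = j'') (hl : i + j = l) (f : (hat X T).comp i) (b : C.comp j) (b' : C.comp j') :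
    hev h f (C.mul hj b b') =
      X.act (show l + j' = l' by omega) (hev hl f b) (C.proj hU j' b') := by
  induction f using hat_induction with
  | h0 => simp
  | hadd f g hf hg => simp only [map_add, LinearMap.add_apply, hf, hg]
  | hsmul c f hf => simp only [map_smul, LinearMap.smul_apply, hf]
  | hgen' s d hs h' x a =>
    have hd : d + j ∈ U := by
      have := hT s hs
      rwa [show l - s = d + j by omega] at this
    rw [hev_hgen hs h' h rfl, hev_hgen hs h' hl rfl,
      act_act_proj X hd hj' _ _ (show d + j + j' = d + j'' by omega) (by omega),
      C.mul_assoc rfl _ hj rfl]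

theorem hev_eq_counit {i j l : ℤ} (hT : ∀ s ∈ T, i - s ∈ U) (hj : j ∈ U) (h : i + j = l)
    (f : (hat X T).comp i) (b : C.comp j) :
    hev h f b = X.act h (counit X T i f) (C.proj hU j b) := by
  have := hev_mul hT hj h (zero_add j) (add_zero i) f C.one b
  rwa [C.one_mul] at this

/-- Functoriality of coinduction from `C_U` to `C`. -/
def coextMap {X Y : GrMod (C.restrict hU)} (g : X ⟶ Y) : coext X ⟶ coext Y :=
  (⟨fun i =>
    { toFun := fun f p => g.app p.1.2 ∘ₗ cev p.2 f
      map_add' := fun f f' => by funext p; ext b; exact (g.app p.1.2).map_add _ _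
      map_smul' := fun c f => by funext p; ext b; exact (g.app p.1.2).map_smul _ _ },
    fun _ _ _ => rfl⟩ :
    Hom (coext X) (coext Y))

/-- Functoriality of the extension. -/
noncomputable def hatMap {X Y : GrMod (C.restrict hU)} (T : Set ℤ) (g : X ⟶ Y) :
    hat X T ⟶ hat Y T :=
  (⟨fun i => ((coextMap g).app i).restrict (p := (hatSub X T).comp i) (q := (hatSub Y T).comp i)
    (fun f hf => by
      refine (Submodule.span_le (p := ((hatSub Y T).comp i).comap ((coextMap g).app i))).2 ?_ hf
      rintro _ ⟨s, d, hs, h, x, a, rfl⟩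
      refine Submodule.subset_span ⟨s, d, hs, h, g.app s x, a, ?_⟩
      funext p; ext b
      exact hom_comm g _ x _), fun _ _ _ => rfl⟩ : Hom (hat X T) (hat Y T))

theorem counit_hatMap {X Y : GrMod (C.restrict hU)} (g : X ⟶ Y) (i : ℤ)
    (f : (hat X T).comp i) :
    counit Y T i ((hatMap T g).app i f) = g.app i (counit X T i f) := rfl

/-! ### The kernel condition -/

/-- The map `X_s ⊗ C_1 → X_{s+j}`, `x ⊗ a ↦ x φ(a)`. -/
noncomputable def tens (X : GrMod (C.restrict hU)) {s j l : ℤ} (h : s + j = l)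
    (φ : C.comp 1 →ₗ[K] C.comp j) : X.comp s ⊗[K] C.comp 1 →ₗ[K] X.comp l :=
  TensorProduct.lift ((X.act h).compl₂ (C.proj hU j ∘ₗ φ))

theorem tens_tmul (X : GrMod (C.restrict hU)) {s j l : ℤ} (h : s + j = l)
    (φ : C.comp 1 →ₗ[K] C.comp j) (x : X.comp s) (a : C.comp 1) :
    tens X h φ (x ⊗ₜ a) = X.act h x (C.proj hU j (φ a)) := by
  simp [tens]

/-- The vanishing of `tens` does not depend on how the target degree is written. -/
theorem tens_eq_zero {X : GrMod (C.restrict hU)} {s j l l' : ℤ} (h : s + j = l)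
    (h' : s + j = l') {φ : C.comp 1 →ₗ[K] C.comp j} {z : X.comp s ⊗[K] C.comp 1}
    (hz : tens X h φ z = 0) : tens X h' φ z = 0 := by
  subst h h'; exact hz

/-- The condition `Ker(μ_{s,1}) C_{n-1} ⊆ Ker(μ_{s,n})`, in terms of elements of `X_s ⊗_K C_1`. -/
def KerCond (n : ℤ) (X : GrMod (C.restrict hU)) (s : ℤ) : Prop :=
  ∀ z : X.comp s ⊗[K] C.comp 1, tens X (rfl : s + 1 = s + 1) LinearMap.id z = 0 →
    ∀ b : C.comp (n - 1), tens X (rfl : s + n = s + n) ((C.mul (add_sub_cancel 1 n)).flip b) z = 0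

theorem kerCond_iff (n : ℤ) (X : GrMod (C.restrict hU)) (s : ℤ) :
    KerCond n X s ↔ X.kerMul n s ≤ LinearMap.ker (X.mu (i := s) (j := n) rfl) := by
  have h1 : ∀ z : X.comp s ⊗[K] C.comp 1, X.mu (i := s) (j := 1) rfl ((X.balanced s 1).mkQ z) =
      tens X rfl LinearMap.id z := fun z => rfl
  have h2 : ∀ (z : X.comp s ⊗[K] C.comp 1) (b : C.comp (n - 1)), X.mu (i := s) (j := n) rfl
      (X.rmul s (add_sub_cancel 1 n) b ((X.balanced s 1).mkQ z)) =
        tens X rfl ((C.mul (add_sub_cancel 1 n)).flip b) z := by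
    intro z b
    induction z using TensorProduct.induction_on with
    | zero => simp
    | add y z hy hz => simp only [map_add, hy, hz]
    | tmul x a => rfl
  constructor
  · intro h
    refine Submodule.span_le.2 ?_
    rintro _ ⟨t, ht, b, rfl⟩
    obtain ⟨z, rfl⟩ := (X.balanced s 1).mkQ_surjective t
    rw [LinearMap.mem_ker, h1] at ht
    rw [SetLike.mem_coe, LinearMap.mem_ker, h2, h z ht]
  · intro h z hz b
    rw [← h2]
    exact h (Submodule.subset_span ⟨_, by rw [LinearMap.mem_ker, h1, hz], b, rfl⟩)

end Hat

section Counit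

variable {C : GrAlg K} (hC : GenInDegreeOne C) {n : ℕ} (hn : 2 ≤ n) {m : ℤ}
  {X : GrMod (C.restrict (setU_ringSupporting hn))}

theorem lProp_iff : LProp C hn m X ↔ X.GeneratedIn (colon (setS n m) (setU n)) ∧
    ∀ k : ℤ, KerCond n X (m + k * n) := by
  simp only [LProp, kerCond_iff]

theorem eq_zero_of_notMem (hX : X.GeneratedIn (colon (setS n m) (setU n))) {i : ℤ}
    (hi : i ∉ setS n m) (x : X.comp i) : x = 0 := by
  have hx : x ∈ (⊤ : Submodule K (X.comp i)) := trivial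
  rw [← hX.span_eq_top i] at hx
  refine (Submodule.mem_bot K).1 (Submodule.span_le.2 ?_ hx)
  rintro _ ⟨s, d, hs, h, y, a, rfl⟩
  have hd : d ∉ setU n := fun hd => hi (by have := hs d hd; rwa [h] at this)
  rw [show a = 0 from Subtype.ext (a.2 hd), map_zero]
  exact zero_mem _

include hC in
/-- An element of the extension of degree `m + kn + 1` comes from `X_{m+kn} ⊗ C_1`, as far as its
value at `1` and its values in degrees `j` with `1 + j ∈ U` are concerned. -/
theorem exists_tens (h2 : n ≠ 2) {k i : ℤ} (hi : m + k * n + 1 = i)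
    (f : (hat X (colon (setS n m) (setU n))).comp i) :
    ∃ z : X.comp (m + k * n) ⊗[K] C.comp 1, counit X _ i f = tens X hi LinearMap.id z ∧
      ∀ {j j' l : ℤ} (h : i + j = l) (hj : 1 + j = j') (_ : j' ∈ setU n) (b : C.comp j),
        hev h f b = tens X (show m + k * n + j' = l by omega) ((C.mul hj).flip b) z := by
  let P : (hat X (colon (setS n m) (setU n))).comp i → Prop := fun f =>
    ∃ z : X.comp (m + k * n) ⊗[K] C.comp 1, counit X _ i f = tens X hi LinearMap.id z ∧
      ∀ {j j' l : ℤ} (h : i + j = l) (hj : 1 + j = j') (_ : j' ∈ setU n) (b : C.comp j),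
        hev h f b = tens X (show m + k * n + j' = l by omega) ((C.mul hj).flip b) z
  have h0 : P 0 := ⟨0, by simp, fun _ _ _ _ => by simp⟩
  have hadd : ∀ f g, P f → P g → P (f + g) := by
    rintro f g ⟨z, hz, hz'⟩ ⟨y, hy, hy'⟩
    exact ⟨z + y, by simp only [map_add, hz, hy], fun h hj h' b => by
      simp only [map_add, LinearMap.add_apply, hz' h hj h', hy' h hj h']⟩
  have hsmul : ∀ (c : K) f, P f → P (c • f) := by
    rintro c f ⟨z, hz, hz'⟩
    exact ⟨c • z, by simp only [map_smul, hz], fun h hj h' b => by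
      simp only [map_smul, LinearMap.smul_apply, hz' h hj h']⟩
  change P f
  induction f using hat_induction with
  | h0 => exact h0
  | hadd f g hf hg => exact hadd f g hf hg
  | hsmul c f hf => exact hsmul c f hf
  | hgen' s d hs h x a =>
    obtain ⟨k', rfl⟩ := (colon_cases hn hs).resolve_left h2
    have hlin : ∀ a b : C.comp d, hgen hs h x (a + b) = hgen hs h x a + hgen hs h x b := fun a b =>
      hev_ext fun j l hl c => by
        simp only [map_add, LinearMap.add_apply, hev_hgen hs h hl rfl]
    have hlin' : ∀ (c : K) (b : C.comp d), hgen hs h x (c • b) = c • hgen hs h x b := fun c b =>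
      hev_ext fun j l hl c => by
        simp only [map_smul, LinearMap.smul_apply, hev_hgen hs h hl rfl]
    have hlin0 : hgen hs h x (0 : C.comp d) = 0 := by
      have := hlin' 0 0
      rwa [zero_smul, zero_smul] at this
    by_cases hd : d < 0
    · rw [hC.eq_zero d hd a, hlin0]; exact h0
    have hd1 : 0 ≤ d - 1 := by
      rcases lt_or_eq_of_le (not_lt.1 hd) with h' | h'
      · omega
      · exfalso
        -- `d ≡ 1` modulo `n ≥ 2` excludes `d = 0`
        have : (n : ℤ) ∣ 1 := ⟨k' - k, by linear_combination hi - h - h'⟩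
        have := Int.le_of_dvd (by norm_num) this
        omega
    have hdU : d - 1 ∈ setU n := ⟨k - k', Or.inl (by linear_combination h - hi)⟩
    have h1U : (1 : ℤ) ∈ setU n := ⟨0, Or.inr (by simp)⟩
    have ha : a ∈ (⊤ : Submodule K (C.comp d)) := trivial
    rw [← hC.span_mul (sub_add_cancel d 1) hd1 zero_le_one] at ha
    induction ha using Submodule.span_induction with
    | zero => rw [hlin0]; exact h0
    | add a b _ _ ha hb => rw [hlin]; exact hadd _ _ ha hb
    | smul c a _ ha => rw [hlin']; exact hsmul _ _ ha
    | mem a ha =>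
      obtain ⟨a', a'', rfl⟩ := ha
      refine ⟨X.act (show m + k' * n + (d - 1) = m + k * n by omega) x (C.proj _ _ a') ⊗ₜ a'',
        ?_, ?_⟩
      · rw [counit_hgen, tens_tmul, LinearMap.id_apply,
          act_act_proj X hdU h1U _ _ (sub_add_cancel d 1) h]
      · intro j j' l hl hj hj' b
        rw [hev_hgen hs h hl (show d + j = (d - 1) + j' by omega), tens_tmul,
          act_act_proj X hdU hj' _ _ rfl (by omega), LinearMap.flip_apply,
          C.mul_assoc (sub_add_cancel d 1) _ hj rfl]

include hC in
/-- The kernel condition makes the counit injective in the degrees of `S`: if `f(1) = 0`, then `f`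
vanishes on `C_U`, and for `i ≡ m + 1` modulo `n` also on `C_{n-1}`, hence on `C_{n-1} C_{kn}`. -/
theorem counit_injective (hX : LProp C hn m X) {i : ℤ} (hi : i ∈ setS n m) :
    Function.Injective (counit X (colon (setS n m) (setU n)) i) := by
  obtain ⟨hgen, hker⟩ := (lProp_iff hn).1 hX
  rw [← LinearMap.ker_eq_bot, Submodule.eq_bot_iff]
  intro f hf
  rw [LinearMap.mem_ker] at hf
  refine hev_ext fun j l hl b => ?_
  rw [map_zero, LinearMap.zero_apply]
  by_cases hlS : l ∉ setS n m
  · exact eq_zero_of_notMem hn hgen hlS _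
  rw [not_not] at hlS
  by_cases hj : j ∈ setU n
  · rw [hev_eq_counit (fun s hs => sub_mem_setU hn hs hi) hj, hf, map_zero, LinearMap.zero_apply]
  have h2 : n ≠ 2 := by rintro rfl; exact hj (setU_two j)
  -- the only remaining case is `i ≡ m + 1` and `l ≡ m` modulo `n`
  obtain ⟨k, k', hk, hk'⟩ : ∃ k k' : ℤ, m + k * n + 1 = i ∧ l = m + k' * n := by
    rw [mem_setS_iff] at hi hlS
    obtain ⟨k, hk⟩ := hi
    obtain ⟨k', hk'⟩ := hlS
    have hjU : ∀ c : ℤ, ¬ (j = c * n ∨ j = c * n + 1) := fun c hc => hj ⟨c, hc⟩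
    rcases hk with hk | hk
    · refine absurd ?_ (hjU (k' - k))
      rcases hk' with hk' | hk'
      · left; linear_combination hl + hk' - hk
      · right; linear_combination hl + hk' - hk
    · rcases hk' with hk' | hk'
      · exact ⟨k, k', by linear_combination -hk, by linear_combination hk'⟩
      · exact absurd (Or.inl (by linear_combination hl + hk' - hk)) (hjU (k' - k))
  obtain ⟨z, hz, hz'⟩ := exists_tens hC hn h2 hk f
  have hz0 : tens X (rfl : m + k * n + 1 = _) LinearMap.id z = 0 := by
    subst hk; rw [← hz, hf]
  have hb : ∀ b : C.comp (n - 1), hev (rfl : i + ((n : ℤ) - 1) = _) f b = 0 := by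
    intro b
    have h3 := hker k z hz0 b
    rw [hz' rfl (add_sub_cancel 1 (n : ℤ)) ⟨1, Or.inl (by ring)⟩ b]
    exact tens_eq_zero _ _ h3
  by_cases hjn : j < 0
  · rw [hC.eq_zero j hjn b, map_zero]
  have hj' : j - (n - 1) = (k' - k - 1) * n := by linear_combination hl + hk' + hk
  have hj0 : 0 ≤ j - (n - 1) := by
    rw [hj']
    refine mul_nonneg ?_ (by omega)
    by_contra hneg
    have : (k' - k - 1) * (n : ℤ) ≤ (-1) * n := mul_le_mul_of_nonneg_right (by omega) (by omega)
    omega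
  have hb' : b ∈ (⊤ : Submodule K (C.comp j)) := trivial
  rw [← hC.span_mul (add_sub_cancel ((n : ℤ) - 1) j) (by omega) hj0] at hb'
  have hle : (Submodule.span K {c | ∃ a b, c = C.mul (add_sub_cancel ((n : ℤ) - 1) j) a b}) ≤
      LinearMap.ker (hev hl f) := by
    rw [Submodule.span_le]
    rintro _ ⟨a, c, rfl⟩
    rw [SetLike.mem_coe, LinearMap.mem_ker, hev_mul (l := i + (n - 1)) ?_ ?_ hl _ rfl, hb,
      map_zero, LinearMap.zero_apply]
    · intro s hs
      refine sub_mem_setU hn hs ?_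
      rw [mem_setS_iff]
      exact ⟨k + 1, Or.inl (by rw [← hk]; ring)⟩
    · exact ⟨k' - k - 1, Or.inl hj'⟩
  exact hle hb'

end Counit

/-! ### Restricting modules over `C` to modules over `C_U` -/

section Restrict

variable {C : GrAlg K} {n : ℕ} (hn : 2 ≤ n) (m : ℤ)

open Classical in
/-- The module over `C_U` which agrees with `Z` in the degrees of `S`, and vanishes in the other
degrees; products that leave `S` are replaced by zero. -/
noncomputable def restr (Z : GrMod C) : GrMod (C.restrict (setU_ringSupporting hn)) where
  comp := fun i =>
    ({ carrier := {x | i ∉ setS n m → x = 0}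
       add_mem' := fun {x y} hx hy h => by rw [hx h, hy h, add_zero]
       zero_mem' := fun _ => rfl
       smul_mem' := fun c x hx h => by rw [hx h, smul_zero] } : Submodule K (Z.comp i))
  act := fun {i j k} h =>
    LinearMap.mk₂ K (fun x a => ⟨if k ∈ setS n m then
        Z.act h x.1 (show C.part (setU n) j from a).1 else 0, fun hk => if_neg hk⟩)
      (by
        intro x y a; apply Subtype.ext
        by_cases hk : k ∈ setS n m <;> simp [hk])
      (by
        intro c x a; apply Subtype.ext
        by_cases hk : k ∈ setS n m <;> simp [hk])
      (by
        intro x a b; apply Subtype.ext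
        by_cases hk : k ∈ setS n m
        · simp only [hk, if_true]; exact map_add _ _ _
        · simp [hk])
      (by
        intro c x a; apply Subtype.ext
        by_cases hk : k ∈ setS n m
        · simp only [hk, if_true]; exact map_smul _ _ _
        · simp [hk])
  act_one := by
    intro i h x
    apply Subtype.ext
    change (if i ∈ setS n m then Z.act h x.1 (C.trunc (setU n) 0 C.one).1 else 0) = x.1
    rw [GrAlg.coe_trunc_of_mem (setU_ringSupporting hn).zero_mem, Z.act_one]
    split_ifs with hi
    · rfl
    · exact (x.2 hi).symm
  act_mul := by
    intro i j k ij jk l h₁ h₂ h₃ h₄ x a b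
    apply Subtype.ext
    change (if l ∈ setS n m then Z.act h₂ (if ij ∈ setS n m then
        Z.act h₁ x.1 (show C.part (setU n) j from a).1 else 0)
          (show C.part (setU n) k from b).1 else 0) =
      (if l ∈ setS n m then Z.act h₄ x.1 (C.trunc (setU n) jk (C.mul h₃
        (show C.part (setU n) j from a).1 (show C.part (setU n) k from b).1)).1 else 0)
    by_cases hl : l ∈ setS n m
    swap
    · rw [if_neg hl, if_neg hl]
    rw [if_pos hl, if_pos hl]
    by_cases hi : i ∈ setS n m
    swap
    · rw [x.2 hi]; simp
    by_cases hj : j ∈ setU n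
    swap
    · rw [show (show C.part (setU n) j from a).1 = 0 from a.2 hj]; simp
    by_cases hk : k ∈ setU n
    swap
    · rw [show (show C.part (setU n) k from b).1 = 0 from b.2 hk]; simp
    have key : ij ∈ setS n m ↔ jk ∈ setU n := by
      rw [mem_setS_iff] at hi hl ⊢
      have := (setU_ringSupporting hn).assoc _ hi j hj k hk
        (by rwa [show i - m + j + k = l - m by omega])
      rwa [show i - m + j = ij - m by omega, h₃] at this
    by_cases hij : ij ∈ setS n m
    · rw [if_pos hij, GrAlg.coe_trunc_of_mem (key.1 hij), Z.act_mul h₁ h₂ h₃ h₄]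
    · rw [if_neg hij, GrAlg.trunc_of_notMem (fun h => hij (key.2 h))]
      simp

variable {m} {Z : GrMod C}

/-- The inclusion of the restriction. -/
noncomputable def restrIncl (Z : GrMod C) (i : ℤ) : (restr hn m Z).comp i →ₗ[K] Z.comp i :=
  Submodule.subtype _

theorem restrIncl_injective (i : ℤ) : Function.Injective (restrIncl hn (m := m) Z i) :=
  Subtype.val_injective

theorem restrIncl_surjective {i : ℤ} (hi : i ∈ setS n m) :
    Function.Surjective (restrIncl hn (m := m) Z i) :=
  fun x => ⟨⟨x, fun h => absurd hi h⟩, rfl⟩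

theorem restr_eq_zero {i : ℤ} (hi : i ∉ setS n m) (x : (restr hn m Z).comp i) : x = 0 :=
  Subtype.ext (x.2 hi)

theorem restrIncl_act {i j k : ℤ} (hj : j ∈ setU n) (hk : k ∈ setS n m) (h : i + j = k)
    (x : (restr hn m Z).comp i) (a : C.comp j) :
    restrIncl hn Z k ((restr hn m Z).act h x (C.proj _ j a)) = Z.act h (restrIncl hn Z i x) a := by
  classical
  change (if k ∈ setS n m then Z.act h x.1 (C.trunc (setU n) j a).1 else 0) = _
  rw [if_pos hk, GrAlg.coe_trunc_of_mem hj]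
  rfl

theorem mem_setS_of_colon {i : ℤ} (hi : i ∈ colon (setS n m) (setU n)) {u j : ℤ} (hu : u ∈ setU n)
    (h : i + u = j) : j ∈ setS n m := h ▸ hi u hu

theorem one_mem_setU (n : ℕ) : (1 : ℤ) ∈ setU n := ⟨0, Or.inr (by simp)⟩

theorem natCast_mem_setU (n : ℕ) : (n : ℤ) ∈ setU n := ⟨1, Or.inl (by ring)⟩

/-- Restrictions satisfy the kernel condition, because products with elements of degree `n - 1` are
defined in `Z`. -/
theorem kerCond_restr (Z : GrMod C) (k : ℤ) : KerCond n (restr hn m Z) (m + k * n) := by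
  intro z hz b
  have key : ∀ z : (restr hn m Z).comp (m + k * n) ⊗[K] C.comp 1,
      restrIncl hn Z _ (tens (restr hn m Z) (rfl : m + k * n + n = _)
        ((C.mul (add_sub_cancel 1 (n : ℤ))).flip b) z) =
      Z.act (by omega) (restrIncl hn Z _ (tens (restr hn m Z) (rfl : m + k * n + 1 = _)
        LinearMap.id z)) b := by
    intro z
    induction z using TensorProduct.induction_on with
    | zero => simp
    | add y z hy hz => simp only [map_add, LinearMap.add_apply, hy, hz]
    | tmul x a =>
      rw [tens_tmul, tens_tmul, restrIncl_act hn (natCast_mem_setU n)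
        (mem_setS_of_colon (mem_colon m k) (natCast_mem_setU n) rfl),
        restrIncl_act hn (one_mem_setU n)
        (mem_setS_of_colon (mem_colon m k) (one_mem_setU n) rfl), LinearMap.id_apply,
        LinearMap.flip_apply, Z.act_mul _ _ (add_sub_cancel 1 (n : ℤ)) rfl]
  apply restrIncl_injective hn
  rw [key, hz, map_zero, map_zero, map_zero, LinearMap.zero_apply]

/-- If `Z_{m+kn+1} = Z_{m+kn} C_1`, then the restriction of `Z` belongs to `ℒ(S, U)`. -/
theorem lProp_restr (Z : GrMod C)
    (hZ : 2 < n → ∀ k : ℤ, ∀ v : Z.comp (m + k * n + 1), v ∈ Submodule.span K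
      {y | ∃ (x : Z.comp (m + k * n)) (a : C.comp 1), y = Z.act rfl x a}) :
    LProp C hn m (restr hn m Z) := by
  refine (lProp_iff hn).2 ⟨generatedIn_of_span ?_, kerCond_restr hn Z⟩
  have h0 : ∀ k, k ∈ colon (setS n m) (setU n) → ∀ x : (restr hn m Z).comp k,
      x ∈ Submodule.span K {y : (restr hn m Z).comp k | ∃ (s j : ℤ)
        (_ : s ∈ colon (setS n m) (setU n)) (h : s + j = k) (x : (restr hn m Z).comp s)
        (a : (C.restrict (setU_ringSupporting hn)).comp j), y = (restr hn m Z).act h x a} :=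
    fun k hk x => Submodule.subset_span ⟨k, 0, hk, add_zero k, x, _, (GrMod.act_one _ _ x).symm⟩
  intro i x
  by_cases hi : i ∈ setS n m
  swap
  · rw [restr_eq_zero hn hi x]; exact zero_mem _
  rcases Nat.lt_or_ge 2 n with h2 | h2
  swap
  · obtain rfl : n = 2 := by omega
    exact h0 i (fun u _ => by rw [mem_setS_iff]; exact setU_two _) x
  obtain ⟨u, ⟨k, rfl | rfl⟩, rfl⟩ := hi
  · exact h0 _ (mem_colon m k) x
  · have e : m + (k * n + 1) = m + k * n + 1 := by ring
    revert x
    rw [e]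
    intro x
    have hx := hZ h2 k (restrIncl hn Z _ x)
    have hS0 : m + k * n ∈ setS n m := mem_setS_of_colon (mem_colon m k)
      (setU_ringSupporting hn).zero_mem (add_zero _)
    have hS : m + k * n + 1 ∈ setS n m := mem_setS_of_colon (mem_colon m k) (one_mem_setU n) rfl
    have hle : Submodule.span K {y | ∃ (x : Z.comp (m + k * n)) (a : C.comp 1),
        y = Z.act rfl x a} ≤ (Submodule.span K {y : (restr hn m Z).comp (m + k * n + 1) |
          ∃ (s j : ℤ) (_ : s ∈ colon (setS n m) (setU n)) (h : s + j = m + k * n + 1)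
            (x : (restr hn m Z).comp s) (a : (C.restrict (setU_ringSupporting hn)).comp j),
              y = (restr hn m Z).act h x a}).map (restrIncl hn Z _) := by
      refine Submodule.span_le.2 ?_
      rintro _ ⟨y, a, rfl⟩
      obtain ⟨y, rfl⟩ := restrIncl_surjective hn hS0 y
      refine ⟨_, Submodule.subset_span ⟨_, 1, mem_colon m k, rfl, y, C.proj _ 1 a, rfl⟩, ?_⟩
      rw [restrIncl_act hn (one_mem_setU n) hS]
    obtain ⟨y, hy, hyx⟩ := hle hx
    rwa [restrIncl_injective hn _ hyx] at hy

end Restrict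

/-! ### Modules presented in given degrees -/

section Quotient

variable {A : GrAlg K}

/-- The quotient of a graded module by a graded submodule. -/
def Sub.quot {M : GrMod A} (N : Sub M) : GrMod A where
  comp := fun i => M.comp i ⧸ N.comp i
  act := fun {i j k} h => LinearMap.flip
    { toFun := fun a => (N.comp i).mapQ (N.comp k) ((M.act h).flip a)
        fun x hx => N.act_mem h x a hx
      map_add' := fun a b => Submodule.linearMap_qext _ (LinearMap.ext fun x => by
        change (N.comp k).mkQ (M.act h x (a + b)) =
          (N.comp k).mkQ (M.act h x a) + (N.comp k).mkQ (M.act h x b)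
        rw [map_add, map_add])
      map_smul' := fun c a => Submodule.linearMap_qext _ (LinearMap.ext fun x => by
        change (N.comp k).mkQ (M.act h x (c • a)) = c • (N.comp k).mkQ (M.act h x a)
        rw [map_smul, map_smul]) }
  act_one := by
    intro i h x
    induction x using Submodule.Quotient.induction_on with
    | H x => exact congrArg (N.comp i).mkQ (M.act_one h x)
  act_mul := by
    intro i j k ij jk l h₁ h₂ h₃ h₄ x a b
    induction x using Submodule.Quotient.induction_on with
    | H x => exact congrArg (N.comp l).mkQ (M.act_mul h₁ h₂ h₃ h₄ x a b)

/-- The projection onto the quotient module. -/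
def Sub.mkQ {M : GrMod A} (N : Sub M) : M ⟶ N.quot :=
  (⟨fun i => (N.comp i).mkQ, fun _ _ _ => rfl⟩ : Hom M N.quot)

theorem Sub.mkQ_eq_zero {M : GrMod A} (N : Sub M) {i : ℤ} (x : M.comp i) :
    N.mkQ.app i x = 0 ↔ x ∈ N.comp i :=
  Submodule.Quotient.mk_eq_zero _

/-- The image of a morphism. -/
def rangeSub {M N : GrMod A} (f : M ⟶ N) : Sub N where
  comp := fun i => LinearMap.range (f.app i)
  act_mem := by
    rintro i j k h _ a ⟨x, rfl⟩
    exact ⟨M.act h x a, hom_comm f h x a⟩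

variable {P₁ P₀ M : GrMod A} {f : P₁ ⟶ P₀} {g : P₀ ⟶ M} {w : f ≫ g = 0}

theorem cokernel_surjective (hg : Limits.IsColimit (Limits.CokernelCofork.ofπ g w)) (i : ℤ) :
    Function.Surjective (g.app i) := by
  have h : (rangeSub g).mkQ = 0 := by
    refine Limits.Cofork.IsColimit.hom_ext hg ?_
    change g ≫ _ = g ≫ _
    refine hom_ext fun i x => ?_
    rw [comp_app, comp_app, zero_app]
    exact ((rangeSub g).mkQ_eq_zero _).2 ⟨x, rfl⟩
  intro x
  refine ((rangeSub g).mkQ_eq_zero x).1 ?_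
  rw [h, zero_app]

theorem cokernel_exact (hg : Limits.IsColimit (Limits.CokernelCofork.ofπ g w)) {i : ℤ}
    {x : P₀.comp i} (hx : g.app i x = 0) : ∃ y, f.app i y = x := by
  have h : f ≫ (rangeSub f).mkQ = 0 := by
    refine hom_ext fun i x => ?_
    rw [comp_app, zero_app]
    exact ((rangeSub f).mkQ_eq_zero _).2 ⟨x, rfl⟩
  obtain ⟨l, hl⟩ := Limits.CokernelCofork.IsColimit.desc' hg _ h
  refine ((rangeSub f).mkQ_eq_zero x).1 ?_
  rw [← hl]
  change l.app i (g.app i x) = 0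
  rw [hx, map_zero]

theorem GeneratedIn.of_surjective {T : Set ℤ} {M N : GrMod A} (g : M ⟶ N)
    (hg : ∀ i, Function.Surjective (g.app i)) (hM : M.GeneratedIn T) : N.GeneratedIn T := by
  rintro L ⟨i, hi⟩
  obtain ⟨j, hj, h⟩ := hM
    { comp := fun i => (L.comp i).comap (g.app i)
      act_mem := by
        intro i j k h x a hx
        rw [Submodule.mem_comap] at hx ⊢
        rw [hom_comm]
        exact L.act_mem h _ a hx } ⟨i, fun h => hi (by
          rw [eq_top_iff]
          intro x _
          obtain ⟨y, rfl⟩ := hg i x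
          exact (Submodule.eq_top_iff'.1 h y :))⟩
  refine ⟨j, hj, fun hL => h ?_⟩
  change (L.comp j).comap (g.app j) = ⊤
  rw [hL, Submodule.comap_top]

/-- An algebra as a module over itself. -/
def regular (A : GrAlg K) : GrMod A where
  comp := A.comp
  act := A.mul
  act_one := A.mul_one
  act_mul := A.mul_assoc

end Quotient

section Presented

theorem tens_naturality {C : GrAlg K} {U : Set ℤ} {hU : RingSupporting U}
    {X Y : GrMod (C.restrict hU)} (g : X ⟶ Y) {s j l : ℤ} (h : s + j = l)
    (φ : C.comp 1 →ₗ[K] C.comp j) (z : X.comp s ⊗[K] C.comp 1) :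
    g.app l (tens X h φ z) = tens Y h φ ((g.app s).rTensor (C.comp 1) z) := by
  induction z using TensorProduct.induction_on with
  | zero => simp
  | add y z hy hz => simp only [map_add, hy, hz]
  | tmul x a => rw [tens_tmul, hom_comm, LinearMap.rTensor_tmul, tens_tmul]

/-- The kernel condition is inherited along jointly injective families of morphisms. -/
theorem KerCond.of_injective {C : GrAlg K} {U : Set ℤ} {hU : RingSupporting U} {ι : Type*}
    {X : GrMod (C.restrict hU)} {Y : ι → GrMod (C.restrict hU)} (g : ∀ t, X ⟶ Y t) {n s : ℤ}
    (hg : ∀ x : X.comp (s + n), (∀ t, (g t).app _ x = 0) → x = 0)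
    (hY : ∀ t, KerCond n (Y t) s) : KerCond n X s := by
  intro z hz b
  refine hg _ fun t => ?_
  rw [tens_naturality]
  exact hY t _ (by rw [← tens_naturality, hz, map_zero]) b

variable {C : GrAlg K} (hC : GenInDegreeOne C) {n : ℕ} (hn : 2 ≤ n) {m : ℤ}
  {X : GrMod (C.restrict (setU_ringSupporting hn))}

/-- For `n = 2` the kernel condition is empty, because `U = ℤ` and the product of `C_U` is that
of `C`. -/
theorem kerCond_two {h2 : 2 ≤ 2} (X : GrMod (C.restrict (setU_ringSupporting h2))) (s : ℤ) :
    KerCond (2 : ℕ) X s := by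
  intro z hz b
  have key : ∀ z : X.comp s ⊗[K] C.comp 1,
      tens X (rfl : s + ((2 : ℕ) : ℤ) = _) ((C.mul (add_sub_cancel 1 ((2 : ℕ) : ℤ))).flip b) z =
      X.act (by omega) (tens X (rfl : s + 1 = _) LinearMap.id z) (C.proj _ _ b) := by
    intro z
    induction z using TensorProduct.induction_on with
    | zero => simp
    | add y z hy hz => simp only [map_add, LinearMap.add_apply, hy, hz]
    | tmul x a =>
      rw [tens_tmul, tens_tmul, LinearMap.id_apply, act_act_proj X (setU_two _) (setU_two _) _ _
        (add_sub_cancel 1 ((2 : ℕ) : ℤ)) rfl]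
      rfl
  rw [key, hz, map_zero, LinearMap.zero_apply]

/-- The morphism to a generated module `X` from the restriction of a shift of `C` which is given by
an element of `X_s`. -/
noncomputable def freeHom (hX : X.GeneratedIn (colon (setS n m) (setU n))) {s : ℤ}
    (hs : s ∈ colon (setS n m) (setU n)) (x : X.comp s) :
    restr hn m ((regular C).shift (-s)) ⟶ X :=
  (⟨fun i => X.act (show s + (-s + i) = i by omega) x ∘ₗ C.proj _ (-s + i) ∘ₗ
      restrIncl hn ((regular C).shift (-s)) i, by
    intro i j k h y a
    by_cases hk : k ∈ setS n m
    swap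
    · exact (eq_zero_of_notMem hn hX hk _).trans (eq_zero_of_notMem hn hX hk _).symm
    by_cases hi : i ∈ setS n m
    swap
    · rw [restr_eq_zero hn hi y]; simp
    by_cases hj : j ∈ setU n
    swap
    · rw [show a = 0 from Subtype.ext (a.2 hj)]; simp
    obtain ⟨a, rfl⟩ : ∃ a', C.proj _ j a' = a := ⟨_, proj_coe j a⟩
    refine (congrArg (fun z => X.act (show s + (-s + k) = k by omega) x (C.proj _ (-s + k) z))
      (restrIncl_act hn hj hk h y a)).trans ?_
    have hd : -s + i ∈ setU n := by
      have := sub_mem_setU hn hs hi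
      rwa [show i - s = -s + i by ring] at this
    exact (act_act_proj X hd hj (show s + (-s + i) = i by omega) h
      (show -s + i + j = -s + k by omega) (show s + (-s + k) = k by omega) x
      (show C.comp (-s + i) from restrIncl hn ((regular C).shift (-s)) i y) a).symm⟩ :
    Hom (restr hn m ((regular C).shift (-s))) X)

/-- Projective modules generated in degrees belonging to `(S : U)` satisfy the kernel condition:
they are direct summands of direct sums of restrictions of shifts of `C`. -/
theorem kerCond_projective [Projective X] (hX : X.GeneratedIn (colon (setS n m) (setU n))) (k : ℤ) :
    KerCond n X (m + k * n) := by
  let T := Σ s : colon (setS n m) (setU n), X.comp s.1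
  let F : T → GrMod (C.restrict (setU_ringSupporting hn)) := fun t =>
    restr hn m ((regular C).shift (-t.1.1))
  let π : coprod F ⟶ X := coprodDesc F fun t => freeHom hn hX t.1.2 t.2
  have hπ : ∀ i, Function.Surjective (π.app i) := by
    intro i
    rw [← LinearMap.range_eq_top, eq_top_iff, ← hX.span_eq_top i, Submodule.span_le]
    rintro _ ⟨s, d, hs, h, x, a, rfl⟩
    obtain rfl : d = -s + i := by omega
    by_cases hd : -s + i ∈ setU n
    swap
    · rw [show a = 0 from Subtype.ext (a.2 hd), map_zero]; exact zero_mem _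
    obtain ⟨y, hy⟩ := restrIncl_surjective hn (Z := (regular C).shift (-s))
      (mem_setS_of_colon hs hd h) (show C.part (setU n) (-s + i) from a).1
    refine ⟨(coprodInj F ⟨⟨s, hs⟩, x⟩).app i y, ?_⟩
    rw [← comp_app, coprodInj_desc]
    change X.act _ x (C.proj _ (-s + i) (restrIncl hn ((regular C).shift (-s)) i y)) = _
    rw [hy]
    exact congrArg _ (proj_coe (-s + i) a)
  have := epi_of_surjective π hπ
  have hσ : ∀ i x, π.app i ((Projective.factorThru (𝟙 X) π).app i x) = x := by
    intro i x
    rw [← comp_app, Projective.factorThru_comp, id_app]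
  refine KerCond.of_injective (fun t : T => Projective.factorThru (𝟙 X) π ≫ coprodProj F t) ?_
    (fun t => kerCond_restr hn _ k)
  intro x hx
  rw [← hσ _ x]
  have : (Projective.factorThru (𝟙 X) π).app _ x = 0 :=
    coprod_ext F fun t => (hx t).trans (map_zero _).symm
  rw [this, map_zero]

include hC in
/-- For a presentation `P₁ ⟶ P₀ ⟶ X`, an element of `Ker μ_{i,1}` lifts to `P₀`, and after
subtracting the image of an element of `P₁ ⊗ C_1` the lift belongs to the kernel of the
multiplication of `P₀`. -/
theorem lProp_of_presentedIn (hX : X.PresentedIn (colon (setS n m) (setU n))) :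
    LProp C hn m X := by
  obtain ⟨P₁, P₀, f, g, w, hP₁, hP₀, hg₁, hg₀, ⟨hc⟩⟩ := hX
  have hgs := cokernel_surjective hc
  refine (lProp_iff hn).2 ⟨hg₀.of_surjective g hgs, fun k => ?_⟩
  rcases eq_or_ne n 2 with rfl | h2
  · exact kerCond_two (h2 := hn) X _
  intro z hz b
  obtain ⟨z, rfl⟩ := LinearMap.rTensor_surjective (C.comp 1) (hgs (m + k * n)) z
  rw [← tens_naturality] at hz
  obtain ⟨y, hy⟩ := cokernel_exact hc hz
  obtain ⟨y, rfl⟩ := counit_surjective hg₁ _ y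
  obtain ⟨t, ht, -⟩ := exists_tens hC hn h2 rfl y
  rw [ht, tens_naturality] at hy
  have h0 := kerCond_projective hn hg₀ k (z - (f.app _).rTensor (C.comp 1) t)
    (by rw [map_sub, hy, sub_self]) b
  rw [map_sub, sub_eq_zero] at h0
  rw [← tens_naturality, h0, ← tens_naturality, ← comp_app, w, zero_app]

end Presented

end GrMod

open GrMod

/-! ### The positions of a contraction -/

section Positions

variable {n : ℕ} {m : ℤ}

theorem delta_even (n : ℕ) (m k : ℤ) : delta n m (2 * k) = m + k * n := by
  unfold delta
  rw [show 2 * k / 2 = k by omega, show 2 * k % 2 = 0 by omega, add_zero]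

theorem delta_odd (n : ℕ) (m k : ℤ) : delta n m (2 * k + 1) = m + k * n + 1 := by
  unfold delta
  rw [show (2 * k + 1) / 2 = k by omega, show (2 * k + 1) % 2 = 1 by omega]

theorem delta_mem_setS (n : ℕ) (m j : ℤ) : delta n m j ∈ setS n m := by
  rcases Int.even_or_odd' j with ⟨k, rfl | rfl⟩
  · exact ⟨_, ⟨k, Or.inl rfl⟩, delta_even n m k⟩
  · exact ⟨_, ⟨k, Or.inr rfl⟩, (delta_odd n m k).trans (add_assoc _ _ _)⟩

theorem exists_delta_eq {i : ℤ} (hi : i ∈ setS n m) : ∃ j, delta n m j = i := by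
  obtain ⟨u, ⟨k, rfl | rfl⟩, rfl⟩ := hi
  · exact ⟨2 * k, delta_even n m k⟩
  · exact ⟨2 * k + 1, (delta_odd n m k).trans (add_assoc _ _ _)⟩

theorem step_even (n : ℕ) (k : ℤ) : step n (2 * k) = 1 := if_pos (by omega)

theorem step_pos (hn : 2 ≤ n) (j : ℤ) : 0 < step n j := by
  unfold step; split_ifs <;> omega

theorem step_lt (hn : 2 ≤ n) (j : ℤ) : step n j < n := by
  unfold step; split_ifs <;> omega

theorem delta_strictMono (hn : 2 ≤ n) (m : ℤ) : StrictMono (delta n m) :=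
  strictMono_int_of_lt_succ fun j => by
    have := delta_add_step hn m j (j + 1) rfl
    have := step_pos hn j
    omega

theorem exists_extend_of_injective {β : ℤ → Type u} [∀ i, Nonempty (β i)] {δ : ℤ → ℤ}
    (hδ : Function.Injective δ) (γ : ∀ j, β (δ j)) : ∃ Γ : ∀ i, β i, ∀ j, Γ (δ j) = γ j := by
  have : ∀ i, ∃ x : β i, ∀ j, δ j = i → HEq x (γ j) := by
    intro i
    by_cases h : ∃ j, δ j = i
    · obtain ⟨j, rfl⟩ := h
      exact ⟨γ j, fun j' h' => by obtain rfl := hδ h'; rfl⟩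
    · exact ⟨Classical.arbitrary _, fun j hj => absurd ⟨j, hj⟩ h⟩
  choose Γ hΓ using this
  exact ⟨Γ, fun j => eq_of_heq (hΓ _ j rfl)⟩

end Positions

/-! ### Morphisms of contractions -/

/-- A family of linear maps `M_i → N_i` that is compatible with the products which start and end in
degrees of `S`. -/
structure GrMod.HomOn {A : GrAlg K} (S : Set ℤ) (M N : GrMod A) where
  app : ∀ i : ℤ, M.comp i →ₗ[K] N.comp i
  comm : ∀ {i j k : ℤ} (_ : i ∈ S) (_ : k ∈ S) (h : i + j = k) (x : M.comp i) (a : A.comp j),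
    app k (M.act h x a) = N.act h (app i x) a

/-- The family underlying a morphism. -/
def GrMod.HomOn.ofHom {A : GrAlg K} (S : Set ℤ) {M N : GrMod A} (f : M ⟶ N) : HomOn S M N where
  app := f.app
  comm := fun _ _ h x a => hom_comm f h x a

section Contraction

variable {Q : Type u} [Quiver.{u} Q] [Fintype Q]
variable {n : ℕ} {I : GrAlg.HomIdeal (pathAlg K Q)} (hn : 2 ≤ n) {m : ℤ}
  {Z Z' : GrMod ((pathAlg K Q).op.quot (dualIdeal n I))}

theorem GrMod.HomOn.vert (Γ : HomOn (setS n m) Z Z') (j : ℤ) (a : Q) (v : Z.comp (delta n m j)) :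
    Γ.app _ (((idemC (dualIdeal n I)).act Z _).e a v) =
      ((idemC (dualIdeal n I)).act Z' _).e a (Γ.app _ v) :=
  Γ.comm (delta_mem_setS n m j) (delta_mem_setS n m j) (add_zero _) v _

/-- The maps between the positions of two contractions that are compatible with the differentials
are compatible with all products, because the dual algebra is generated in degree `1`. -/
theorem contraction_comm {γ : ∀ j, Z.comp (delta n m j) →ₗ[K] Z'.comp (delta n m j)}
    (hγ : ∀ j a v, γ j (((idemC (dualIdeal n I)).act Z _).e a v) =
      ((idemC (dualIdeal n I)).act Z' _).e a (γ j v))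
    (hc : ∀ j (p : PathOfLength Q (step n j)) v,
      γ (j + 1) (Z.act (delta_add_step hn m j _ rfl) v (clsOp _ p)) =
        Z'.act (delta_add_step hn m j _ rfl) (γ j v) (clsOp _ p))
    {j j' : ℤ} (hj : j ≤ j') : ∀ {r : ℤ} (h : delta n m j + r = delta n m j') (v)
      (c : ((pathAlg K Q).op.quot (dualIdeal n I)).comp r),
      γ j' (Z.act h v c) = Z'.act h (γ j v) c := by
  induction j', hj using Int.leInduction with
  | base =>
    intro r h v c
    obtain rfl : r = 0 := by omega
    have hc : c ∈ Submodule.span K (Set.range (clsOp (dualIdeal n I) (i := 0))) := by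
      rw [span_clsOp]; trivial
    induction hc using Submodule.span_induction with
    | mem c hc =>
      obtain ⟨p, rfl⟩ := hc
      rw [p.eq_triv]
      exact hγ j _ v
    | zero => simp
    | add b c _ _ hb hc => simp only [map_add, hb, hc]
    | smul t c _ hc => simp only [map_smul, hc]
  | succ j' hj ih =>
    intro r h v c
    have hs := delta_add_step hn m j' _ rfl
    have hle := (delta_strictMono hn m).monotone hj
    have hr : r - step n j' + step n j' = r := by omega
    have hc' : c ∈ Submodule.span K {c | ∃ a b,
        c = ((pathAlg K Q).op.quot (dualIdeal n I)).mul hr a b} := by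
      rw [quotOp_span_mul _ hr (by omega) (by omega)]; trivial
    induction hc' using Submodule.span_induction with
    | mem c hc' =>
      obtain ⟨a, b, rfl⟩ := hc'
      have h' : delta n m j + (r - step n j') = delta n m j' := by omega
      rw [← Z.act_mul h' hs, ← Z'.act_mul h' hs, ← ih]
      have hb : b ∈ Submodule.span K (Set.range (clsOp (dualIdeal n I) (i := step n j'))) := by
        rw [span_clsOp]; trivial
      induction hb using Submodule.span_induction with
      | mem b hb => obtain ⟨p, rfl⟩ := hb; exact hc j' p _
      | zero => simp
      | add b c _ _ hb hc => simp only [map_add, hb, hc]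
      | smul t c _ hc => simp only [map_smul, hc]
    | zero => simp
    | add b c _ _ hb hc => simp only [map_add, hb, hc]
    | smul t c _ hc => simp only [map_smul, hc]

variable [∀ a b : Q, Finite (a ⟶ b)]

theorem contraction_d (Z : GrMod ((pathAlg K Q).op.quot (dualIdeal n I))) {i j : ℤ}
    (h : i + 1 = j) : (contraction hn m (linComplex n I Z)).d i j =
      linD I Z (step n i) (delta n m i) (delta n m j) (delta_add_step hn m i j h) :=
  (dif_pos h).trans (dIter_linD I Z _ _ _ _)

/-- The morphism of contractions induced by a family of linear maps. -/
noncomputable def contractionHom (Γ : HomOn (setS n m) Z Z') :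
    contraction hn m (linComplex n I Z) ⟶ contraction hn m (linComplex n I Z') where
  f j := coindMap (idemA I) _ _ (delta n m j) (Γ.app _) (Γ.vert j)
  comm' i j h := by
    rw [contraction_d hn Z h, contraction_d hn Z' h]
    exact (linD_coindMap I _ _ _ _ _ fun p v =>
      Γ.comm (delta_mem_setS n m i) (delta_mem_setS n m j) _ v _).symm

theorem contractionHom_injective (hI : I.comp 0 = ⊥) {Γ Γ' : HomOn (setS n m) Z Z'}
    (h : contractionHom hn Γ = contractionHom hn Γ') {i : ℤ} (hi : i ∈ setS n m) :
    Γ.app i = Γ'.app i := by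
  obtain ⟨j, rfl⟩ := exists_delta_eq hi
  ext v
  have hj : delta n m j + -delta n m j + 0 = 0 := by omega
  obtain ⟨f, rfl⟩ := exists_coind_one (w := (idemC (dualIdeal n I)).act Z _) hI hj v
  exact congrArg (fun φ : contraction hn m (linComplex n I Z) ⟶
    contraction hn m (linComplex n I Z') => ev hj ((φ.f j).app _ f) ((pathAlg K Q).quot I).one) h

/-- Every morphism of contractions comes from a family of linear maps. -/
theorem contractionHom_surjective (hI : RelationsOfDegreeGE n I)
    (φ : contraction hn m (linComplex n I Z) ⟶ contraction hn m (linComplex n I Z')) :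
    ∃ Γ : HomOn (setS n m) Z Z', contractionHom hn Γ = φ := by
  have hI0 : I.comp 0 = ⊥ := comp_eq_bot_of_lt hI (by omega)
  choose γ hγ hφ using fun j => exists_coindMap (w := (idemC (dualIdeal n I)).act Z _)
    (w' := (idemC (dualIdeal n I)).act Z' _) (k := delta n m j) hI0 (φ.f j)
  have hc := fun {j j' r} (hj : j ≤ j') => contraction_comm (γ := γ) hn hγ (fun j p v => by
    have h := φ.comm j (j + 1)
    rw [contraction_d hn Z rfl, contraction_d hn Z' rfl, hφ, hφ] at h
    exact coindMap_linD I (delta_add_step hn m j _ rfl)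
      (comp_eq_bot_of_lt hI (by exact_mod_cast step_lt hn j)) (γ j) (hγ j) (γ (j + 1))
      (hγ (j + 1)) h.symm p v) hj (r := r)
  obtain ⟨Γ, hΓ⟩ := exists_extend_of_injective (β := fun i => Z.comp i →ₗ[K] Z'.comp i)
    (delta_strictMono hn m).injective γ
  refine ⟨⟨Γ, ?_⟩, ?_⟩
  · intro i r k hi hk h v c
    by_cases hr : r < 0
    · rw [quotOp_eq_zero_of_neg _ _ hr c]; simp
    obtain ⟨j, rfl⟩ := exists_delta_eq hi
    obtain ⟨j', rfl⟩ := exists_delta_eq hk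
    rw [hΓ, hΓ]
    exact hc ((delta_strictMono hn m).le_iff_le.1 (by omega)) h v c
  · refine HomologicalComplex.hom_ext _ _ fun j => ?_
    rw [hφ]
    refine hom_ext fun i f => ev_ext (j := -(delta n m j + i)) (by omega) fun b => ?_
    exact LinearMap.congr_fun (hΓ j) _

/-- Bijective maps induce isomorphisms of contractions. -/
noncomputable def contractionIsoOfBijective (Γ : HomOn (setS n m) Z Z')
    (hΓ : ∀ i ∈ setS n m, Function.Bijective (Γ.app i)) :
    contraction hn m (linComplex n I Z) ≅ contraction hn m (linComplex n I Z') :=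
  HomologicalComplex.Hom.isoOfComponents
    (fun j =>
      let e := LinearEquiv.ofBijective (Γ.app _) (hΓ _ (delta_mem_setS n m j))
      { hom := (contractionHom hn Γ).f j
        inv := coindMap (idemA I) _ _ (delta n m j) e.symm.toLinearMap (fun a v =>
          e.symm_apply_eq.2 ((Γ.vert j a (e.symm v)).trans
            (congrArg _ (e.apply_symm_apply v))).symm)
        hom_inv_id := hom_ext fun i f => ev_ext (j := -(delta n m j + i)) (by omega) fun b =>
          e.symm_apply_apply _
        inv_hom_id := hom_ext fun i f => ev_ext (j := -(delta n m j + i)) (by omega) fun b =>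
          e.apply_symm_apply _ })
    (fun i j _ => (contractionHom hn Γ).comm i j)

/-! ### Socles and products with elements of degree one -/

/-- The differential of the linear complex of `Z` covers the socle if and only if the corresponding
component of `Z` consists of sums of products with elements of degree `1`. -/
theorem socle_le_range_iff (hI : RelationsOfDegreeGE n I) (hn : 2 ≤ n) {k l : ℤ} (h : k + 1 = l) :
    (∀ i, (linObj I Z l).socle i ≤ LinearMap.range ((linD I Z 1 k l h).app i)) ↔
      ∀ v : Z.comp l, v ∈ Submodule.span K
        {y | ∃ (x : Z.comp k) (a : ((pathAlg K Q).op.quot (dualIdeal n I)).comp 1),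
          y = Z.act h x a} := by
  have hI0 : I.comp 0 = ⊥ := comp_eq_bot_of_lt hI (by omega)
  constructor
  · intro hs v
    have hl : l + -l + 0 = 0 := by omega
    obtain ⟨f, rfl⟩ := exists_coind_one (w := (idemC (dualIdeal n I)).act Z _) hI0 hl v
    obtain ⟨y, rfl⟩ := hs (-l) (show f ∈ (linObj I Z l).socle (-l) from fun j i hj hj0 a => by
      refine ev_ext (j := -j) (by omega) fun b => ?_
      rw [quot_eq_zero_of_neg I _ (by omega) b, map_zero, map_zero])
    rw [ev_linD I Z h hl (y' := 1) (by omega) (zero_add 1)]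
    exact sum_mem fun p _ => Submodule.subset_span ⟨_, _, rfl⟩
  · intro hv i f hf
    by_cases hi : l + i + 0 = 0
    · have hle : Submodule.span K
          {y | ∃ (x : Z.comp k) (a : ((pathAlg K Q).op.quot (dualIdeal n I)).comp 1),
            y = Z.act h x a} ≤
          LinearMap.range ((ev hi).flip ((pathAlg K Q).quot I).one ∘ₗ
            (linD I Z 1 k l h).app i) := by
        refine Submodule.span_le.2 ?_
        rintro _ ⟨x, a, rfl⟩
        have ha : a ∈ Submodule.span K (Set.range (clsOp (dualIdeal n I) (i := 1))) := by
          rw [span_clsOp]; trivial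
        refine (Submodule.span_le (p := (LinearMap.range ((ev hi).flip
          ((pathAlg K Q).quot I).one ∘ₗ (linD I Z 1 k l h).app i)).comap (Z.act h x))).2 ?_ ha
        rintro _ ⟨p, rfl⟩
        obtain ⟨g, hg, -⟩ := exists_linD_eq I Z h (comp_eq_bot_of_lt hI (by omega)) p x hi
        exact ⟨g, hg⟩
      obtain ⟨g, hg⟩ := hle (hv (ev hi f ((pathAlg K Q).quot I).one))
      exact ⟨g, ev_one_ext hi hg⟩
    · have hf0 : f = 0 := by
        refine ev_ext (j := -(l + i)) (by omega) fun b => ?_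
        rcases lt_or_gt_of_ne (show -(l + i) ≠ 0 by omega) with h0 | h0
        · rw [quot_eq_zero_of_neg I _ h0 b, map_zero, map_zero]
        · have := ev_act (show i + -(l + i) = -l by omega) (show l + -l + 0 = 0 by omega)
            (show l + i + -(l + i) = 0 by omega) (add_zero _) f b ((pathAlg K Q).quot I).one
          rw [hf _ _ _ h0, GrAlg.mul_one] at this
          rw [← this]; simp
      rw [hf0]; exact zero_mem _

end Contraction

/-! ### The equivalence -/

section Equivalence

variable {Q : Type u} [Quiver.{u} Q] [Fintype Q]
variable {n : ℕ} {I : GrAlg.HomIdeal (pathAlg K Q)}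

theorem dualAlg_genInDegreeOne (n : ℕ) (I : GrAlg.HomIdeal (pathAlg K Q)) :
    GenInDegreeOne (dualAlg n I) where
  eq_zero := quotOp_eq_zero_of_neg _
  span_mul := quotOp_span_mul _

section

variable {C : GrAlg K} (hC : GenInDegreeOne C) (hn : 2 ≤ n) {m : ℤ}
  {X Y : GrMod (C.restrict (setU_ringSupporting hn))}

include hC in
/-- Between modules of the subcategory `ℒ(S, U)`, a family of maps of the extensions that is
compatible with the products inside `S` comes from a morphism. -/
theorem exists_hatMap_eq (hX : LProp C hn m X) (hY : LProp C hn m Y)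
    (Γ : HomOn (setS n m) (hat X (colon (setS n m) (setU n))) (hat Y (colon (setS n m) (setU n)))) :
    ∃ g : X ⟶ Y, ∀ i ∈ setS n m, (hatMap (colon (setS n m) (setU n)) g).app i = Γ.app i := by
  have hf : ∀ i, ∃ f : X.comp i →ₗ[K] Y.comp i, i ∈ setS n m → ∀ v,
      f (counit X (colon (setS n m) (setU n)) i v) = counit Y _ i (Γ.app i v) := by
    intro i
    by_cases hi : i ∈ setS n m
    swap
    · exact ⟨0, fun h => absurd h hi⟩
    let e := LinearEquiv.ofBijective (counit X (colon (setS n m) (setU n)) i)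
      ⟨counit_injective hC hn hX hi, counit_surjective hX.1 i⟩
    exact ⟨counit Y _ i ∘ₗ Γ.app i ∘ₗ e.symm.toLinearMap, fun _ v =>
      congrArg (fun w => counit Y _ i (Γ.app i w)) (e.symm_apply_apply v)⟩
  choose f hf using hf
  refine ⟨(⟨f, ?_⟩ : Hom X Y), ?_⟩
  · intro i j k h x a
    by_cases hk : k ∈ setS n m
    swap
    · exact (eq_zero_of_notMem hn hY.1 hk _).trans (eq_zero_of_notMem hn hY.1 hk _).symm
    by_cases hi : i ∈ setS n m
    swap
    · rw [eq_zero_of_notMem hn hX.1 hi x]; simp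
    by_cases hj : j ∈ setU n
    swap
    · rw [show a = 0 from Subtype.ext (a.2 hj)]; simp
    obtain ⟨a, rfl⟩ : ∃ a', C.proj _ j a' = a := ⟨_, proj_coe j a⟩
    obtain ⟨v, rfl⟩ := counit_surjective hX.1 i x
    have hT : ∀ s ∈ colon (setS n m) (setU n), i - s ∈ setU n :=
      fun s hs => sub_mem_setU hn hs hi
    rw [← hev_eq_counit hT hj, ← counit_act, hf k hk, hf i hi, ← hev_eq_counit hT hj, ← counit_act,
      Γ.comm hi hk]
  · intro i hi
    ext v
    apply counit_injective hC hn hY hi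
    rw [counit_hatMap]
    exact hf i hi v

/-- The extension of the restriction of `Z` to `S` agrees with `Z` in the degrees of `S`. -/
noncomputable def restrHatHomOn (Z : GrMod C) :
    HomOn (setS n m) (hat (restr hn m Z) (colon (setS n m) (setU n))) Z where
  app := fun i => restrIncl hn Z i ∘ₗ counit _ _ i
  comm := by
    intro i j k hi hk h f c
    rw [LinearMap.comp_apply, LinearMap.comp_apply, counit_act]
    induction f using hat_induction with
    | h0 => simp
    | hadd f g hf hg => simp only [map_add, LinearMap.add_apply, hf, hg]
    | hsmul t f hf => simp only [map_smul, LinearMap.smul_apply, hf]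
    | hgen' s d hs hd x a =>
      have hdU : d ∈ setU n := by
        have := sub_mem_setU hn hs hi
        rwa [show i - s = d by omega] at this
      have heU : d + j ∈ setU n := by
        have := sub_mem_setU hn hs hk
        rwa [show k - s = d + j by omega] at this
      rw [hev_hgen hs hd h rfl, counit_hgen, restrIncl_act hn heU hk, restrIncl_act hn hdU hi,
        Z.act_mul hd h rfl]

include hC in
theorem restrHatHomOn_bijective (Z : GrMod C) (hZ : LProp C hn m (restr hn m Z)) {i : ℤ}
    (hi : i ∈ setS n m) : Function.Bijective ((restrHatHomOn hn (m := m) Z).app i) :=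
  ⟨(restrIncl_injective hn i).comp (counit_injective hC hn hZ hi),
    (restrIncl_surjective hn hi).comp (counit_surjective hZ.1 i)⟩

include hC in
/-- In the degrees `m + kn + 1`, the extension consists of sums of products with elements of
degree `1`. -/
theorem hat_mem_span (h2 : 2 < n) (k : ℤ)
    (f : (hat X (colon (setS n m) (setU n))).comp (m + k * n + 1)) :
    f ∈ Submodule.span K {y | ∃ (x : (hat X (colon (setS n m) (setU n))).comp (m + k * n))
      (a : C.comp 1), y = (hat X (colon (setS n m) (setU n))).act rfl x a} := by
  induction f using hat_induction with
  | h0 => exact zero_mem _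
  | hadd f g hf hg => exact add_mem hf hg
  | hsmul t f hf => exact Submodule.smul_mem _ _ hf
  | hgen' s d hs hd x a =>
    -- Here `d ≡ 1` modulo `n`, so that either `d < 0` or `d ≥ 1`.
    obtain ⟨k', rfl⟩ := (colon_cases hn hs).resolve_left h2.ne'
    by_cases hk : k < k'
    · have : d < 0 := by
        have : (k' - k) * n ≥ 1 * n := by gcongr; omega
        have : (n : ℤ) > 2 := by exact_mod_cast h2
        linarith [sub_mul k' k (n : ℤ)]
      rw [hC.eq_zero d this a]
      have : hgen hs hd x (0 : C.comp d) = 0 := hev_ext fun j l hl b => by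
        rw [hev_hgen hs hd hl rfl]; simp
      rw [this]; exact zero_mem _
    · have hd1 : 0 ≤ d - 1 := by
        have : 0 ≤ (k - k') * (n : ℤ) := mul_nonneg (by omega) (by positivity)
        linarith [sub_mul k k' (n : ℤ)]
      have ha : a ∈ Submodule.span K {c | ∃ a b, c = C.mul (sub_add_cancel d 1) a b} := by
        rw [hC.span_mul _ hd1 zero_le_one]; trivial
      let φ : C.comp d →ₗ[K] (hat X (colon (setS n m) (setU n))).comp (m + k * n + 1) :=
        { toFun := hgen hs hd x
          map_add' := fun a b => hev_ext fun j l hl c => by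
            rw [map_add, LinearMap.add_apply]
            simp only [hev_hgen hs hd hl rfl, map_add, LinearMap.add_apply]
          map_smul' := fun t a => hev_ext fun j l hl c => by
            rw [map_smul, LinearMap.smul_apply]
            simp only [hev_hgen hs hd hl rfl, map_smul, LinearMap.smul_apply, RingHom.id_apply] }
      refine (Submodule.span_le (p := (Submodule.span K _).comap φ)).2 ?_ ha
      rintro _ ⟨a, b, rfl⟩
      exact Submodule.subset_span ⟨hgen hs (by omega) x a, b,
        (hgen_act hs _ rfl (sub_add_cancel d 1) x a b).symm⟩

end

variable [∀ a b : Q, Finite (a ⟶ b)]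

/-- The functor that sends a module over `Λ^!_U` to the contraction of the linear complex of its
extension to `Λ^!`. -/
noncomputable def linFunctor (hn : 2 ≤ n) (m : ℤ) (I : GrAlg.HomIdeal (pathAlg K Q)) :
    GrMod ((dualAlg n I).restrict (setU_ringSupporting hn)) ⥤
      CochainComplex (GrMod ((pathAlg K Q).quot I)) ℤ where
  obj X := contraction hn m (linComplex n I (hat X (colon (setS n m) (setU n))))
  map g := contractionHom hn (HomOn.ofHom _ (hatMap _ g))
  map_id _ := HomologicalComplex.hom_ext _ _ fun _ => rfl
  map_comp _ _ := HomologicalComplex.hom_ext _ _ fun _ => rfl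

/-- The differentials of a contraction cover the socle in odd positions if and only if
`Z_{m+kn+1} = Z_{m+kn} C_1`. -/
theorem contraction_socle (hn : 2 ≤ n) (m : ℤ) (hI : RelationsOfDegreeGE n I)
    (Z : GrMod ((pathAlg K Q).op.quot (dualIdeal n I))) (k : ℤ) :
    (∀ i, ((contraction hn m (linComplex n I Z)).X (2 * k + 1)).socle i ≤ LinearMap.range
      (((contraction hn m (linComplex n I Z)).d (2 * k) (2 * k + 1)).app i)) ↔
      ∀ v : Z.comp (m + k * n + 1), v ∈ Submodule.span K {y | ∃ (x : Z.comp (m + k * n))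
        (a : ((pathAlg K Q).op.quot (dualIdeal n I)).comp 1), y = Z.act rfl x a} := by
  rw [contraction_d hn Z rfl]
  rw [← socle_le_range_iff hI hn (Z := Z) (rfl : m + k * n + 1 = _)]
  have key : ∀ (r a b : ℤ) (h : a + r = b), r = 1 → a = m + k * n → b = m + k * n + 1 →
      ((∀ i, (linObj I Z b).socle i ≤ LinearMap.range ((linD I Z r a b h).app i)) ↔
        ∀ i, (linObj I Z (m + k * n + 1)).socle i ≤
          LinearMap.range ((linD I Z 1 (m + k * n) (m + k * n + 1) rfl).app i)) := by
    rintro r a b h rfl rfl rfl; rfl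
  exact key _ _ _ _ (by rw [step_even]; rfl) (delta_even n m k) (delta_odd n m k)

theorem yProp_linFunctor (hn : 2 ≤ n) (m : ℤ) (hI : RelationsOfDegreeGE n I)
    (X : GrMod ((dualAlg n I).restrict (setU_ringSupporting hn))) :
    YProp ((pathAlg K Q).quot I) hn m ((linFunctor hn m I).obj X) :=
  ⟨⟨_, ⟨Iso.refl _⟩⟩, fun _ =>
    ⟨(linComplex n I _).almostInjective _, (linComplex n I _).cogenerated _⟩,
    fun h2 k => (contraction_socle hn m hI _ k).2
      (hat_mem_span (dualAlg_genInDegreeOne n I) hn h2 k)⟩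

/-- Covering the socle by the image of a differential is invariant under isomorphisms. -/
theorem socle_le_range_of_iso {A : GrAlg K} {Y Y' : CochainComplex (GrMod A) ℤ} (e : Y ≅ Y')
    {j j' : ℤ} (h : ∀ i, (Y'.X j').socle i ≤ LinearMap.range ((Y'.d j j').app i)) (i : ℤ) :
    (Y.X j').socle i ≤ LinearMap.range ((Y.d j j').app i) := by
  intro f hf
  obtain ⟨y, hy⟩ := h i (show (e.hom.f j').app i f ∈ _ from fun l k hl hl0 a => by
    rw [← hom_comm, hf l k hl hl0 a, map_zero])
  refine ⟨(e.inv.f j).app i y, ?_⟩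
  rw [← comp_app, e.inv.comm, comp_app, hy, ← comp_app, ← HomologicalComplex.comp_f,
    e.hom_inv_id]
  rfl

/-- Every complex in `𝒴(S, U)` is the image of the restriction of the module attached to one of its
lifts. -/
theorem exists_linFunctor_iso (hn : 2 ≤ n) (m : ℤ) (hI : RelationsOfDegreeGE n I)
    {Y : CochainComplex (GrMod ((pathAlg K Q).quot I)) ℤ}
    (hY : YProp ((pathAlg K Q).quot I) hn m Y) :
    ∃ X, LProp (dualAlg n I) hn m X ∧ Nonempty ((linFunctor hn m I).obj X ≅ Y) := by
  obtain ⟨⟨L, ⟨e⟩⟩, -, hs⟩ := hY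
  obtain ⟨Z, τ, hτ⟩ := exists_linComplex_iso hn hI L
  let e' := (contractionIso hn m L (linComplex n I Z) τ hτ).symm ≪≫ e
  have hZ : LProp (dualAlg n I) hn m (restr hn m Z) := lProp_restr hn Z fun h2 k =>
    (contraction_socle hn m hI Z k).1 (socle_le_range_of_iso e' (hs h2 k))
  exact ⟨restr hn m Z, hZ, ⟨contractionIsoOfBijective hn (restrHatHomOn hn Z)
    (fun i hi => restrHatHomOn_bijective (dualAlg_genInDegreeOne n I) hn Z hZ hi) ≪≫ e'⟩⟩

/-- The restriction of `linFunctor` to the two subcategories. -/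
noncomputable def linFunctorOn (hn : 2 ≤ n) (m : ℤ) (hI : RelationsOfDegreeGE n I) :
    (LProp (dualAlg n I) hn m).FullSubcategory ⥤
      (YProp ((pathAlg K Q).quot I) hn m).FullSubcategory :=
  ObjectProperty.lift _ (ObjectProperty.ι _ ⋙ linFunctor hn m I)
    fun X => yProp_linFunctor hn m hI X.obj

variable (hn : 2 ≤ n) (m : ℤ) (hI : RelationsOfDegreeGE n I)

theorem linFunctorOn_faithful : (linFunctorOn hn m hI).Faithful where
  map_injective {X Y f g} h := by
    have h' : (linFunctor hn m I).map f.hom = (linFunctor hn m I).map g.hom :=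
      congrArg (fun φ => φ.hom) h
    refine ObjectProperty.hom_ext _ (hom_ext fun i x => ?_)
    by_cases hi : i ∈ setS n m
    · obtain ⟨v, rfl⟩ := counit_surjective X.property.1 i x
      rw [← counit_hatMap, ← counit_hatMap]
      exact congrArg (counit _ _ i) (LinearMap.congr_fun
        (contractionHom_injective hn (comp_eq_bot_of_lt hI (by omega)) h' hi) v)
    · exact (eq_zero_of_notMem hn Y.property.1 hi _).trans
        (eq_zero_of_notMem hn Y.property.1 hi _).symm

theorem linFunctorOn_full : (linFunctorOn hn m hI).Full where
  map_surjective {X Y} φ := by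
    obtain ⟨Γ, hΓ⟩ := contractionHom_surjective hn hI φ.hom
    obtain ⟨g, hg⟩ := exists_hatMap_eq (dualAlg_genInDegreeOne n I) hn X.property Y.property Γ
    refine ⟨ObjectProperty.homMk g, ObjectProperty.hom_ext _ ?_⟩
    refine Eq.trans ?_ hΓ
    refine HomologicalComplex.hom_ext _ _ fun j => hom_ext fun i f =>
      ev_ext (j := -(delta n m j + i)) (by omega) fun b => ?_
    exact LinearMap.congr_fun (hg _ (delta_mem_setS n m j)) _

theorem linFunctorOn_essSurj : (linFunctorOn hn m hI).EssSurj where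
  mem_essImage Y := by
    obtain ⟨X, hX, ⟨e⟩⟩ := exists_linFunctor_iso hn m hI Y.property
    exact ⟨⟨X, hX⟩, ⟨ObjectProperty.isoMk _ e⟩⟩

theorem linFunctorOn_isEquivalence : (linFunctorOn hn m hI).IsEquivalence where
  faithful := linFunctorOn_faithful hn m hI
  full := linFunctorOn_full hn m hI
  essSurj := linFunctorOn_essSurj hn m hI

end Equivalence

end GrDual

theorem mainTheorem2 (K : Type u) [Field K] (Q : Type u) [Quiver.{u} Q] [Fintype Q]
    [∀ a b : Q, Finite (a ⟶ b)] (n : ℕ) (hn : 2 ≤ n) (m : ℤ)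
    (I : GrDual.GrAlg.HomIdeal (GrDual.pathAlg K Q)) (hI : GrDual.RelationsOfDegreeGE n I) :
    Nonempty
      ((GrDual.LProp (GrDual.dualAlg n I) hn m).FullSubcategory ≌
        (GrDual.YProp ((GrDual.pathAlg K Q).quot I) hn m).FullSubcategory) ∧
    ∀ X : GrDual.GrMod ((GrDual.dualAlg n I).restrict (GrDual.setU_ringSupporting hn)),
      X.PresentedIn (GrDual.colon (GrDual.setS n m) (GrDual.setU n)) →
        GrDual.LProp (GrDual.dualAlg n I) hn m X := by
  have := GrDual.linFunctorOn_isEquivalence hn m hI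
  exact ⟨⟨(GrDual.linFunctorOn hn m hI).asEquivalence⟩, fun X hX =>
    GrDual.GrMod.lProp_of_presentedIn (GrDual.dualAlg_genInDegreeOne n I) hn hX⟩
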